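/- All logarithms are to base $2$. A circuit on a finite set of qubits is a finite sequence of layers; a layer is a set of gates with pairwise disjoint supports, each gate being a Clifford gate (Hadamard, phase gate $\mathrm{diag}(1,i)$, or fan-out $X$ with one control and any number of targets), a single-qubit rotation $e^{-i\theta P/2}$ with $P\in\{X,Y,Z\}$ and $\theta\in\mathbb R$, or a Toffoli gate. The depth is the number of all layers; the rotation depth (resp. Toffoli depth) is the number of layers that contain a rotation (resp. a Toffoli gate). A circuit of rotation depth at most $r$ and Toffoli depth at most $t$ is said to have T-depth at most $r\cdot\mathrm{ROT}+t\cdot\mathrm{TOF}$, where $\mathrm{ROT}$ and $\mathrm{TOF}$ are the depths of one rotation and of one Toffoli gate. For $\alpha>0$ an $(\alpha,a,0)$-block-encoding of a $2^n\times 2^n$ matrix $A$ is a unitary on $n+a$ qubits whose block with all $a$ ancillas in $|0\rangle$ (on input and output) is $A/\alpha$. A function on $2^n$ grid points is block-encoded as its diagonal matrix of values. Let $x_j=j/(2^n-1)$, $0\le j<2^n$. There is an absolute constant $K$ such that the following hold. 1. (General.) Let $S,C\ge 1$, and let $\varphi_0,\dots,\varphi_{S-1}$ be linearly independent complex functions on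 $2^n$ grid points, each $\varphi_k$ having a $(\beta_k,a,0)$-block-encoding by a circuit of depth at most $C$. For all $y\in\mathbb C^S$ and all $\alpha>0$ with $\alpha\ge\sum_k|y_k|\beta_k$, the function $\sum_k y_k\varphi_k$ has an $(\alpha,a+b,0)$-block-encoding by a circuit of depth at most $K\,S\,C$ with $b\le K S$ additional ancillas. In 2–5 let $y\in\mathbb C^S$ and let $\alpha>0$ satisfy $\alpha\ge\sum_k|y_k|$. 2. (Fourier-based case.) Let $n\ge1$, $S\ge2$, $k_0\in\mathbb Z$. The function $f(x_j)=\sum_{k=0}^{S-1}y_k e^{i(k_0+k)x_j}$ has an $(\alpha,a,0)$-block-encoding with $a\le KS$, without Toffoli depth, and with T-depth at most $(2S+2\log S-2)\cdot\mathrm{ROT}$. 3. (Monomial-based case.) Let $n\ge3$, $S\ge2$. The function $f(x_j)=\sum_{k=0}^{S-1}y_k x_j^k$ has an $(\alpha,a,0)$-block-encoding with $a\le K(S+\log n)$ and T-depth at most $$(2(S-1)(n+1)-2)\cdot\mathrm{ROT}+(2(S-1)(n+1)(2\log\log n-1)+2n-4\log\log n-2)\cdot\mathrm{TOF}.$$ 4.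 (Composition with the Fourier-based case.) Let $n\ge1$, $S\ge3$, let $f$ be as in 2 and real-valued on the grid, and let $P\in\mathbb R[x]$ have degree $d\ge1$ and $|P|\le1$ on $[-1,1]$. If $P(-x)=(-1)^dP(x)$, then the function $P(f(x_j)/\alpha)$ has a $(1,a,0)$-block-encoding with $a\le KS$ and T-depth at most $$(2S+2\log S-1)d\cdot\mathrm{ROT}+(4\log\log S-2)d\cdot\mathrm{TOF}.$$ For every such $P$, without the parity condition, it has a $(2,a,0)$-block-encoding with $a\le KS$ and at most twice this T-depth. 5. (Composition with the monomial-based case.) Let $n\ge3$, $S\ge2$, let $f$ be as in 3 and real-valued on the grid, and let $P$ be as in 4. If $P(-x)=(-1)^dP(x)$, then the function $P(f(x_j)/\alpha)$ has a $(1,a,0)$-block-encoding with $a\le K(S+\log n)$ and T-depth at most $$(2(S-1)(n+1)-1)d\cdot\mathrm{ROT}+\bigl(2(S-1)(n+1)(2\log\log n-1)+2n+4\log\log(Sn)-4\log\log n-4\bigr)d\cdot\mathrm{TOF}.$$ For every such $P$, without the parity condition, it has a $(2,a,0)$-block-encoding with $a\le K(S+\log n)$ and at most twice this T-depth. -/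

import Mathlib

noncomputable section

namespace Spectral

/-- The base-two logarithm. -/
def lg (x : ℝ) : ℝ := Real.logb 2 x

/-! ### Gates, layers, circuits

`W` is the finite set of wires (qubits); computational basis states are maps `W → Bool`. -/

/-- The matrix of a one-qubit operator `M` applied to wire `q`. -/
def onQubit {W : Type} [Fintype W] [DecidableEq W] (q : W) (M : Matrix Bool Bool ℂ) :
    Matrix (W → Bool) (W → Bool) ℂ :=
  Matrix.of fun x y => if ∀ w, w ≠ q → x w = y w then M (x q) (y q) else 0

/-- The matrix sending each basis state `|y⟩` to the basis state `|g y⟩`. -/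
def ofBasisMap {W : Type} [Fintype W] [DecidableEq W] (g : (W → Bool) → (W → Bool)) :
    Matrix (W → Bool) (W → Bool) ℂ :=
  Matrix.of fun x y => if x = g y then 1 else 0

/-- The three Pauli axes. -/
inductive Axis : Type
  | X
  | Y
  | Z

/-- The Pauli matrices (`false` is `|0⟩`, `true` is `|1⟩`). -/
def pauli : Axis → Matrix Bool Bool ℂ
  | .X => Matrix.of fun b c => if b = c then 0 else 1
  | .Y => Matrix.of fun b c =>
      if b = c then 0 else if b then Complex.I else -Complex.I
  | .Z => Matrix.of fun b c => if b = c then (if b then -1 else 1) else 0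

/-- The rotation `exp (-i θ P / 2) = cos (θ / 2) I - i sin (θ / 2) P` about a Pauli axis. -/
def rotMatrix (p : Axis) (θ : ℝ) : Matrix Bool Bool ℂ :=
  ((Real.cos (θ / 2) : ℝ) : ℂ) • (1 : Matrix Bool Bool ℂ)
    - (Complex.I * ((Real.sin (θ / 2) : ℝ) : ℂ)) • pauli p

/-- The Hadamard matrix. -/
def hadamardMatrix : Matrix Bool Bool ℂ :=
  Matrix.of fun b c => ((1 / Real.sqrt 2 : ℝ) : ℂ) * (if b && c then -1 else 1)

/-- The phase gate `diag (1, i)`. -/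
def phaseMatrix : Matrix Bool Bool ℂ :=
  Matrix.diagonal fun b => if b then Complex.I else 1

/-- The gate set: the Clifford gates Hadamard, phase and fan-out `X` (one control, any set of
targets; a single target is `CX`), single-qubit rotations, and the Toffoli gate. -/
inductive Gate (W : Type) : Type
  | hadamard (q : W)
  | phase (q : W)
  | fanout (c : W) (T : Finset W) (hc : c ∉ T)
  | rotation (p : Axis) (θ : ℝ) (q : W)
  | toffoli (c₁ c₂ t : W) (h₁₂ : c₁ ≠ c₂) (h₁ : c₁ ≠ t) (h₂ : c₂ ≠ t)

namespace Gate

/-- The unitary of a gate. -/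
def matrix {W : Type} [Fintype W] [DecidableEq W] :
    Gate W → Matrix (W → Bool) (W → Bool) ℂ
  | hadamard q => onQubit q hadamardMatrix
  | phase q => onQubit q phaseMatrix
  | fanout c T _ => ofBasisMap fun x w => if w ∈ T then xor (x w) (x c) else x w
  | rotation p θ q => onQubit q (rotMatrix p θ)
  | toffoli c₁ c₂ t _ _ _ =>
      ofBasisMap fun x => Function.update x t (xor (x t) (x c₁ && x c₂))

/-- The wires a gate acts on. -/
def support {W : Type} [DecidableEq W] : Gate W → Finset W
  | hadamard q => {q}
  | phase q => {q}
  | fanout c T _ => insert c T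
  | rotation _ _ q => {q}
  | toffoli c₁ c₂ t _ _ _ => {c₁, c₂, t}

/-- Is the gate a rotation? -/
def isRotation {W : Type} : Gate W → Bool
  | rotation _ _ _ => true
  | _ => false

/-- Is the gate a Toffoli gate? -/
def isToffoli {W : Type} : Gate W → Bool
  | toffoli _ _ _ _ _ _ => true
  | _ => false

end Gate

/-- A layer: gates that act on pairwise disjoint sets of wires, hence in parallel. -/
structure Layer (W : Type) [DecidableEq W] where
  /-- the gates of the layer -/
  gates : List (Gate W)
  /-- they have pairwise disjoint supports -/
  disjoint : gates.Pairwise fun g h => Disjoint g.support h.support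

/-- The unitary of a layer. -/
def Layer.matrix {W : Type} [Fintype W] [DecidableEq W] (L : Layer W) :
    Matrix (W → Bool) (W → Bool) ℂ :=
  (L.gates.map Gate.matrix).prod

/-- A circuit: a list of layers, the head being applied first. -/
abbrev Circuit (W : Type) [DecidableEq W] : Type := List (Layer W)

namespace Circuit

/-- The unitary of a circuit. -/
def matrix {W : Type} [Fintype W] [DecidableEq W] (c : Circuit W) :
    Matrix (W → Bool) (W → Bool) ℂ :=
  ((List.reverse c).map Layer.matrix).prod

/-- The depth: the number of all layers. -/
def depth {W : Type} [DecidableEq W] (c : Circuit W) : ℕ := List.length c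

/-- The rotation depth: the number of layers that contain a rotation. -/
def rotDepth {W : Type} [DecidableEq W] (c : Circuit W) : ℕ :=
  List.countP (fun L : Layer W => L.gates.any Gate.isRotation) c

/-- The Toffoli depth: the number of layers that contain a Toffoli gate. -/
def tofDepth {W : Type} [DecidableEq W] (c : Circuit W) : ℕ :=
  List.countP (fun L : Layer W => L.gates.any Gate.isToffoli) c

end Circuit

/-! ### Block-encodings -/

/-- `U`, acting on `n` data qubits and `a` ancillas, is an `(α, a, 0)`-block-encoding of the
`2 ^ n × 2 ^ n` matrix `A`: it is unitary, and its block in which all ancillas are `|0⟩`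
is `A / α`. -/
def IsBlockEncoding {n a : ℕ} (α : ℝ)
    (U : Matrix (Fin n ⊕ Fin a → Bool) (Fin n ⊕ Fin a → Bool) ℂ)
    (A : Matrix (Fin n → Bool) (Fin n → Bool) ℂ) : Prop :=
  0 < α ∧ U ∈ Matrix.unitaryGroup (Fin n ⊕ Fin a → Bool) ℂ ∧
    ∀ i j : Fin n → Bool,
      U (Sum.elim i fun _ => false) (Sum.elim j fun _ => false) = A i j / (α : ℂ)

/-! ### Grids and bases -/

/-- The point of the uniform grid `{0, 1 / (2 ^ n - 1), …, 1}` of `[0, 1]` whose index has the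
binary digits `b` (`b l` is the digit of weight `2 ^ l`). -/
def gridPoint {n : ℕ} (b : Fin n → Bool) : ℝ :=
  (∑ l : Fin n, if b l then (2 : ℝ) ^ (l : ℕ) else 0) / ((2 : ℝ) ^ n - 1)

/-- The Fourier sum `x ↦ ∑ k < S, y k * exp (i (k₀ + k) x)` on the grid. -/
def fourierSum {n S : ℕ} (k₀ : ℤ) (y : Fin S → ℂ) (b : Fin n → Bool) : ℂ :=
  ∑ k : Fin S,
    y k * Complex.exp (Complex.I * ((k₀ : ℂ) + ((k : ℕ) : ℂ)) * ((gridPoint b : ℝ) : ℂ))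

/-- The sum of monomials `x ↦ ∑ k < S, y k * x ^ k` on the grid. -/
def monomialSum {n S : ℕ} (y : Fin S → ℂ) (b : Fin n → Bool) : ℂ :=
  ∑ k : Fin S, y k * ((gridPoint b : ℝ) : ℂ) ^ (k : ℕ)

/-- Rotation depth in the Fourier case. -/
def fourierRot (S : ℕ) : ℝ := 2 * S + 2 * lg S - 2

/-- Rotation depth in the monomial case. -/
def monomialRot (S n : ℕ) : ℝ := 2 * ((S : ℝ) - 1) * ((n : ℝ) + 1) - 2

/-- Toffoli depth in the monomial case. -/
def monomialTof (S n : ℕ) : ℝ :=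
  2 * ((S : ℝ) - 1) * ((n : ℝ) + 1) * (2 * lg (lg n) - 1) + 2 * n - 4 * lg (lg n) - 2

/-- Rotation depth per degree, composition with the Fourier case. -/
def composedFourierRot (S : ℕ) : ℝ := 2 * S + 2 * lg S - 1

/-- Toffoli depth per degree, composition with the Fourier case. -/
def composedFourierTof (S : ℕ) : ℝ := 4 * lg (lg S) - 2

/-- Rotation depth per degree, composition with the monomial case. -/
def composedMonomialRot (S n : ℕ) : ℝ := 2 * ((S : ℝ) - 1) * ((n : ℝ) + 1) - 1

/-- Toffoli depth per degree, composition with the monomial case. -/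
def composedMonomialTof (S n : ℕ) : ℝ :=
  2 * ((S : ℝ) - 1) * ((n : ℝ) + 1) * (2 * lg (lg n) - 1) + 2 * n
    + 4 * lg (lg ((S : ℝ) * n)) - 4 * lg (lg n) - 4

/-- The diagonal matrix with entries `P (g b / α)`. -/
def composedDiag {n : ℕ} (P : Polynomial ℝ) (g : (Fin n → Bool) → ℝ) (α : ℝ) :
    Matrix (Fin n → Bool) (Fin n → Bool) ℂ :=
  Matrix.diagonal fun b => ((P.eval (g b / α) : ℝ) : ℂ)

end Spectral

end

set_option linter.unusedSectionVars false

/-! Fourier sums. A layer of `Z`-rotations of the data with angles proportional to `2 ^ l`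
multiplies by `exp (-i ψ (1 - 2 x) / 2)`. Flipping all digits negates `1 - 2 x`, so a fan-out from
one ancilla before and after the layer turns it into `diag (h, h⁻¹)` on that ancilla, where `h ^ 2`
is `exp (i x)` up to a constant. Interleaving this signal with one-qubit rotations is quantum signal
processing. Every polynomial `A` with `|A| ≤ 1` on the unit circle arises as a corner of such a
sequence (`exists_angles`): the Fejér–Riesz theorem (`fejer_riesz`) supplies `B` with `|A| ^ 2 + |B|
^ 2 = 1`, and the pair is stripped of one degree at a time (`exists_angles_pair`). A sum of `S`
exponentials has degree `S - 1` and costs rotation depth `2 (S - 1) + 2` on two ancillas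
(`exists_trig_circuit`).

Composition with a Fourier sum. If `f = α w h (exp (i x))` is real, with `|w| = 1`, then `(f / α) ^
2 = |h| ^ 2`. Hence the even or odd part of `P` at `f / α` is again a trigonometric polynomial
bounded by `1`, of degree at most `d (S - 1)` (`exists_composed_trig`), and a single
signal-processing sequence implements it without Toffoli gates. For general `P` a branch qubit
averages the even and the odd part, whence the subnormalisation `2` (`exists_trig_circuit_two`).

Monomials, alone or composed. Both are polynomials `p` in `x`, bounded by `1` on `[0, 1]`, of degree
`D = S - 1` or `d (S - 1)`, so one statement serves both (`exists_polynomial_blockEncoding`). For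
`n` below an absolute threshold, any bounded diagonal is realised by one rotation layer on
exponentially many parity wires, a bounded number of ancillas (`exists_diagonal_circuit`). For
larger `n`, `O (log n)` control qubits select digit `l` with probability `2 ^ l / (2 ^ n - 1)` by
fewer than `n` Toffoli gates (`exists_hasSelector`); the sign of the selected digit has mean `1 - 2
x`. This makes a walk with `cos θ = 1 - 2 x` (`grid_walk`). Signal processing applies `z ^ D * p ((1
- Re z) / 2)` to the walk, and `D` inverse steps remove `z ^ D` (`exists_polynomial_circuit`). The
cost of at most `18 D n` Toffoli layers is within the claimed bound once `lg (lg n) ≥ 5`.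

General bases. This is a linear combination of unitaries. Every gate is, up to a phase, a program of
at most `19` steps that collapses to the identity when certain `Z`-rotations are switched off
(`Gate.hasSwitch`). The programs of a layer run in parallel, and one control switches all rotations
of a row through a fan-out, so control multiplies depth by `95` (`exists_ctrl_circuit`). The weights
are prepared by `S` independent rotated qubits of which the first that is set is marked
(`exists_firstHit_weights`, `lcuMark`). -/

noncomputable section

namespace Spectral

section

open Matrix

/-! ### Tensor products of one-qubit operators and basis maps -/

section Basic

variable {W : Type} [Fintype W] [DecidableEq W]

/-- The tensor product of the one-qubit matrices `M w`. -/
def tens (M : W → Matrix Bool Bool ℂ) : Matrix (W → Bool) (W → Bool) ℂ :=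
  Matrix.of fun x y => ∏ w, M w (x w) (y w)

theorem tens_apply (M : W → Matrix Bool Bool ℂ) (x y : W → Bool) :
    tens M x y = ∏ w, M w (x w) (y w) := rfl

theorem tens_mul (M N : W → Matrix Bool Bool ℂ) :
    tens M * tens N = tens fun w => M w * N w := by
  ext x y
  simp only [tens_apply, Matrix.mul_apply, ← Finset.prod_mul_distrib]
  rw [Finset.prod_univ_sum, Fintype.piFinset_univ]

theorem tens_one : tens (fun _ : W => (1 : Matrix Bool Bool ℂ)) = 1 := by
  ext x y
  rw [tens_apply]
  by_cases h : x = y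
  · subst h; simp
  · obtain ⟨w, hw⟩ := Function.ne_iff.1 h
    rw [Matrix.one_apply_ne h]
    exact Finset.prod_eq_zero (Finset.mem_univ w) (Matrix.one_apply_ne hw)

theorem tens_conjTranspose (M : W → Matrix Bool Bool ℂ) :
    (tens M)ᴴ = tens fun w => (M w)ᴴ := by
  ext x y
  simp [tens_apply, Matrix.conjTranspose_apply]

theorem tens_diagonal (d : W → Bool → ℂ) :
    tens (fun w => Matrix.diagonal (d w)) = Matrix.diagonal fun x => ∏ w, d w (x w) := by
  ext x y
  rw [tens_apply]
  by_cases h : x = y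
  · subst h; simp
  · obtain ⟨w, hw⟩ := Function.ne_iff.1 h
    rw [Matrix.diagonal_apply_ne _ h]
    exact Finset.prod_eq_zero (Finset.mem_univ w) (Matrix.diagonal_apply_ne _ hw)

theorem onQubit_eq_tens (q : W) (M : Matrix Bool Bool ℂ) :
    onQubit q M = tens (Function.update (fun _ => 1) q M) := by
  ext x y
  rw [tens_apply, ← Finset.mul_prod_erase _ _ (Finset.mem_univ q), Function.update_self]
  simp only [onQubit, Matrix.of_apply]
  split_ifs with h
  · rw [Finset.prod_eq_one, mul_one]
    intro w hw
    rw [Function.update_of_ne (Finset.ne_of_mem_erase hw), h w (Finset.ne_of_mem_erase hw),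
      Matrix.one_apply_eq]
  · push Not at h
    obtain ⟨w, hw, hne⟩ := h
    rw [Finset.prod_eq_zero (i := w) (Finset.mem_erase.2 ⟨hw, Finset.mem_univ w⟩), mul_zero]
    rw [Function.update_of_ne hw, Matrix.one_apply_ne hne]

theorem onQubit_mul (q : W) (M N : Matrix Bool Bool ℂ) :
    onQubit q M * onQubit q N = onQubit q (M * N) := by
  simp only [onQubit_eq_tens, tens_mul]
  congr 1
  ext1 w
  by_cases h : w = q
  · subst h; simp
  · simp [Function.update_of_ne h]

theorem onQubit_one (q : W) : onQubit q (1 : Matrix Bool Bool ℂ) = 1 := by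
  rw [onQubit_eq_tens, ← tens_one]
  congr 1
  exact Function.update_eq_self _ _

theorem onQubit_conjTranspose (q : W) (M : Matrix Bool Bool ℂ) :
    (onQubit q M)ᴴ = onQubit q Mᴴ := by
  rw [onQubit_eq_tens, onQubit_eq_tens, tens_conjTranspose]
  congr 1
  ext1 w
  by_cases h : w = q
  · subst h; simp
  · simp [Function.update_of_ne h]

theorem prod_onQubit (M : W → Matrix Bool Bool ℂ) (l : List W) (hl : l.Nodup) :
    (l.map fun w => onQubit w (M w)).prod = tens fun w => if w ∈ l then M w else 1 := by
  induction l with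
  | nil => simp [tens_one]
  | cons a l ih =>
    rw [List.map_cons, List.prod_cons, ih (List.nodup_cons.1 hl).2, onQubit_eq_tens, tens_mul]
    congr 1
    ext1 w
    by_cases h : w = a
    · subst h; simp [(List.nodup_cons.1 hl).1]
    · simp [h]

theorem ofBasisMap_apply (g : (W → Bool) → W → Bool) (x y : W → Bool) :
    ofBasisMap g x y = if x = g y then 1 else 0 := rfl

theorem ofBasisMap_mul (g h : (W → Bool) → W → Bool) :
    ofBasisMap g * ofBasisMap h = ofBasisMap (g ∘ h) := by
  ext x y
  simp [Matrix.mul_apply, ofBasisMap_apply]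

theorem ofBasisMap_id : ofBasisMap (fun x : W → Bool => x) = 1 := by
  ext x y
  simp [ofBasisMap_apply, Matrix.one_apply]

theorem ofBasisMap_unitary (g : (W → Bool) → W → Bool) (hg : Function.Injective g) :
    (ofBasisMap g)ᴴ * ofBasisMap g = 1 := by
  ext x y
  simp only [Matrix.mul_apply, Matrix.conjTranspose_apply, ofBasisMap_apply, Matrix.one_apply]
  simp [apply_ite, hg.eq_iff, eq_comm]

/-- Permuting the basis, applying phases and permuting back only relabels the phases. All
conjugations of diagonal cores by fan-out and Toffoli gates reduce to this. -/
theorem ofBasisMap_conj_diagonal (g h : (W → Bool) → W → Bool) (hgh : ∀ x, h (g x) = x)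
    (d : (W → Bool) → ℂ) :
    ofBasisMap h * Matrix.diagonal d * ofBasisMap g = Matrix.diagonal (d ∘ g) := by
  ext x y
  simp only [Matrix.mul_apply, ofBasisMap_apply, Matrix.diagonal_apply,
    Function.comp_apply]
  simp only [mul_ite, mul_one, mul_zero, Finset.sum_ite_eq', Finset.mem_univ, if_true, hgh]
  by_cases h : x = y
  · subst h; simp
  · simp [h]

end Basic

/-! ### One-qubit rotations -/

theorem rotMatrix_zero (p : Axis) : rotMatrix p 0 = 1 := by
  simp [rotMatrix]

theorem rotMatrix_mul (p : Axis) (θ η : ℝ) :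
    rotMatrix p θ * rotMatrix p η = rotMatrix p (θ + η) := by
  have hc : Real.cos ((θ + η) / 2)
      = Real.cos (θ / 2) * Real.cos (η / 2) - Real.sin (θ / 2) * Real.sin (η / 2) := by
    rw [add_div, Real.cos_add]
  have hs : Real.sin ((θ + η) / 2)
      = Real.sin (θ / 2) * Real.cos (η / 2) + Real.cos (θ / 2) * Real.sin (η / 2) := by
    rw [add_div, Real.sin_add]
  have hI : Complex.I ^ 2 = -1 := Complex.I_sq
  have hI4 : Complex.I ^ 4 = 1 := Complex.I_pow_four
  ext b c
  cases p <;> cases b <;> cases c <;>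
    simp [rotMatrix, pauli, Matrix.mul_apply, hc, hs, -Complex.ofReal_cos,
      -Complex.ofReal_sin] <;> ring_nf <;> simp only [hI, hI4] <;> ring

theorem rotMatrix_conjTranspose (p : Axis) (θ : ℝ) :
    (rotMatrix p θ)ᴴ = rotMatrix p (-θ) := by
  ext b c
  cases p <;> cases b <;> cases c <;>
    simp [rotMatrix, pauli, Matrix.conjTranspose_apply, neg_div, -Complex.ofReal_cos,
      -Complex.ofReal_sin, sub_eq_add_neg]

theorem rotMatrix_Y_apply (θ : ℝ) :
    rotMatrix .Y θ = Matrix.of fun b c =>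
      if b = c then (Real.cos (θ / 2) : ℂ)
        else if b then (Real.sin (θ / 2) : ℂ) else -(Real.sin (θ / 2) : ℂ) := by
  have hI : Complex.I * Complex.I = -1 := Complex.I_mul_I
  ext b c
  cases b <;> cases c <;> simp [rotMatrix, pauli, -Complex.ofReal_cos, -Complex.ofReal_sin] <;>
    first
    | linear_combination (Real.sin (θ / 2) : ℂ) * hI
    | linear_combination (-Real.sin (θ / 2) : ℂ) * hI

/-- The sign `(-1) ^ b`. -/
def sgn (b : Bool) : ℝ := if b then -1 else 1

@[simp] theorem sgn_false : sgn false = 1 := rfl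
@[simp] theorem sgn_true : sgn true = -1 := rfl

theorem sgn_xor (b c : Bool) : sgn (xor b c) = sgn b * sgn c := by
  cases b <;> cases c <;> simp

theorem sgn_mul_self (b : Bool) : sgn b * sgn b = 1 := by
  cases b <;> simp

theorem rotMatrix_Z_eq (θ : ℝ) :
    rotMatrix .Z θ
      = Matrix.diagonal fun b => Complex.exp (-(Complex.I * ((θ / 2 * sgn b : ℝ) : ℂ))) := by
  ext b c
  have h1 : Complex.exp (-(Complex.I * ((θ / 2 : ℝ) : ℂ)))
      = Real.cos (θ / 2) - Complex.I * Real.sin (θ / 2) := by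
    rw [show -(Complex.I * ((θ / 2 : ℝ) : ℂ)) = (((-(θ / 2) : ℝ)) : ℂ) * Complex.I by
      push_cast; ring, Complex.exp_mul_I, ← Complex.ofReal_cos, ← Complex.ofReal_sin]
    simp only [Real.cos_neg, Real.sin_neg]
    push_cast; ring
  have h2 : Complex.exp (-(Complex.I * ((θ / 2 * (-1) : ℝ) : ℂ)))
      = Real.cos (θ / 2) + Complex.I * Real.sin (θ / 2) := by
    rw [show -(Complex.I * ((θ / 2 * (-1) : ℝ) : ℂ)) = (((θ / 2 : ℝ)) : ℂ) * Complex.I by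
      push_cast; ring, Complex.exp_mul_I, ← Complex.ofReal_cos, ← Complex.ofReal_sin]
    ring
  cases b <;> cases c
  · rw [Matrix.diagonal_apply_eq, sgn_false, mul_one, h1]
    simp [rotMatrix, pauli]
  · rw [Matrix.diagonal_apply_ne _ (by decide)]
    simp [rotMatrix, pauli]
  · rw [Matrix.diagonal_apply_ne _ (by decide)]
    simp [rotMatrix, pauli]
  · rw [Matrix.diagonal_apply_eq, sgn_true, h2]
    simp [rotMatrix, pauli]

theorem sqrt_two_inv_mul : ((1 / Real.sqrt 2 : ℝ) : ℂ) * ((1 / Real.sqrt 2 : ℝ) : ℂ) = 1 / 2 := by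
  rw [← Complex.ofReal_mul, div_mul_div_comm, Real.mul_self_sqrt (by norm_num)]
  norm_num

theorem hadamardMatrix_mul_self : hadamardMatrix * hadamardMatrix = 1 := by
  have h := sqrt_two_inv_mul
  ext b c
  cases b <;> cases c <;> simp only [hadamardMatrix, Matrix.mul_apply, Matrix.of_apply,
    Fintype.sum_bool, Bool.and_true, Bool.and_false, Bool.false_eq_true, if_true, if_false,
    Matrix.one_apply, reduceCtorEq] <;> first | linear_combination 2 * h | ring

theorem hadamardMatrix_conjTranspose : hadamardMatrixᴴ = hadamardMatrix := by
  ext b c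
  cases b <;> cases c <;>
    simp [hadamardMatrix, Matrix.conjTranspose_apply]

theorem hadamard_conj_X : hadamardMatrix * pauli .X * hadamardMatrix = pauli .Z := by
  have h := sqrt_two_inv_mul
  ext b c
  cases b <;> cases c <;> simp only [hadamardMatrix, Matrix.mul_apply, Matrix.of_apply,
    Fintype.sum_bool, Bool.and_true, Bool.and_false, Bool.false_eq_true, if_true, if_false,
    pauli, reduceCtorEq] <;> first | linear_combination 2 * h | linear_combination (-2) * h | ring

theorem phaseMatrix_unitary : phaseMatrixᴴ * phaseMatrix = 1 := by
  ext b c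
  cases b <;> cases c <;> simp [phaseMatrix, Matrix.mul_apply, Matrix.diagonal_apply]

theorem phaseMatrix_mul_self : phaseMatrix * phaseMatrix = pauli .Z := by
  ext b c
  cases b <;> cases c <;> simp [phaseMatrix, pauli]

/-- `X` anticommutes with `Y` (and with `Z`, below), so a pair of `CX` gates makes the sign of an
angle depend on their control. -/
theorem pauli_X_conj_Y (θ : ℝ) :
    pauli .X * rotMatrix .Y θ * pauli .X = rotMatrix .Y (-θ) := by
  ext b c
  cases b <;> cases c <;>
    simp [rotMatrix_Y_apply, pauli, Matrix.mul_apply, neg_div, -Complex.ofReal_cos,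
      -Complex.ofReal_sin]

theorem pauli_X_conj_Z (θ : ℝ) :
    pauli .X * rotMatrix .Z θ * pauli .X = rotMatrix .Z (-θ) := by
  ext b c
  cases b <;> cases c <;>
    simp [rotMatrix_Z_eq, pauli, Matrix.mul_apply, neg_div]

end

section

open Matrix

/-! ### Layers and circuits -/

section Circuits

variable {W : Type} [Fintype W] [DecidableEq W]

theorem fanout_map_involutive (c : W) (T : Finset W) (hc : c ∉ T) (x : W → Bool) :
    (fun w => if w ∈ T then xor ((fun w => if w ∈ T then xor (x w) (x c) else x w) w)
      ((fun w => if w ∈ T then xor (x w) (x c) else x w) c)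
      else (fun w => if w ∈ T then xor (x w) (x c) else x w) w) = x := by
  funext w
  by_cases h : w ∈ T <;> simp [h, hc]

/-- The basis map of a Toffoli gate. -/
def tofMap (c₁ c₂ t : W) (x : W → Bool) : W → Bool :=
  Function.update x t (xor (x t) (x c₁ && x c₂))

/-- The basis map of a fan-out gate. -/
def fanMap (c : W) (T : Finset W) (x : W → Bool) : W → Bool :=
  fun w => if w ∈ T then xor (x w) (x c) else x w

theorem fanMap_fanMap (c : W) (T : Finset W) (hc : c ∉ T) (x : W → Bool) :
    fanMap c T (fanMap c T x) = x := fanout_map_involutive c T hc x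

theorem tofMap_tofMap (c₁ c₂ t : W) (h₁ : c₁ ≠ t) (h₂ : c₂ ≠ t) (x : W → Bool) :
    tofMap c₁ c₂ t (tofMap c₁ c₂ t x) = x := by
  funext w
  by_cases h : w = t
  · subst h; simp [tofMap, Function.update_of_ne h₁, Function.update_of_ne h₂]
  · simp [tofMap, Function.update_of_ne h]

theorem matrix_fanout (c : W) (T : Finset W) (hc : c ∉ T) :
    (Gate.fanout c T hc).matrix = ofBasisMap (fanMap c T) := rfl

theorem matrix_toffoli (c₁ c₂ t : W) (h₁₂ h₁ h₂) :
    (Gate.toffoli c₁ c₂ t h₁₂ h₁ h₂).matrix = ofBasisMap (tofMap c₁ c₂ t) := rfl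

theorem ofBasisMap_mul_self (g : (W → Bool) → W → Bool) (hg : ∀ x, g (g x) = x) :
    ofBasisMap g * ofBasisMap g = 1 := by
  rw [ofBasisMap_mul, ← ofBasisMap_id]
  congr 1
  funext x
  exact hg x

theorem onQubit_unitary (q : W) {M : Matrix Bool Bool ℂ} (hM : Mᴴ * M = 1) :
    (onQubit q M)ᴴ * onQubit q M = 1 := by
  rw [onQubit_conjTranspose, onQubit_mul, hM, onQubit_one]

theorem rotMatrix_unitary (p : Axis) (θ : ℝ) : (rotMatrix p θ)ᴴ * rotMatrix p θ = 1 := by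
  rw [rotMatrix_conjTranspose, rotMatrix_mul, neg_add_cancel, rotMatrix_zero]

theorem Gate.matrix_unitary (g : Gate W) : (g.matrix)ᴴ * g.matrix = 1 := by
  cases g with
  | hadamard q =>
    exact onQubit_unitary q (by rw [hadamardMatrix_conjTranspose, hadamardMatrix_mul_self])
  | phase q => exact onQubit_unitary q phaseMatrix_unitary
  | fanout c T hc =>
    exact ofBasisMap_unitary _ (Function.LeftInverse.injective (fanMap_fanMap c T hc))
  | rotation p θ q => exact onQubit_unitary q (rotMatrix_unitary p θ)
  | toffoli c₁ c₂ t h₁₂ h₁ h₂ =>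
    exact ofBasisMap_unitary _ (Function.LeftInverse.injective (tofMap_tofMap c₁ c₂ t h₁ h₂))

theorem list_prod_unitary (l : List (Matrix (W → Bool) (W → Bool) ℂ))
    (h : ∀ M ∈ l, Mᴴ * M = 1) : (l.prod)ᴴ * l.prod = 1 := by
  induction l with
  | nil => simp
  | cons a l ih =>
    rw [List.prod_cons, Matrix.conjTranspose_mul, Matrix.mul_assoc, ← Matrix.mul_assoc _ a,
      h a (by simp), Matrix.one_mul, ih fun M hM => h M (by simp [hM])]

theorem Layer.matrix_unitary (L : Layer W) : (L.matrix)ᴴ * L.matrix = 1 := by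
  apply list_prod_unitary
  intro M hM
  obtain ⟨g, -, rfl⟩ := List.mem_map.1 hM
  exact g.matrix_unitary

theorem Circuit.matrix_unitary (c : Circuit W) : (c.matrix)ᴴ * c.matrix = 1 := by
  apply list_prod_unitary
  intro M hM
  obtain ⟨g, -, rfl⟩ := List.mem_map.1 hM
  exact g.matrix_unitary

theorem Circuit.matrix_mem_unitaryGroup (c : Circuit W) :
    c.matrix ∈ Matrix.unitaryGroup (W → Bool) ℂ :=
  Matrix.mem_unitaryGroup_iff'.2 c.matrix_unitary

theorem Circuit.matrix_nil : Circuit.matrix ([] : Circuit W) = 1 := by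
  simp [Circuit.matrix]

theorem Circuit.matrix_append (c d : Circuit W) :
    Circuit.matrix (c ++ d) = Circuit.matrix d * Circuit.matrix c := by
  simp [Circuit.matrix, List.reverse_append]

theorem Circuit.matrix_cons (L : Layer W) (c : Circuit W) :
    Circuit.matrix (L :: c) = Circuit.matrix c * L.matrix := by
  simp [Circuit.matrix]

theorem Circuit.matrix_singleton (L : Layer W) : Circuit.matrix [L] = L.matrix := by
  simp [Circuit.matrix]

theorem Circuit.rotDepth_append (c d : Circuit W) :
    Circuit.rotDepth (c ++ d) = Circuit.rotDepth c + Circuit.rotDepth d :=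
  List.countP_append ..

theorem Circuit.tofDepth_append (c d : Circuit W) :
    Circuit.tofDepth (c ++ d) = Circuit.tofDepth c + Circuit.tofDepth d :=
  List.countP_append ..

theorem Circuit.depth_append (c d : Circuit W) :
    Circuit.depth (c ++ d) = Circuit.depth c + Circuit.depth d :=
  List.length_append ..

/-- The layer with the single gate `g`. -/
def Layer.single (g : Gate W) : Layer W := ⟨[g], List.pairwise_singleton _ _⟩

theorem Layer.matrix_single (g : Gate W) : (Layer.single g).matrix = g.matrix := by
  simp [Layer.single, Layer.matrix]

/-- A circuit given by a sequence of gates, one to a layer. -/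
def seq (l : List (Gate W)) : Circuit W := l.map Layer.single

theorem matrix_seq_cons (g : Gate W) (l : List (Gate W)) :
    (seq (g :: l)).matrix = (seq l).matrix * g.matrix := by
  rw [seq, List.map_cons, Circuit.matrix_cons, Layer.matrix_single, seq]

theorem matrix_seq_nil : (seq ([] : List (Gate W))).matrix = 1 := Circuit.matrix_nil

theorem rotDepth_seq (l : List (Gate W)) : (seq l).rotDepth = l.countP Gate.isRotation := by
  simp [seq, Circuit.rotDepth, List.countP_map, Layer.single, Function.comp_def]

theorem tofDepth_seq (l : List (Gate W)) : (seq l).tofDepth = l.countP Gate.isToffoli := by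
  simp [seq, Circuit.tofDepth, List.countP_map, Layer.single, Function.comp_def]

theorem depth_seq (l : List (Gate W)) : (seq l).depth = l.length := by
  simp [seq, Circuit.depth]

/-- A layer with one rotation on every wire. -/
def rotLayer (p : W → Axis) (θ : W → ℝ) : Layer W where
  gates := (Finset.univ : Finset W).toList.map fun w => Gate.rotation (p w) (θ w) w
  disjoint := by
    rw [List.pairwise_map]
    refine (Finset.nodup_toList _).imp fun h => ?_
    simpa [Gate.support] using h

theorem matrix_rotLayer (p : W → Axis) (θ : W → ℝ) :
    (rotLayer p θ).matrix = tens fun w => rotMatrix (p w) (θ w) := by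
  have h := prod_onQubit (fun w => rotMatrix (p w) (θ w)) (Finset.univ : Finset W).toList
    (Finset.nodup_toList _)
  simp only [Finset.mem_toList, Finset.mem_univ, if_true] at h
  rw [← h]
  simp [Layer.matrix, rotLayer, Function.comp_def, Gate.matrix]

theorem rotDepth_rotLayer_le (p : W → Axis) (θ : W → ℝ) :
    Circuit.rotDepth [rotLayer p θ] ≤ 1 := List.countP_le_length

theorem tofDepth_rotLayer (p : W → Axis) (θ : W → ℝ) :
    Circuit.tofDepth [rotLayer p θ] = 0 := by
  simp [Circuit.tofDepth, rotLayer, Gate.isToffoli]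

/-! ### Operators on one wire controlled by the others -/

/-- The operator that acts on the wire `q` by the matrix `N x`, where `x` are the values of the
wires (with `x q` replaced by `0`). -/
def mux (q : W) (N : (W → Bool) → Matrix Bool Bool ℂ) : Matrix (W → Bool) (W → Bool) ℂ :=
  Matrix.of fun x y => if ∀ w, w ≠ q → x w = y w then
    N (Function.update y q false) (x q) (y q) else 0

theorem update_eq_of_agree {q : W} {x y : W → Bool} (h : ∀ w, w ≠ q → x w = y w) (s : Bool) :
    Function.update x q s = Function.update y q s := by
  funext w
  by_cases hw : w = q
  · subst hw; simp
  · simp [Function.update_of_ne hw, h w hw]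

theorem mux_mul (q : W) (M N : (W → Bool) → Matrix Bool Bool ℂ) :
    mux q M * mux q N = mux q fun x => M x * N x := by
  ext x y
  simp only [Matrix.mul_apply, mux, Matrix.of_apply]
  by_cases h : ∀ w, w ≠ q → x w = y w
  · rw [if_pos h]
    -- Only the two intermediate states that agree with `y` off `q` contribute.
    have hinj : Function.Injective fun s : Bool => Function.update y q s :=
      fun s t hst => by simpa using congrFun hst q
    rw [← Fintype.sum_of_injective (fun s : Bool => Function.update y q s) hinj
      (fun s => M (Function.update y q false) (x q) s * N (Function.update y q false) s (y q))]
    · intro z hz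
      split_ifs with h1 h2
      · exact absurd ⟨z q, by
          funext w
          by_cases hw : w = q
          · subst hw; simp
          · simp [Function.update_of_ne hw, h2 w hw]⟩ hz
      all_goals simp
    · intro s
      rw [if_pos, if_pos]
      · simp
      · intro w hw; simp [Function.update_of_ne hw]
      · intro w hw; simp [Function.update_of_ne hw, h w hw]
  · rw [if_neg h, Finset.sum_eq_zero]
    intro z _
    split_ifs with h1 h2
    · exact absurd (fun w hw => (h1 w hw).trans (h2 w hw)) h
    all_goals simp

theorem onQubit_eq_mux (q : W) (M : Matrix Bool Bool ℂ) : onQubit q M = mux q fun _ => M := rfl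

theorem diagonal_eq_mux (q : W) (d : (W → Bool) → ℂ) :
    Matrix.diagonal d = mux q fun x => Matrix.diagonal fun s => d (Function.update x q s) := by
  ext x y
  simp only [mux, Matrix.of_apply]
  by_cases h : x = y
  · subst h; simp
  · rw [Matrix.diagonal_apply_ne _ h]
    split_ifs with h1
    · rw [Matrix.diagonal_apply_ne]
      intro hq
      apply h
      funext w
      by_cases hw : w = q
      · subst hw; exact hq
      · exact h1 w hw
    · rfl

theorem cx_eq_mux (c q : W) (h : c ∉ ({q} : Finset W)) :
    (Gate.fanout c {q} h).matrix = mux q fun x => if x c then pauli .X else 1 := by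
  have hc : c ≠ q := by simpa using h
  ext x y
  rw [matrix_fanout, ofBasisMap_apply]
  simp only [mux, Matrix.of_apply, Function.update_of_ne hc]
  have key : x = fanMap c {q} y ↔ (∀ w, w ≠ q → x w = y w) ∧ x q = xor (y q) (y c) := by
    constructor
    · rintro rfl
      exact ⟨fun w hw => by simp [fanMap, hw], by simp [fanMap]⟩
    · rintro ⟨h1, h2⟩
      funext w
      by_cases hw : w = q
      · subst hw; simpa [fanMap] using h2
      · simpa [fanMap, hw] using h1 w hw
  simp only [key]
  by_cases h1 : ∀ w, w ≠ q → x w = y w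
  · rw [if_pos h1]
    simp only [and_iff_right h1]
    generalize y c = s, x q = a, y q = b
    cases s <;> cases a <;> cases b <;> simp [pauli]
  · simp [h1]

theorem tof_eq_mux (c₁ c₂ q : W) (h₁₂ h₁ h₂) :
    (Gate.toffoli c₁ c₂ q h₁₂ h₁ h₂).matrix
      = mux q fun x => if x c₁ && x c₂ then pauli .X else 1 := by
  ext x y
  rw [matrix_toffoli, ofBasisMap_apply]
  simp only [mux, Matrix.of_apply, Function.update_of_ne h₁, Function.update_of_ne h₂]
  have key : x = tofMap c₁ c₂ q y ↔
      (∀ w, w ≠ q → x w = y w) ∧ x q = xor (y q) (y c₁ && y c₂) := by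
    constructor
    · rintro rfl
      exact ⟨fun w hw => by simp [tofMap, hw], by simp [tofMap]⟩
    · rintro ⟨h1, h2⟩
      funext w
      by_cases hw : w = q
      · subst hw; simpa [tofMap] using h2
      · simpa [tofMap, hw] using h1 w hw
  simp only [key]
  by_cases h1 : ∀ w, w ≠ q → x w = y w
  · rw [if_pos h1]
    simp only [and_iff_right h1]
    generalize (y c₁ && y c₂) = s, x q = a, y q = b
    cases s <;> cases a <;> cases b <;> simp [pauli]
  · simp [h1]

/-- By `H X H = Z` and `H H = 1`, fibre by fibre: a controlled flip becomes a controlled sign. -/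
theorem hadamard_conj_mux (q : W) (p : (W → Bool) → Bool)
    (hp : ∀ x s, p (Function.update x q s) = p x) :
    onQubit q hadamardMatrix * (mux q fun x => if p x then pauli .X else 1)
      * onQubit q hadamardMatrix
      = Matrix.diagonal fun x => ((sgn (p x && x q) : ℝ) : ℂ) := by
  rw [onQubit_eq_mux, mux_mul, mux_mul, diagonal_eq_mux q]
  congr 1
  funext x
  simp only [hp, Function.update_self]
  cases p x
  · simp [hadamardMatrix_mul_self]
  · simp only [if_true, hadamard_conj_X, Bool.true_and]
    ext b c
    cases b <;> cases c <;> simp [pauli]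

/-- The controlled-`Z` gate as a sequence of Clifford gates. -/
def czGates (c q : W) (h : c ∉ ({q} : Finset W)) : List (Gate W) :=
  [.hadamard q, .fanout c {q} h, .hadamard q]

theorem matrix_czGates (c q : W) (h : c ∉ ({q} : Finset W)) :
    (seq (czGates c q h)).matrix = Matrix.diagonal fun x => ((sgn (x c && x q) : ℝ) : ℂ) := by
  have hc : c ≠ q := by simpa using h
  rw [← hadamard_conj_mux q (fun x => x c) fun x s => by simp [Function.update_of_ne hc]]
  rw [czGates, matrix_seq_cons, matrix_seq_cons, matrix_seq_cons, matrix_seq_nil, cx_eq_mux,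
    Matrix.one_mul]
  rfl

theorem onQubit_diagonal (q : W) (d : Bool → ℂ) :
    onQubit q (Matrix.diagonal d) = Matrix.diagonal fun x => d (x q) := by
  rw [onQubit_eq_mux, diagonal_eq_mux q]
  simp

theorem matrix_phase_phase (q : W) :
    (seq [Gate.phase q, Gate.phase q]).matrix
      = Matrix.diagonal fun x => ((sgn (x q) : ℝ) : ℂ) := by
  rw [matrix_seq_cons, matrix_seq_cons, matrix_seq_nil, Matrix.one_mul]
  change onQubit q phaseMatrix * onQubit q phaseMatrix = _
  rw [onQubit_mul, phaseMatrix_mul_self, show pauli .Z = Matrix.diagonal fun b => (sgn b : ℂ) by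
    ext b c; cases b <;> cases c <;> simp [pauli], onQubit_diagonal]

end Circuits

/-! ### Embedding of wires -/

section Lift

variable {W V : Type} [Fintype W] [DecidableEq W] [Fintype V] [DecidableEq V]

/-- The operator `M` on the wires `W`, transported along `f : W ↪ V`. -/
def lift (f : W ↪ V) (M : Matrix (W → Bool) (W → Bool) ℂ) : Matrix (V → Bool) (V → Bool) ℂ :=
  Matrix.of fun x y => if ∀ v, v ∉ Set.range f → x v = y v then M (x ∘ f) (y ∘ f) else 0

theorem extend_comp_embedding (f : W ↪ V) (u : W → Bool) (x : V → Bool) :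
    Function.extend f u x ∘ f = u := by
  funext w; exact f.injective.extend_apply u x w

theorem extend_eq_iff (f : W ↪ V) (u : W → Bool) (x y : V → Bool) :
    y = Function.extend f u x ↔ y ∘ f = u ∧ ∀ v, v ∉ Set.range f → y v = x v := by
  constructor
  · rintro rfl
    exact ⟨extend_comp_embedding f u x, fun v hv => Function.extend_apply' _ _ _ hv⟩
  · rintro ⟨rfl, h⟩
    funext v
    by_cases hv : v ∈ Set.range f
    · obtain ⟨w, rfl⟩ := hv
      rw [f.injective.extend_apply]; rfl
    · rw [Function.extend_apply' _ _ _ hv, h v hv]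

theorem lift_mul (f : W ↪ V) (M N : Matrix (W → Bool) (W → Bool) ℂ) :
    lift f M * lift f N = lift f (M * N) := by
  ext x y
  simp only [Matrix.mul_apply, lift, Matrix.of_apply]
  by_cases h : ∀ v, v ∉ Set.range f → x v = y v
  · rw [if_pos h]
    -- The intermediate states that contribute agree with `y` off the range of `f`, hence are
    -- determined by their restriction along `f`.
    have hinj : Function.Injective fun u : W → Bool => Function.extend f u y :=
      fun u u' huu => by
        have := congrArg (· ∘ f) huu
        simpa only [extend_comp_embedding] using this
    symm
    apply Fintype.sum_of_injective (fun u : W → Bool => Function.extend f u y) hinj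
    · intro z hz
      split_ifs with h1 h2
      · exact absurd ⟨z ∘ f, ((extend_eq_iff f _ _ _).2 ⟨rfl, h2⟩).symm⟩ hz
      all_goals simp
    · intro u
      have h2 : ∀ v, v ∉ Set.range f → Function.extend f u y v = y v :=
        fun v hv => Function.extend_apply' _ _ _ hv
      rw [if_pos fun v hv => (h v hv).trans (h2 v hv).symm, if_pos h2, extend_comp_embedding]
  · rw [if_neg h, Finset.sum_eq_zero]
    intro z _
    split_ifs with h1 h2
    · exact absurd (fun w hw => (h1 w hw).trans (h2 w hw)) h
    all_goals simp

theorem lift_one (f : W ↪ V) : lift f (1 : Matrix (W → Bool) (W → Bool) ℂ) = 1 := by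
  ext x y
  simp only [lift, Matrix.of_apply, Matrix.one_apply]
  by_cases h : x = y
  · subst h; simp
  · rw [if_neg h]
    split_ifs with h1 h2
    · exfalso
      apply h
      funext v
      by_cases hv : v ∈ Set.range f
      · obtain ⟨w, rfl⟩ := hv
        exact congrFun h2 w
      · exact h1 v hv
    all_goals rfl

theorem lift_list_prod (f : W ↪ V) (l : List (Matrix (W → Bool) (W → Bool) ℂ)) :
    lift f l.prod = (l.map (lift f)).prod := by
  induction l with
  | nil => exact lift_one f
  | cons a l ih => rw [List.prod_cons, ← lift_mul, ih, List.map_cons, List.prod_cons]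

theorem lift_onQubit (f : W ↪ V) (q : W) (M : Matrix Bool Bool ℂ) :
    lift f (onQubit q M) = onQubit (f q) M := by
  ext x y
  simp only [lift, onQubit, Matrix.of_apply, Function.comp_apply, ← ite_and]
  congr 1
  apply propext
  constructor
  · rintro ⟨h1, h2⟩ v hv
    by_cases hr : v ∈ Set.range f
    · obtain ⟨w, rfl⟩ := hr
      exact h2 w fun h => hv (by rw [h])
    · exact h1 v hr
  · intro h
    exact ⟨fun v hv => h v fun hq => hv ⟨q, hq.symm⟩,
      fun w hw => h (f w) fun hq => hw (f.injective hq)⟩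

theorem lift_ofBasisMap (f : W ↪ V) (g : (W → Bool) → W → Bool) :
    lift f (ofBasisMap g) = ofBasisMap fun x => Function.extend f (g (x ∘ f)) x := by
  ext x y
  simp only [lift, ofBasisMap_apply, Matrix.of_apply, extend_eq_iff, ← ite_and]
  congr 1
  apply propext
  tauto

/-- Relabelling of the wires of a gate. -/
def Gate.mapWires (f : W ↪ V) : Gate W → Gate V
  | .hadamard q => .hadamard (f q)
  | .phase q => .phase (f q)
  | .fanout c T hc => .fanout (f c) (T.map f) (by simpa using hc)
  | .rotation p θ q => .rotation p θ (f q)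
  | .toffoli c₁ c₂ t h₁₂ h₁ h₂ =>
      .toffoli (f c₁) (f c₂) (f t) (f.injective.ne h₁₂) (f.injective.ne h₁) (f.injective.ne h₂)

theorem Gate.support_mapWires (f : W ↪ V) (g : Gate W) :
    (g.mapWires f).support = g.support.map f := by
  cases g <;> simp [Gate.mapWires, Gate.support, Finset.map_insert]

theorem Gate.matrix_mapWires (f : W ↪ V) (g : Gate W) :
    (g.mapWires f).matrix = lift f g.matrix := by
  cases g with
  | hadamard q => exact (lift_onQubit f q _).symm
  | phase q => exact (lift_onQubit f q _).symm
  | fanout c T hc =>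
    simp only [Gate.mapWires, matrix_fanout, lift_ofBasisMap]
    congr 1
    funext x
    rw [extend_eq_iff]
    refine ⟨?_, fun v hv => ?_⟩
    · funext w
      simp [fanMap]
    · rw [fanMap, if_neg]
      intro h
      obtain ⟨w, -, rfl⟩ := Finset.mem_map.1 h
      exact hv ⟨w, rfl⟩
  | rotation p θ q => exact (lift_onQubit f q _).symm
  | toffoli c₁ c₂ t h₁₂ h₁ h₂ =>
    simp only [Gate.mapWires, matrix_toffoli, lift_ofBasisMap]
    congr 1
    funext x
    rw [extend_eq_iff]
    refine ⟨?_, fun v hv => ?_⟩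
    · funext w
      simp [tofMap, Function.update_apply, f.injective.eq_iff]
    · rw [tofMap, Function.update_of_ne]
      rintro rfl
      exact hv ⟨t, rfl⟩

/-- Relabelling of the wires of a layer. -/
def Layer.mapWires (f : W ↪ V) (L : Layer W) : Layer V where
  gates := L.gates.map (Gate.mapWires f)
  disjoint := by
    rw [List.pairwise_map]
    refine L.disjoint.imp fun h => ?_
    rw [Gate.support_mapWires, Gate.support_mapWires, Finset.disjoint_map]
    exact h

theorem Layer.matrix_mapWires (f : W ↪ V) (L : Layer W) :
    (L.mapWires f).matrix = lift f L.matrix := by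
  simp only [Layer.matrix, Layer.mapWires, lift_list_prod, List.map_map]
  congr 1
  apply List.map_congr_left
  intro g _
  exact Gate.matrix_mapWires f g

/-- Relabelling of the wires of a circuit. -/
def Circuit.mapWires (f : W ↪ V) (c : Circuit W) : Circuit V := List.map (Layer.mapWires f) c

theorem Circuit.matrix_mapWires (f : W ↪ V) (c : Circuit W) :
    (c.mapWires f).matrix = lift f c.matrix := by
  simp only [Circuit.matrix, Circuit.mapWires, lift_list_prod, List.map_map, ← List.map_reverse]
  congr 1
  apply List.map_congr_left
  intro g _
  exact Layer.matrix_mapWires f g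

theorem Circuit.depth_mapWires (f : W ↪ V) (c : Circuit W) :
    (c.mapWires f).depth = c.depth := List.length_map _

theorem Gate.isRotation_mapWires (f : W ↪ V) (g : Gate W) :
    (g.mapWires f).isRotation = g.isRotation := by cases g <;> rfl

theorem Gate.isToffoli_mapWires (f : W ↪ V) (g : Gate W) :
    (g.mapWires f).isToffoli = g.isToffoli := by cases g <;> rfl

theorem Circuit.rotDepth_mapWires (f : W ↪ V) (c : Circuit W) :
    (c.mapWires f).rotDepth = c.rotDepth := by
  simp [Circuit.rotDepth, Circuit.mapWires, List.countP_map, Layer.mapWires, Function.comp_def,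
    Gate.isRotation_mapWires]

theorem Circuit.tofDepth_mapWires (f : W ↪ V) (c : Circuit W) :
    (c.mapWires f).tofDepth = c.tofDepth := by
  simp [Circuit.tofDepth, Circuit.mapWires, List.countP_map, Layer.mapWires, Function.comp_def,
    Gate.isToffoli_mapWires]

theorem lift_equiv (e : W ≃ V) (M : Matrix (W → Bool) (W → Bool) ℂ) (x y : V → Bool) :
    lift e.toEmbedding M x y = M (x ∘ e) (y ∘ e) := by
  simp [lift]

end Lift

/-- A circuit with ancillas in an arbitrary finite type gives a block-encoding. -/
theorem exists_blockEncoding {n : ℕ} {Z : Type} [Fintype Z] [DecidableEq Z]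
    (c : Circuit (Fin n ⊕ Z)) {α : ℝ} (hα : 0 < α) {A : Matrix (Fin n → Bool) (Fin n → Bool) ℂ}
    (h : ∀ i j : Fin n → Bool,
      c.matrix (Sum.elim i fun _ => false) (Sum.elim j fun _ => false) = A i j / (α : ℂ)) :
    ∃ c' : Circuit (Fin n ⊕ Fin (Fintype.card Z)), IsBlockEncoding α c'.matrix A ∧
      c'.depth = c.depth ∧ c'.rotDepth = c.rotDepth ∧ c'.tofDepth = c.tofDepth := by
  let e : Fin n ⊕ Z ≃ Fin n ⊕ Fin (Fintype.card Z) :=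
    Equiv.sumCongr (Equiv.refl _) (Fintype.equivFin Z)
  refine ⟨c.mapWires e.toEmbedding, ⟨hα, Circuit.matrix_mem_unitaryGroup _, fun i j => ?_⟩,
    Circuit.depth_mapWires _ _, Circuit.rotDepth_mapWires _ _, Circuit.tofDepth_mapWires _ _⟩
  have he : ∀ u : Fin n → Bool, (Sum.elim u fun _ => false : Fin n ⊕ Fin (Fintype.card Z) → Bool)
      ∘ e = Sum.elim u fun _ => false := by
    intro u
    funext w
    cases w <;> simp [e]
  rw [Circuit.matrix_mapWires, lift_equiv, he, he, h]

end

section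

open Matrix

/-! ### Classical gates -/

section Classical

variable {W : Type} [Fintype W] [DecidableEq W]

/-- The fan-out and Toffoli gates permute the basis states. -/
def Gate.IsClassical : Gate W → Prop
  | .fanout _ _ _ => True
  | .toffoli _ _ _ _ _ _ => True
  | _ => False

/-- The permutation of the basis states by a classical gate. -/
def Gate.basisMap : Gate W → (W → Bool) → W → Bool
  | .fanout c T _, x => fanMap c T x
  | .toffoli c₁ c₂ t _ _ _, x => tofMap c₁ c₂ t x
  | _, x => x

theorem Gate.matrix_of_isClassical {g : Gate W} (h : g.IsClassical) :
    g.matrix = ofBasisMap g.basisMap := by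
  cases g with
  | fanout => rfl
  | toffoli => rfl
  | _ => exact h.elim

theorem Gate.basisMap_basisMap (g : Gate W) (x : W → Bool) : g.basisMap (g.basisMap x) = x := by
  cases g with
  | fanout c T hc => exact fanMap_fanMap c T hc x
  | toffoli c₁ c₂ t h₁₂ h₁ h₂ => exact tofMap_tofMap c₁ c₂ t h₁ h₂ x
  | _ => rfl

theorem Gate.isRotation_of_isClassical {g : Gate W} (h : g.IsClassical) :
    g.isRotation = false := by
  cases g with
  | rotation => exact h.elim
  | _ => rfl

/-- The map of basis states computed by a list of classical gates, the head being applied first. -/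
def runMap : List (Gate W) → (W → Bool) → W → Bool
  | [], x => x
  | g :: l, x => runMap l (g.basisMap x)

theorem runMap_append (l l' : List (Gate W)) (x : W → Bool) :
    runMap (l ++ l') x = runMap l' (runMap l x) := by
  induction l generalizing x with
  | nil => rfl
  | cons g l ih => exact ih _

theorem matrix_seq_append (l l' : List (Gate W)) :
    (seq (l ++ l')).matrix = (seq l').matrix * (seq l).matrix := by
  rw [seq, List.map_append, Circuit.matrix_append]; rfl

/-- Conjugation of a circuit by a list of gates. -/
def conjBy : List (Gate W) → Circuit W → Circuit W
  | [], c => c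
  | g :: l, c => seq [g] ++ (conjBy l c ++ seq [g])

theorem rotDepth_conjBy {l : List (Gate W)} (h : ∀ g ∈ l, g.IsClassical) (c : Circuit W) :
    (conjBy l c).rotDepth = c.rotDepth := by
  induction l with
  | nil => rfl
  | cons g l ih =>
    rw [conjBy, Circuit.rotDepth_append, Circuit.rotDepth_append,
      ih fun g hg => h g (by simp [hg]), rotDepth_seq]
    simp [Gate.isRotation_of_isClassical (h g (by simp))]

theorem tofDepth_conjBy (l : List (Gate W)) (c : Circuit W) :
    (conjBy l c).tofDepth = 2 * l.countP Gate.isToffoli + c.tofDepth := by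
  induction l with
  | nil => simp [conjBy]
  | cons g l ih =>
    rw [conjBy, Circuit.tofDepth_append, Circuit.tofDepth_append, ih, tofDepth_seq,
      List.countP_cons, List.countP_cons, List.countP_nil]
    ring

theorem depth_conjBy (l : List (Gate W)) (c : Circuit W) :
    (conjBy l c).depth = 2 * l.length + c.depth := by
  induction l with
  | nil => simp [conjBy]
  | cons g l ih =>
    rw [conjBy, Circuit.depth_append, Circuit.depth_append, ih, depth_seq]
    simp only [List.length_cons, List.length_nil]
    ring

/-- Classical gates are involutions, so the second half of the conjugation uncomputes the first, and
the core sees the state only as transformed by `runMap l`. -/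
theorem matrix_conjBy_of_diagonal {l : List (Gate W)} (h : ∀ g ∈ l, g.IsClassical)
    {c : Circuit W} {d : (W → Bool) → ℂ} (hc : c.matrix = Matrix.diagonal d) :
    (conjBy l c).matrix = Matrix.diagonal (d ∘ runMap l) := by
  induction l with
  | nil => exact hc
  | cons g l ih =>
    rw [conjBy, Circuit.matrix_append, Circuit.matrix_append,
      ih fun g hg => h g (by simp [hg]), matrix_seq_cons, matrix_seq_nil, Matrix.one_mul,
      Gate.matrix_of_isClassical (h g (by simp)), ofBasisMap_conj_diagonal _ _ g.basisMap_basisMap]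
    rfl

/-- A gate that copies a wire onto another one. -/
theorem basisMap_cx (c q : W) (h : c ∉ ({q} : Finset W)) (x : W → Bool) :
    (Gate.fanout c {q} h).basisMap x = Function.update x q (xor (x q) (x c)) := by
  funext w
  by_cases hw : w = q
  · subst hw; simp [Gate.basisMap, fanMap]
  · simp [Gate.basisMap, fanMap, hw]

theorem basisMap_toffoli (c₁ c₂ q : W) (h₁₂ h₁ h₂) (x : W → Bool) :
    (Gate.toffoli c₁ c₂ q h₁₂ h₁ h₂).basisMap x
      = Function.update x q (xor (x q) (x c₁ && x c₂)) := rfl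

/-- The value of `v` replaces the value of `u` if the wire `c` is set; `v` is modified. -/
def selectGates (c u v : W) (hcu : c ≠ u) (hcv : c ≠ v) (huv : u ≠ v) : List (Gate W) :=
  [.fanout u {v} (by simpa using huv), .toffoli c v u hcv hcu huv.symm]

theorem isClassical_selectGates (c u v : W) (hcu : c ≠ u) (hcv : c ≠ v) (huv : u ≠ v) :
    ∀ g ∈ selectGates c u v hcu hcv huv, g.IsClassical := by
  simp [selectGates, Gate.IsClassical]

/-- Once `v` holds `u + v`, adding it to `u` when `c` is set leaves the old `v` there. A single
Toffoli gate suffices because `v` is not restored. -/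
theorem runMap_selectGates (c u v : W) (hcu : c ≠ u) (hcv : c ≠ v) (huv : u ≠ v) (x : W → Bool) :
    runMap (selectGates c u v hcu hcv huv) x
      = Function.update (Function.update x v (xor (x v) (x u))) u
          (if x c then x v else x u) := by
  simp only [selectGates, runMap, basisMap_cx, basisMap_toffoli, Function.update_self,
    Function.update_of_ne huv, Function.update_of_ne hcv]
  congr 1
  cases x c <;> cases x u <;> cases x v <;> rfl

/-- Computes in `h k` whether `k` is the first index of the list with `d k` set and the wire `m`
not set initially, and adds to `m` whether there is one. -/
def firstHit {ι : Type} (d h : ι → W) (m : W) (hdh : ∀ i j, d i ≠ h j) (hd : ∀ i, d i ≠ m)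
    (hh : ∀ i, h i ≠ m) : List ι → List (Gate W)
  | [] => []
  | k :: l => .toffoli m (d k) (h k) (hd k).symm (hh k).symm (hdh k k) ::
      .fanout (d k) {h k} (by simpa using hdh k k) ::
      .fanout (h k) {m} (by simpa using hh k) :: firstHit d h m hdh hd hh l

theorem isClassical_firstHit {ι : Type} (d h : ι → W) (m : W) (hdh : ∀ i j, d i ≠ h j)
    (hd : ∀ i, d i ≠ m) (hh : ∀ i, h i ≠ m) (l : List ι) :
    ∀ g ∈ firstHit d h m hdh hd hh l, g.IsClassical := by
  induction l with
  | nil => simp [firstHit]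
  | cons k l ih =>
    simp only [firstHit, List.mem_cons]
    rintro g (rfl | rfl | rfl | hg)
    · trivial
    · trivial
    · trivial
    · exact ih g hg

theorem length_firstHit {ι : Type} (d h : ι → W) (m : W) (hdh : ∀ i j, d i ≠ h j)
    (hd : ∀ i, d i ≠ m) (hh : ∀ i, h i ≠ m) (l : List ι) :
    (firstHit d h m hdh hd hh l).length = 3 * l.length := by
  induction l with
  | nil => rfl
  | cons k l ih => simp only [firstHit, List.length_cons, ih]; ring

theorem countP_firstHit {ι : Type} (d h : ι → W) (m : W) (hdh : ∀ i j, d i ≠ h j)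
    (hd : ∀ i, d i ≠ m) (hh : ∀ i, h i ≠ m) (l : List ι) :
    (firstHit d h m hdh hd hh l).countP Gate.isToffoli = l.length := by
  induction l with
  | nil => rfl
  | cons k l ih => simp [firstHit, List.countP_cons, ih, Gate.isToffoli]

/-- Is `k` the first index of the list with `v k` set, provided that `s` is not set? -/
def hitVal {ι : Type} [DecidableEq ι] (v : ι → Bool) : List ι → Bool → ι → Bool
  | [], _, _ => false
  | j :: l, s, k => if k = j then v j && !s else hitVal v l (s || v j) k

/-- For each index, the Toffoli gate and the `CX` gate together put `d k ∧ ¬ m` into the clean wire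
`h k`; since this is disjoint from `m`, adding it to `m` makes `m ∨ d k`. -/
theorem runMap_firstHit {ι : Type} [DecidableEq ι] (d h : ι → W) (m : W)
    (hdh : ∀ i j, d i ≠ h j) (hd : ∀ i, d i ≠ m) (hh : ∀ i, h i ≠ m)
    (hinj : Function.Injective h) (l : List ι) (hl : l.Nodup)
    (x : W → Bool) (hx : ∀ k ∈ l, x (h k) = false) :
    (runMap (firstHit d h m hdh hd hh l) x m = (x m || l.any fun k => x (d k))) ∧
    (∀ k ∈ l, runMap (firstHit d h m hdh hd hh l) x (h k)
      = hitVal (fun i => x (d i)) l (x m) k) ∧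
    ∀ w, w ≠ m → (∀ k ∈ l, w ≠ h k) → runMap (firstHit d h m hdh hd hh l) x w = x w := by
  induction l generalizing x with
  | nil => simp [firstHit, runMap]
  | cons k l ih =>
    obtain ⟨hk, hl⟩ := List.nodup_cons.1 hl
    have hhk : x (h k) = false := hx k (by simp)
    set y := Function.update (Function.update x (h k) (x (d k) && !x m)) m (x m || x (d k))
      with hy
    have hrun : runMap (firstHit d h m hdh hd hh (k :: l)) x
        = runMap (firstHit d h m hdh hd hh l) y := by
      simp only [firstHit, runMap, basisMap_cx, basisMap_toffoli, Function.update_self,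
        Function.update_idem, Function.update_of_ne (hdh k k), Function.update_of_ne (hh k).symm,
        hhk]
      congr 1
      rw [hy]
      cases x m <;> cases x (d k) <;> rfl
    have hyd : ∀ i, y (d i) = x (d i) := fun i => by
      rw [hy, Function.update_of_ne (hd i), Function.update_of_ne (hdh i k)]
    have hym : y m = (x m || x (d k)) := by rw [hy, Function.update_self]
    have hyh : ∀ j, j ≠ k → y (h j) = x (h j) := fun j hj => by
      rw [hy, Function.update_of_ne (hh j), Function.update_of_ne (hinj.ne hj)]
    obtain ⟨h1, h2, h3⟩ := ih hl y (fun j hj => by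
      rw [hyh j (by rintro rfl; exact hk hj)]; exact hx j (by simp [hj]))
    rw [hrun]
    refine ⟨?_, ?_, ?_⟩
    · rw [h1, hym]
      simp only [hyd, List.any_cons, Bool.or_assoc]
    · intro j hj
      rw [hitVal]
      by_cases hjk : j = k
      · subst hjk
        rw [if_pos rfl, h3 _ (hh j) fun i hi => hinj.ne (by rintro rfl; exact hk hi), hy,
          Function.update_of_ne (hh j), Function.update_self]
      · rw [if_neg hjk, h2 j (by simpa [hjk] using hj), hym]
        simp only [hyd]
    · intro w hw hwl
      rw [h3 w hw fun i hi => hwl i (by simp [hi]), hy, Function.update_of_ne hw,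
        Function.update_of_ne (hwl k (by simp))]

end Classical

end

section

open Matrix Polynomial ComplexConjugate

/-! ### Polynomials on the unit circle -/

/-- The circle is connected and has more than one point. Its infinitude allows polynomial identities
to be checked on it; the absence of isolated points lets an inequality extend over a zero. -/
theorem sphere_preperfect_infinite :
    Preperfect (Metric.sphere (0 : ℂ) 1) ∧ (Metric.sphere (0 : ℂ) 1).Infinite := by
  have h1 : IsPreconnected (Metric.sphere (0 : ℂ) 1) :=
    isPreconnected_sphere (by rw [Complex.rank_real_complex]; norm_num) 0 1
  have h2 : (Metric.sphere (0 : ℂ) 1).Nontrivial :=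
    ⟨1, by simp, -1, by simp, by norm_num⟩
  exact ⟨h1.preperfect_of_nontrivial h2, h1.infinite_of_nontrivial h2⟩

theorem eq_of_eval_eq_on_circle {P Q : ℂ[X]} (h : ∀ z : ℂ, ‖z‖ = 1 → P.eval z = Q.eval z) :
    P = Q :=
  Polynomial.eq_of_infinite_eval_eq P Q
    (sphere_preperfect_infinite.2.mono fun z hz => h z (by simpa using hz))

theorem conj_mul_self_of_norm {z : ℂ} (hz : ‖z‖ = 1) : conj z * z = 1 := by
  rw [mul_comm, Complex.mul_conj, Complex.normSq_eq_norm_sq, hz]; norm_num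

/-- The polynomial `z ^ N * conj (P (1 / conj z))`. -/
def conjReflect (N : ℕ) (P : ℂ[X]) : ℂ[X] := (P.reflect N).map (starRingEnd ℂ)

theorem coeff_conjReflect {N k : ℕ} (hk : k ≤ N) (P : ℂ[X]) :
    (conjReflect N P).coeff k = conj (P.coeff (N - k)) := by
  rw [conjReflect, coeff_map, coeff_reflect, revAt_le hk]

theorem natDegree_conjReflect_le {N : ℕ} {P : ℂ[X]} (hP : P.natDegree ≤ N) :
    (conjReflect N P).natDegree ≤ N := by
  refine natDegree_map_le.trans ((natDegree_reflect_le).trans ?_)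
  simpa using hP

theorem eval_conjReflect {N : ℕ} {P : ℂ[X]} (hP : P.natDegree ≤ N) {z : ℂ} (hz : z ≠ 0) :
    (conjReflect N P).eval z = z ^ N * conj (P.eval (conj z)⁻¹) := by
  have hc : (conj z)⁻¹ ≠ 0 := inv_ne_zero ((_root_.map_ne_zero _).2 hz)
  let _ : Invertible (conj z)⁻¹ := invertibleOfNonzero hc
  have h := eval₂_reflect_mul_pow (RingHom.id ℂ) ((conj z)⁻¹) N P hP
  rw [invOf_eq_inv, inv_inv, ← eval, ← eval] at h
  rw [conjReflect, eval_map, ← Complex.conj_conj z, eval₂_at_apply, Complex.conj_conj, ← h,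
    map_mul, map_pow, map_inv₀, Complex.conj_conj, mul_left_comm, ← mul_pow, mul_inv_cancel₀ hz,
    one_pow, mul_one]

theorem eval_conjReflect_of_norm {N : ℕ} {P : ℂ[X]} (hP : P.natDegree ≤ N) {z : ℂ}
    (hz : ‖z‖ = 1) : (conjReflect N P).eval z = z ^ N * conj (P.eval z) := by
  have h0 : z ≠ 0 := by rintro rfl; simp at hz
  rw [eval_conjReflect hP h0, inv_eq_of_mul_eq_one_right (conj_mul_self_of_norm hz)]

/-- `Q` is `z ^ D` times a nonnegative function on the unit circle. -/
def NonnegOnCircle (D : ℕ) (Q : ℂ[X]) : Prop :=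
  ∀ z : ℂ, ‖z‖ = 1 → 0 ≤ (Q.eval z * conj z ^ D).re ∧ (Q.eval z * conj z ^ D).im = 0

/-- This is reality on the circle. It makes the coefficients conjugate-symmetric and pairs each
nonzero root `a` with `1 / conj a`. -/
theorem NonnegOnCircle.conjReflect_eq {D : ℕ} {Q : ℂ[X]} (h : NonnegOnCircle D Q)
    (hQ : Q.natDegree ≤ 2 * D) : conjReflect (2 * D) Q = Q := by
  apply eq_of_eval_eq_on_circle
  intro z hz
  rw [eval_conjReflect_of_norm hQ hz]
  have h1 : conj (Q.eval z * conj z ^ D) = Q.eval z * conj z ^ D :=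
    Complex.conj_eq_iff_im.2 (h z hz).2
  rw [map_mul, map_pow, Complex.conj_conj] at h1
  have h2 : (conj z) ^ D * z ^ D = 1 := by rw [← mul_pow, conj_mul_self_of_norm hz, one_pow]
  calc z ^ (2 * D) * conj (Q.eval z) = (conj (Q.eval z) * z ^ D) * z ^ D := by ring
    _ = Q.eval z := by rw [h1, mul_assoc, h2, mul_one]

/-- A zero on the unit circle of a nonnegative trigonometric polynomial is a critical point. -/
theorem NonnegOnCircle.derivative_eval {D : ℕ} {Q : ℂ[X]} (h : NonnegOnCircle D Q) {a : ℂ}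
    (ha : ‖a‖ = 1) (h0 : Q.eval a = 0) : (derivative Q).eval a = 0 := by
  have ha0 : a ≠ 0 := by rintro rfl; simp at ha
  have hainv : a⁻¹ = conj a := inv_eq_of_mul_eq_one_left (conj_mul_self_of_norm ha)
  -- The nonnegative function on the circle as a holomorphic function of the angle measured from
  -- `a`. At real arguments it is real and nonnegative, and it vanishes at `0`.
  let G : ℂ → ℂ := fun z =>
    Q.eval (a * Complex.exp (Complex.I * z)) * (a⁻¹ * Complex.exp (-(Complex.I * z))) ^ D
  have hu : HasDerivAt (fun z : ℂ => a * Complex.exp (Complex.I * z)) (a * Complex.I) 0 := by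
    have := (((hasDerivAt_id (0 : ℂ)).const_mul Complex.I).cexp).const_mul a
    simpa using this
  have hQ : HasDerivAt (fun z : ℂ => Q.eval (a * Complex.exp (Complex.I * z)))
      ((derivative Q).eval a * (a * Complex.I)) 0 := by
    have h1 : HasDerivAt (fun w : ℂ => Q.eval w) ((derivative Q).eval a)
        (a * Complex.exp (Complex.I * 0)) := by
      simpa using Q.hasDerivAt a
    exact h1.comp (0 : ℂ) hu
  have hv : DifferentiableAt ℂ
      (fun z : ℂ => (a⁻¹ * Complex.exp (-(Complex.I * z))) ^ D) 0 := by fun_prop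
  have hG : HasDerivAt G ((derivative Q).eval a * (a * Complex.I) * a⁻¹ ^ D) 0 := by
    have h2 := hQ.mul hv.hasDerivAt
    simp only [mul_zero, Complex.exp_zero, mul_one, h0, zero_mul, add_zero, neg_zero] at h2
    exact h2
  have hval : ∀ t : ℝ, 0 ≤ (G t).re ∧ (G t).im = 0 := by
    intro t
    have hz : ‖a * Complex.exp (Complex.I * t)‖ = 1 := by
      rw [norm_mul, ha, mul_comm Complex.I, Complex.norm_exp_ofReal_mul_I, one_mul]
    have := h _ hz
    rw [map_mul, ← Complex.exp_conj, map_mul, Complex.conj_I, Complex.conj_ofReal, ← hainv,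
      neg_mul] at this
    exact this
  have hG0 : G ((0 : ℝ) : ℂ) = 0 := by simp [G, h0]
  have hre := hG.real_of_complex (z := 0)
  have him := (hG.const_mul (-Complex.I)).real_of_complex (z := 0)
  have hmin : IsLocalMin (fun t : ℝ => (G t).re) 0 :=
    Filter.Eventually.of_forall fun t => by
      change (G ((0 : ℝ) : ℂ)).re ≤ _
      rw [hG0]; exact (hval t).1
  -- The real part of `-i G` is the imaginary part of `G`, which is constantly `0` on the real axis;
  -- so both parts of the derivative vanish.
  have hmin' : IsLocalMin (fun t : ℝ => (-Complex.I * G t).re) 0 :=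
    Filter.Eventually.of_forall fun t => by
      have h2 := (hval 0).2
      rw [Complex.ofReal_zero] at h2
      simp [(hval t).2, h2]
  have e1 := hmin.hasDerivAt_eq_zero hre
  have e2 := hmin'.hasDerivAt_eq_zero him
  have e3 : (derivative Q).eval a * (a * Complex.I) * a⁻¹ ^ D = 0 := by
    apply Complex.ext
    · exact e1
    · simpa using e2
  have hne : a * Complex.I ≠ 0 := mul_ne_zero ha0 Complex.I_ne_zero
  have hne' : a⁻¹ ^ D ≠ 0 := pow_ne_zero _ (inv_ne_zero ha0)
  exact (mul_eq_zero.1 ((mul_eq_zero.1 e3).resolve_right hne')).resolve_right hne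

/-- On the circle, `(1 - conj a * z) * conj z` is the conjugate of `z - a`. So a root and its mirror
image together contribute `z` times a square. -/
theorem circle_factor {a z : ℂ} (hz : ‖z‖ = 1) :
    (z - a) * (1 - conj a * z) * conj z = (Complex.normSq (z - a) : ℂ) := by
  rw [← Complex.mul_conj, map_sub]
  linear_combination (-(z - a) * conj a) * conj_mul_self_of_norm hz

/-- The root of a nonnegative trigonometric polynomial comes with its mirror image. -/
theorem NonnegOnCircle.exists_factor {D : ℕ} {Q : ℂ[X]} (h : NonnegOnCircle D Q)
    (hQ : Q.natDegree ≤ 2 * D) {a : ℂ} (ha : a ≠ 0) (h0 : Q.eval a = 0) :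
    ∃ Q₁ : ℂ[X], Q = (X - C a) * (1 - C (conj a) * X) * Q₁ := by
  obtain ⟨R, hR⟩ := dvd_iff_isRoot.2 h0
  have hca : conj a ≠ 0 := (_root_.map_ne_zero _).2 ha
  have hRb : R.eval (conj a)⁻¹ = 0 := by
    -- A root on the circle is its own mirror image and is double because it is a critical point.
    -- Any other root has a distinct mirror image, which is a root by symmetry.
    by_cases hb : (conj a)⁻¹ = a
    · have hn : ‖a‖ = 1 := by
        have h1 : a * conj a = 1 := by
          have := inv_mul_cancel₀ hca
          rwa [hb] at this
        rw [Complex.mul_conj, Complex.normSq_eq_norm_sq] at h1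
        have h2 : ‖a‖ ^ 2 = 1 := by exact_mod_cast h1
        exact (pow_eq_one_iff_of_nonneg (norm_nonneg a) two_ne_zero).1 h2
      have := h.derivative_eval hn h0
      rw [hR] at this
      rw [hb]
      simpa using this
    · have h1 : Q.eval (conj a)⁻¹ = 0 := by
        rw [← h.conjReflect_eq hQ, eval_conjReflect hQ (inv_ne_zero hca)]
        simp [h0]
      rw [hR, eval_mul, mul_eq_zero] at h1
      refine h1.resolve_left ?_
      simpa [sub_eq_zero] using hb
  obtain ⟨R', hR'⟩ := dvd_iff_isRoot.2 hRb
  refine ⟨C (-(conj a)⁻¹) * R', ?_⟩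
  have h1 : (1 - C (conj a) * X) * C (-(conj a)⁻¹) = X - C (conj a)⁻¹ := by
    have h2 : C (conj a) * C (conj a)⁻¹ = (1 : ℂ[X]) := by
      rw [← C_mul, mul_inv_cancel₀ hca, C_1]
    rw [C_neg]
    linear_combination X * h2
  rw [mul_assoc, ← mul_assoc (1 - C (conj a) * X), h1, ← hR', ← hR]

/-- Away from `a` the factor is positive and divides out. The condition is closed, so it passes to
`a` as a limit of other points of the circle. -/
theorem NonnegOnCircle.of_factor {D : ℕ} {Q₁ : ℂ[X]} {a : ℂ}
    (h : NonnegOnCircle (D + 1) ((X - C a) * (1 - C (conj a) * X) * Q₁)) :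
    NonnegOnCircle D Q₁ := by
  have key : ∀ z : ℂ, ‖z‖ = 1 → z ≠ a →
      0 ≤ (Q₁.eval z * conj z ^ D).re ∧ (Q₁.eval z * conj z ^ D).im = 0 := by
    intro z hz hza
    have h1 := h z hz
    have h2 : ((X - C a) * (1 - C (conj a) * X) * Q₁).eval z * conj z ^ (D + 1)
        = (Complex.normSq (z - a) : ℂ) * (Q₁.eval z * conj z ^ D) := by
      rw [← circle_factor hz]
      simp only [eval_mul, eval_sub, eval_X, eval_C, eval_one]
      ring
    have h3 : 0 < Complex.normSq (z - a) := Complex.normSq_pos.2 (sub_ne_zero.2 hza)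
    rw [h2, Complex.re_ofReal_mul, Complex.im_ofReal_mul] at h1
    exact ⟨nonneg_of_mul_nonneg_right h1.1 h3, (mul_eq_zero.1 h1.2).resolve_left h3.ne'⟩
  intro z hz
  by_cases hza : z = a
  · subst hza
    have hacc : AccPt z (Filter.principal (Metric.sphere (0 : ℂ) 1)) :=
      sphere_preperfect_infinite.1 z (by simpa using hz)
    have hcl : z ∈ closure (Metric.sphere (0 : ℂ) 1 \ {z}) := by
      rw [mem_closure_iff_clusterPt]
      exact accPt_principal_iff_clusterPt.1 hacc
    have hclosed : IsClosed {w : ℂ | 0 ≤ (Q₁.eval w * conj w ^ D).re ∧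
        (Q₁.eval w * conj w ^ D).im = 0} := by
      have hc : Continuous fun w : ℂ => Q₁.eval w * conj w ^ D :=
        Q₁.continuous.mul (Complex.continuous_conj.pow D)
      exact (isClosed_le continuous_const (Complex.continuous_re.comp hc)).inter
        (isClosed_eq (Complex.continuous_im.comp hc) continuous_const)
    refine (hclosed.closure_subset_iff.2 ?_) hcl
    rintro w ⟨hw, hwz⟩
    exact key w (by simpa using hw) hwz
  · exact key z hz hza

/-- The Fejér–Riesz theorem. -/
theorem fejer_riesz (D : ℕ) (Q : ℂ[X]) (hQ : Q.natDegree ≤ 2 * D) (h : NonnegOnCircle D Q) :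
    ∃ B : ℂ[X], B.natDegree ≤ D ∧
      ∀ z : ℂ, ‖z‖ = 1 → Q.eval z * conj z ^ D = (Complex.normSq (B.eval z) : ℂ) := by
  induction D generalizing Q with
  | zero =>
    obtain ⟨c, rfl⟩ : ∃ c, Q = C c := ⟨_, eq_C_of_natDegree_le_zero (by simpa using hQ)⟩
    have h1 := h 1 (by simp)
    simp only [eval_C, pow_zero, mul_one] at h1
    refine ⟨C ((Real.sqrt c.re : ℝ) : ℂ), by simp, fun z _ => ?_⟩
    simp only [eval_C, pow_zero, mul_one, Complex.normSq_ofReal, Real.mul_self_sqrt h1.1]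
    apply Complex.ext <;> simp [h1.2]
  | succ D ih =>
    have htop : Q.coeff (2 * (D + 1)) = conj (Q.coeff 0) := by
      conv_lhs => rw [← h.conjReflect_eq hQ]
      rw [coeff_conjReflect le_rfl, Nat.sub_self]
    by_cases h0 : Q.coeff 0 = 0
    -- By symmetry the top coefficient vanishes together with the constant one, so division by `X`
    -- brings the degree bound down to `2 * D`.
    · have hX : Q = X * Q.divX := by
        conv_lhs => rw [← Q.X_mul_divX_add]
        rw [h0, C_0, add_zero]
      have hdeg : Q.divX.natDegree ≤ 2 * D := by
        rw [natDegree_le_iff_coeff_eq_zero]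
        intro N hN
        rw [coeff_divX]
        by_cases hN' : N = 2 * D + 1
        · subst hN'
          rw [show 2 * D + 1 + 1 = 2 * (D + 1) by ring, htop, h0, map_zero]
        · exact coeff_eq_zero_of_natDegree_lt (by omega)
      have hev : ∀ z : ℂ, ‖z‖ = 1 →
          Q.eval z * conj z ^ (D + 1) = Q.divX.eval z * conj z ^ D := by
        intro z hz
        conv_lhs => rw [hX]
        rw [eval_mul, eval_X]
        linear_combination (Q.divX.eval z * conj z ^ D) * conj_mul_self_of_norm hz
      obtain ⟨B, hB, hB'⟩ := ih Q.divX hdeg fun z hz => by rw [← hev z hz]; exact h z hz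
      exact ⟨B, hB.trans (Nat.le_succ D), fun z hz => by rw [hev z hz, hB' z hz]⟩
    · have hpos : 0 < Q.degree := by
        rw [← natDegree_pos_iff_degree_pos]
        have : Q.coeff (2 * (D + 1)) ≠ 0 := by
          rw [htop]; exact (_root_.map_ne_zero _).2 h0
        have := le_natDegree_of_ne_zero this
        omega
      -- The root and its mirror image split off `|z - a| ^ 2`; the polynomial found for the
      -- quotient is then multiplied by `X - a`.
      obtain ⟨a, ha⟩ := Complex.exists_root hpos
      have ha0 : a ≠ 0 := by
        rintro rfl
        exact h0 (by rw [coeff_zero_eq_eval_zero]; exact ha)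
      obtain ⟨Q₁, hQ₁⟩ := h.exists_factor hQ ha0 ha
      have hne : Q ≠ 0 := by rintro rfl; simp at h0
      have hca : conj a ≠ 0 := (_root_.map_ne_zero _).2 ha0
      have hd1 : ((1 : ℂ[X]) - C (conj a) * X).natDegree = 1 := by
        rw [show (1 : ℂ[X]) - C (conj a) * X = C (-conj a) * X + C 1 by
          rw [C_neg, C_1]; ring, natDegree_linear (neg_ne_zero.2 hca)]
      have hdeg : Q₁.natDegree ≤ 2 * D := by
        have hne1 : Q₁ ≠ 0 := by rintro rfl; exact hne (by rw [hQ₁, mul_zero])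
        have hne2 : (X - C a) * ((1 : ℂ[X]) - C (conj a) * X) ≠ 0 := by
          intro h2; exact hne (by rw [hQ₁, h2, zero_mul])
        have := hQ
        rw [hQ₁, natDegree_mul hne2 hne1, natDegree_mul (left_ne_zero_of_mul hne2)
          (right_ne_zero_of_mul hne2), hd1, natDegree_X_sub_C] at this
        omega
      have hnn := h
      rw [hQ₁] at hnn
      obtain ⟨B, hB, hB'⟩ := ih Q₁ hdeg hnn.of_factor
      refine ⟨(X - C a) * B, natDegree_mul_le.trans ?_, fun z hz => ?_⟩
      · rw [natDegree_X_sub_C]; omega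
      · have hB2 : (Complex.normSq (((X - C a) * B).eval z) : ℂ)
            = (Complex.normSq (z - a) : ℂ) * (Q₁.eval z * conj z ^ D) := by
          rw [hB' z hz, eval_mul, Complex.normSq_mul, Complex.ofReal_mul, eval_sub, eval_X, eval_C]
        rw [hQ₁, hB2]
        simp only [eval_mul, eval_sub, eval_X, eval_C, eval_one]
        rw [← circle_factor hz]
        ring

/-- A polynomial bounded by `1` on the unit circle has a complement. -/
theorem exists_complement (D : ℕ) (A : ℂ[X]) (hA : A.natDegree ≤ D)
    (h : ∀ z : ℂ, ‖z‖ = 1 → ‖A.eval z‖ ≤ 1) :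
    ∃ B : ℂ[X], B.natDegree ≤ D ∧ ∀ z : ℂ, ‖z‖ = 1 →
      Complex.normSq (A.eval z) + Complex.normSq (B.eval z) = 1 := by
  -- Multiplied by `z ^ D`, the function `1 - |A| ^ 2` on the circle becomes a polynomial of degree
  -- at most `2 * D`; Fejér–Riesz applied to it yields the complement.
  have hev : ∀ z : ℂ, ‖z‖ = 1 →
      (X ^ D - A * conjReflect D A).eval z * conj z ^ D
        = ((1 - Complex.normSq (A.eval z) : ℝ) : ℂ) := by
    intro z hz
    have h2 : (conj z) ^ D * z ^ D = 1 := by rw [← mul_pow, conj_mul_self_of_norm hz, one_pow]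
    rw [eval_sub, eval_mul, eval_pow, eval_X, eval_conjReflect_of_norm hA hz,
      Complex.ofReal_sub, Complex.ofReal_one, ← Complex.mul_conj]
    linear_combination (1 - A.eval z * conj (A.eval z)) * h2
  obtain ⟨B, hB, hB'⟩ := fejer_riesz D (X ^ D - A * conjReflect D A)
    (by
      refine (natDegree_sub_le _ _).trans (max_le ?_ (natDegree_mul_le.trans ?_))
      · rw [natDegree_X_pow]; omega
      · have := natDegree_conjReflect_le hA
        omega)
    (by
      intro z hz
      rw [hev z hz, Complex.ofReal_re, Complex.ofReal_im]
      refine ⟨?_, rfl⟩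
      have := h z hz
      rw [Complex.normSq_eq_norm_sq, sub_nonneg]
      exact pow_le_one₀ (norm_nonneg _) this)
  refine ⟨B, hB, fun z hz => ?_⟩
  have := hB' z hz
  rw [hev z hz] at this
  have h3 : 1 - Complex.normSq (A.eval z) = Complex.normSq (B.eval z) := by exact_mod_cast this
  linarith

end

section

open Matrix Polynomial ComplexConjugate

/-! ### Signal processing -/

section Signal

variable {R R' : Type*} [Ring R] [Algebra ℂ R] [Ring R'] [Algebra ℂ R']

/-- The phase `exp (-i φ / 2 · (-1) ^ b)` of a `Z`-rotation. -/
def zPhase (φ : ℝ) (b : Bool) : ℂ := Complex.exp (-(Complex.I * ((φ / 2 * sgn b : ℝ) : ℂ)))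

/-- The action of a `Y`-rotation on a column. -/
def yAct (θ : ℝ) (v : R × R) : R × R :=
  ((Real.cos (θ / 2) : ℂ) • v.1 - (Real.sin (θ / 2) : ℂ) • v.2,
    (Real.sin (θ / 2) : ℂ) • v.1 + (Real.cos (θ / 2) : ℂ) • v.2)

/-- The action of a `Z`-rotation on a column. -/
def zAct (φ : ℝ) (v : R × R) : R × R := (zPhase φ false • v.1, zPhase φ true • v.2)

/-- The first column of `Y(θ k) Z(φ (k - 1)) diag(w, 1) ⋯ Y(θ 1) Z(φ 0) diag(w, 1) Y(θ 0)`. -/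
def qcol (w : R) (θ φ : ℕ → ℝ) : ℕ → R × R
  | 0 => yAct (θ 0) (1, 0)
  | k + 1 => yAct (θ (k + 1)) (zAct (φ k) (w * (qcol w θ φ k).1, (qcol w θ φ k).2))

/-- Angles are found over `ℂ[X]` and used after evaluation: at a number for the Fourier circuits, at
a matrix for the walk. -/
theorem qcol_map (f : R →ₐ[ℂ] R') (w : R) (θ φ : ℕ → ℝ) (k : ℕ) :
    qcol (f w) θ φ k = (f (qcol w θ φ k).1, f (qcol w θ φ k).2) := by
  induction k with
  | zero => simp [qcol, yAct]
  | succ k ih => simp only [qcol, yAct, zAct, ih, map_add, map_sub, map_smul, map_mul]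

theorem qcol_congr (w : R) {θ φ θ' φ' : ℕ → ℝ} (k : ℕ) (hθ : ∀ j ≤ k, θ j = θ' j)
    (hφ : ∀ j < k, φ j = φ' j) : qcol w θ φ k = qcol w θ' φ' k := by
  induction k with
  | zero => simp [qcol, hθ]
  | succ k ih =>
    simp only [qcol, ih (fun j hj => hθ j (by omega)) fun j hj => hφ j (by omega), hθ (k + 1) le_rfl,
      hφ k (Nat.lt_succ_self k)]

theorem yAct_smul (θ : ℝ) (c : ℂ) (v : R × R) : yAct θ (c • v) = c • yAct θ v := by
  simp only [yAct, Prod.smul_mk, Prod.smul_fst, Prod.smul_snd, smul_sub, smul_add,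
    smul_comm c]

theorem zAct_smul (φ : ℝ) (c : ℂ) (v : R × R) : zAct φ (c • v) = c • zAct φ v := by
  simp only [zAct, Prod.smul_mk, Prod.smul_fst, Prod.smul_snd, smul_comm c]

theorem zPhase_neg_mul (φ : ℝ) (b : Bool) : zPhase φ b * zPhase (-φ) b = 1 := by
  rw [zPhase, zPhase, ← Complex.exp_add, ← Complex.exp_zero]
  congr 1
  push_cast; ring

theorem conj_zPhase (φ : ℝ) (b : Bool) : conj (zPhase φ b) = zPhase (-φ) b := by
  rw [zPhase, zPhase, ← Complex.exp_conj]
  congr 1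
  simp only [map_neg, map_mul, Complex.conj_I, Complex.conj_ofReal]
  push_cast; ring

theorem zPhase_true (φ : ℝ) : zPhase φ true = zPhase (-φ) false := by
  simp [zPhase, neg_div]

theorem zAct_neg (φ : ℝ) (v : R × R) : zAct φ (zAct (-φ) v) = v := by
  simp [zAct, smul_smul, zPhase_neg_mul]

theorem cos_sq_add_sin_sq_complex (t : ℝ) :
    (Real.cos t : ℂ) * Real.cos t + (Real.sin t : ℂ) * Real.sin t = 1 := by
  have := Real.cos_sq_add_sin_sq t
  rw [sq, sq] at this
  exact_mod_cast this

theorem yAct_neg (θ : ℝ) (v : R × R) : yAct θ (yAct (-θ) v) = v := by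
  have h := cos_sq_add_sin_sq_complex (θ / 2)
  have h' : (Real.sin (θ / 2) : ℂ) * Real.sin (θ / 2) + Real.cos (θ / 2) * Real.cos (θ / 2) = 1 := by
    rw [add_comm]; exact h
  obtain ⟨a, b⟩ := v
  simp only [yAct, neg_div, Real.cos_neg, Real.sin_neg, Complex.ofReal_neg, neg_smul, smul_add,
    smul_sub, smul_smul, smul_neg, Prod.mk.injEq]
  constructor
  · rw [mul_comm (Real.cos (θ / 2) : ℂ) (Real.sin (θ / 2))]
    conv_rhs => rw [← one_smul ℂ a, ← h, add_smul]
    abel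
  · rw [mul_comm (Real.cos (θ / 2) : ℂ) (Real.sin (θ / 2))]
    conv_rhs => rw [← one_smul ℂ b, ← h', add_smul]
    abel

end Signal

theorem exists_real_kill (p q : ℝ) : ∃ t : ℝ, Real.cos t * p + Real.sin t * q = 0 := by
  refine ⟨Complex.arg ⟨q, -p⟩, ?_⟩
  have h1 := Complex.norm_mul_cos_arg ⟨q, -p⟩
  have h2 := Complex.norm_mul_sin_arg ⟨q, -p⟩
  simp only at h1 h2
  linear_combination (-Real.sin (Complex.arg ⟨q, -p⟩)) * h1
    + Real.cos (Complex.arg ⟨q, -p⟩) * h2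

/-- The mean of the two arguments goes into the common phase, their difference into the
`Z`-rotation. -/
theorem zPhase_mul_polar (u v : ℂ) :
    ∃ φ : ℝ, ∃ μ : ℂ, ‖μ‖ = 1 ∧ u = μ * zPhase φ false * ‖u‖ ∧ v = μ * zPhase φ true * ‖v‖ := by
  refine ⟨v.arg - u.arg, Complex.exp ((((u.arg + v.arg) / 2 : ℝ) : ℂ) * Complex.I),
    Complex.norm_exp_ofReal_mul_I _, ?_, ?_⟩
  · conv_lhs => rw [← Complex.norm_mul_exp_arg_mul_I u]
    rw [zPhase, ← Complex.exp_add, mul_comm]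
    congr 2
    simp only [sgn_false]; push_cast; ring
  · conv_lhs => rw [← Complex.norm_mul_exp_arg_mul_I v]
    rw [zPhase, ← Complex.exp_add, mul_comm]
    congr 2
    simp only [sgn_true]; push_cast; ring

/-- Some rotation maps a given vector to the second axis. -/
theorem exists_kill (u v : ℂ) : ∃ θ φ : ℝ, (yAct (-θ) (zAct (-φ) (u, v))).1 = 0 := by
  obtain ⟨φ, μ, -, hu, hv⟩ := zPhase_mul_polar u v
  obtain ⟨t, ht⟩ := exists_real_kill ‖u‖ ‖v‖
  refine ⟨2 * t, φ, ?_⟩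
  have ht' : (Real.cos t : ℂ) * ‖u‖ + (Real.sin t : ℂ) * ‖v‖ = 0 := by exact_mod_cast ht
  have e1 : zPhase (-φ) false * u = μ * ‖u‖ := by
    conv_lhs => rw [hu]
    linear_combination (μ * ‖u‖) * zPhase_neg_mul φ false
  have e2 : zPhase (-φ) true * v = μ * ‖v‖ := by
    conv_lhs => rw [hv]
    linear_combination (μ * ‖v‖) * zPhase_neg_mul φ true
  simp only [yAct, zAct, smul_eq_mul, e1, e2]
  rw [show -(2 * t) / 2 = -t by ring, Real.cos_neg, Real.sin_neg, Complex.ofReal_neg]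
  linear_combination μ * ht'

theorem yAct_normSq (θ : ℝ) (v : ℂ × ℂ) :
    Complex.normSq (yAct θ v).1 + Complex.normSq (yAct θ v).2
      = Complex.normSq v.1 + Complex.normSq v.2 := by
  have h := Real.cos_sq_add_sin_sq (θ / 2)
  simp only [yAct, smul_eq_mul, Complex.normSq_apply, Complex.sub_re, Complex.sub_im,
    Complex.add_re, Complex.add_im, Complex.re_ofReal_mul, Complex.im_ofReal_mul]
  linear_combination (v.1.re ^ 2 + v.1.im ^ 2 + v.2.re ^ 2 + v.2.im ^ 2) * h

theorem normSq_zPhase (φ : ℝ) (b : Bool) : Complex.normSq (zPhase φ b) = 1 := by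
  have : (Complex.normSq (zPhase φ b) : ℂ) = 1 := by
    rw [← Complex.mul_conj, conj_zPhase, zPhase_neg_mul]
  exact_mod_cast this

theorem zAct_normSq (φ : ℝ) (v : ℂ × ℂ) :
    Complex.normSq (zAct φ v).1 + Complex.normSq (zAct φ v).2
      = Complex.normSq v.1 + Complex.normSq v.2 := by
  simp [zAct, Complex.normSq_mul, normSq_zPhase]

/-- The rotations are unitary and preserve orthogonality: once the nonzero vector `(a, b)` lies on
the second axis, a vector orthogonal to it lies on the first. -/
theorem kill_orthogonal {a b c d : ℂ} {θ φ : ℝ} (horth : c * conj a + d * conj b = 0)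
    (h : (yAct (-θ) (zAct (-φ) (a, b))).1 = 0) (hne : a ≠ 0 ∨ b ≠ 0) :
    (yAct (-θ) (zAct (-φ) (c, d))).2 = 0 := by
  have hcs := cos_sq_add_sin_sq_complex (θ / 2)
  have hz1 := zPhase_neg_mul φ false
  have hz2 := zPhase_neg_mul φ true
  have hc1 := conj_zPhase φ false
  have hc2 := conj_zPhase φ true
  have hc3 := conj_zPhase (-φ) false
  have hc4 := conj_zPhase (-φ) true
  rw [neg_neg] at hc3 hc4
  simp only [yAct, zAct, smul_eq_mul, neg_div, Real.cos_neg, Real.sin_neg,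
    Complex.ofReal_neg] at h ⊢
  rw [zPhase_true, zPhase_true] at *
  rw [neg_neg] at *
  set p := zPhase φ false
  set r := zPhase (-φ) false
  set C := (Real.cos (θ / 2) : ℂ)
  set S := (Real.sin (θ / 2) : ℂ)
  have hC : conj C = C := Complex.conj_ofReal _
  have hS : conj S = S := Complex.conj_ofReal _
  have h' := congrArg conj h
  simp only [map_sub, map_mul, map_neg, map_zero, hC, hS, hc1, hc3] at h'
  have ka : conj a * (-S * (r * c) + C * (p * d)) = 0 := by
    linear_combination (-S * r) * horth + d * h'
  have kb : conj b * (-S * (r * c) + C * (p * d)) = 0 := by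
    linear_combination (C * p) * horth - c * h'
  rcases hne with ha | hb
  · exact (mul_eq_zero.1 ka).resolve_left ((_root_.map_ne_zero _).2 ha)
  · exact (mul_eq_zero.1 kb).resolve_left ((_root_.map_ne_zero _).2 hb)

theorem coeff_yAct_zAct (θ φ : ℝ) (A B : ℂ[X]) (k : ℕ) :
    (((yAct θ (zAct φ (A, B))).1.coeff k, (yAct θ (zAct φ (A, B))).2.coeff k) : ℂ × ℂ)
      = yAct θ (zAct φ (A.coeff k, B.coeff k)) := by
  simp [yAct, zAct]

theorem eval_yAct_zAct (θ φ : ℝ) (A B : ℂ[X]) (z : ℂ) :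
    (((yAct θ (zAct φ (A, B))).1.eval z, (yAct θ (zAct φ (A, B))).2.eval z) : ℂ × ℂ)
      = yAct θ (zAct φ (A.eval z, B.eval z)) := by
  simp [yAct, zAct]

/-- Every complementary pair of polynomials is the first column of a signal-processing sequence,
up to a global phase. -/
theorem exists_angles_pair (D : ℕ) (A B : ℂ[X]) (hA : A.natDegree ≤ D) (hB : B.natDegree ≤ D)
    (h : ∀ z : ℂ, ‖z‖ = 1 → Complex.normSq (A.eval z) + Complex.normSq (B.eval z) = 1) :
    ∃ (θ φ : ℕ → ℝ) (μ : ℂ), ‖μ‖ = 1 ∧ (A, B) = μ • zAct (φ D) (qcol X θ φ D) := by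
  induction D generalizing A B with
  | zero =>
    obtain ⟨a, rfl⟩ : ∃ c, A = C c := ⟨_, eq_C_of_natDegree_le_zero hA⟩
    obtain ⟨b, rfl⟩ : ∃ c, B = C c := ⟨_, eq_C_of_natDegree_le_zero hB⟩
    have h1 := h 1 (by simp)
    rw [eval_C, eval_C, Complex.normSq_eq_norm_sq, Complex.normSq_eq_norm_sq] at h1
    obtain ⟨φ, μ, hμ, ha, hb⟩ := zPhase_mul_polar a b
    have hcos : Real.cos (Real.arccos ‖a‖) = ‖a‖ :=
      Real.cos_arccos (by linarith [norm_nonneg a]) (by nlinarith [norm_nonneg a, sq_nonneg ‖b‖])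
    have hsin : Real.sin (Real.arccos ‖a‖) = ‖b‖ := by
      rw [Real.sin_arccos, show 1 - ‖a‖ ^ 2 = ‖b‖ ^ 2 by linarith, Real.sqrt_sq (norm_nonneg b)]
    refine ⟨fun _ => 2 * Real.arccos ‖a‖, fun _ => φ, μ, hμ, ?_⟩
    simp only [qcol, yAct, zAct, mul_div_cancel_left₀ _ (two_ne_zero' ℝ), hcos, hsin, smul_zero,
      sub_zero, add_zero, Prod.smul_mk, smul_smul, Prod.mk.injEq]
    constructor
    · rw [← mul_assoc, ← ha, ← Algebra.algebraMap_eq_smul_one]; rfl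
    · rw [← mul_assoc, ← hb, ← Algebra.algebraMap_eq_smul_one]; rfl
  | succ D ih =>
    have hid : A * conjReflect (D + 1) A + B * conjReflect (D + 1) B = X ^ (D + 1) := by
      apply eq_of_eval_eq_on_circle
      intro z hz
      have h1 : A.eval z * conj (A.eval z) + B.eval z * conj (B.eval z) = 1 := by
        rw [Complex.mul_conj, Complex.mul_conj, ← Complex.ofReal_add, h z hz, Complex.ofReal_one]
      rw [eval_add, eval_mul, eval_mul, eval_conjReflect_of_norm hA hz,
        eval_conjReflect_of_norm hB hz, eval_pow, eval_X]
      linear_combination z ^ (D + 1) * h1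
    -- The coefficient of degree `2 (D + 1)` in the normalisation identity; on the right it is `0`
    -- because `D + 1 < 2 (D + 1)`.
    have horth : A.coeff (D + 1) * conj (A.coeff 0) + B.coeff (D + 1) * conj (B.coeff 0) = 0 := by
      have h2 := congrArg (fun P => coeff P (D + 1 + (D + 1))) hid
      simp only [coeff_add, coeff_X_pow] at h2
      rw [coeff_mul_add_eq_of_natDegree_le hA (natDegree_conjReflect_le hA),
        coeff_mul_add_eq_of_natDegree_le hB (natDegree_conjReflect_le hB),
        coeff_conjReflect le_rfl, coeff_conjReflect le_rfl, Nat.sub_self, if_neg (by omega)] at h2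
      exact h2
    -- The last rotations to be undone. They kill the constant coefficient of the first component,
    -- and orthogonality then kills the top coefficient of the second. If both constant coefficients
    -- vanish, the vector to be killed is one orthogonal to the top coefficients.
    obtain ⟨θ', φ', hk0, hkD⟩ : ∃ θ φ : ℝ,
        (yAct (-θ) (zAct (-φ) (A.coeff 0, B.coeff 0))).1 = 0 ∧
        (yAct (-θ) (zAct (-φ) (A.coeff (D + 1), B.coeff (D + 1)))).2 = 0 := by
      by_cases hne : A.coeff 0 ≠ 0 ∨ B.coeff 0 ≠ 0
      · obtain ⟨θ, φ, hk⟩ := exists_kill (A.coeff 0) (B.coeff 0)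
        exact ⟨θ, φ, hk, kill_orthogonal horth hk hne⟩
      · push Not at hne
        rw [hne.1, hne.2]
        by_cases hne' : A.coeff (D + 1) ≠ 0 ∨ B.coeff (D + 1) ≠ 0
        · obtain ⟨θ, φ, hk⟩ := exists_kill (-conj (B.coeff (D + 1))) (conj (A.coeff (D + 1)))
          refine ⟨θ, φ, by simp [yAct, zAct], kill_orthogonal ?_ hk ?_⟩
          · simp; ring
          · rcases hne' with h3 | h3
            · right; simpa using h3
            · left; simpa using h3
        · push Not at hne'
          exact ⟨0, 0, by simp [yAct, zAct], by simp [yAct, zAct, hne'.1, hne'.2]⟩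
    set v := yAct (-θ') (zAct (-φ') (A, B)) with hv
    have hcoeff : ∀ k, ((v.1.coeff k, v.2.coeff k) : ℂ × ℂ)
        = yAct (-θ') (zAct (-φ') (A.coeff k, B.coeff k)) := coeff_yAct_zAct _ _ A B
    have hcoeff0 : ∀ k, D + 1 < k → v.1.coeff k = 0 ∧ v.2.coeff k = 0 := by
      intro k hk
      have h3 := hcoeff k
      rw [coeff_eq_zero_of_natDegree_lt (hA.trans_lt hk),
        coeff_eq_zero_of_natDegree_lt (hB.trans_lt hk)] at h3
      simpa [yAct, zAct] using h3
    -- The first component is divisible by `X`, so one factor `diag (X, 1)` comes off and both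
    -- components have degree at most `D`.
    have hX : v.1 = X * v.1.divX := by
      conv_lhs => rw [← v.1.X_mul_divX_add]
      rw [show v.1.coeff 0 = 0 from (congrArg Prod.fst (hcoeff 0)).trans hk0, C_0, add_zero]
    have hd1 : v.1.divX.natDegree ≤ D := by
      rw [natDegree_le_iff_coeff_eq_zero]
      intro N hN
      rw [coeff_divX]
      exact (hcoeff0 (N + 1) (by omega)).1
    have hd2 : v.2.natDegree ≤ D := by
      rw [natDegree_le_iff_coeff_eq_zero]
      intro N hN
      by_cases hN' : N = D + 1
      · subst hN'
        exact (congrArg Prod.snd (hcoeff (D + 1))).trans hkD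
      · exact (hcoeff0 N (by omega)).2
    obtain ⟨θ, φ, μ, hμ, hrec⟩ := ih v.1.divX v.2 hd1 hd2 (by
      intro z hz
      have h3 : Complex.normSq (v.1.eval z) + Complex.normSq (v.2.eval z) = 1 := by
        have h4 := eval_yAct_zAct (-θ') (-φ') A B z
        rw [← hv] at h4
        rw [show v.1.eval z = _ from congrArg Prod.fst h4,
          show v.2.eval z = _ from congrArg Prod.snd h4, yAct_normSq, zAct_normSq, h z hz]
      rwa [hX, eval_mul, eval_X, Complex.normSq_mul, Complex.normSq_eq_norm_sq z, hz, one_pow,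
        one_mul] at h3)
    refine ⟨Function.update θ (D + 1) θ', Function.update φ (D + 1) φ', μ, hμ, ?_⟩
    have hAB : (A, B) = zAct φ' (yAct θ' v) := by rw [hv, yAct_neg, zAct_neg]
    have hvv : v = μ • zAct (φ D) (X * (qcol X θ φ D).1, (qcol X θ φ D).2) := by
      have e1 := congrArg Prod.fst hrec
      have e2 := congrArg Prod.snd hrec
      apply Prod.ext
      · rw [hX]
        simp only [zAct, Prod.smul_mk] at e1 ⊢
        rw [e1, mul_smul_comm, mul_smul_comm]
      · simpa only [zAct, Prod.smul_mk, Prod.smul_snd] using e2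
    rw [hAB, hvv, yAct_smul, zAct_smul]
    congr 1
    have hc : qcol (X : ℂ[X]) (Function.update θ (D + 1) θ') (Function.update φ (D + 1) φ') D
        = qcol X θ φ D := qcol_congr X D
      (fun j hj => Function.update_of_ne (by omega) _ _)
      (fun j hj => Function.update_of_ne (by omega) _ _)
    rw [Function.update_self, qcol, Function.update_self,
      Function.update_of_ne (show D ≠ D + 1 by omega), hc]

/-- Every polynomial bounded by `1` on the unit circle is the corner of a signal-processing
sequence. -/
theorem exists_angles (D : ℕ) (A : ℂ[X]) (hA : A.natDegree ≤ D)
    (h : ∀ z : ℂ, ‖z‖ = 1 → ‖A.eval z‖ ≤ 1) :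
    ∃ (θ φ : ℕ → ℝ), A = zPhase (φ D) false • (qcol X θ φ D).1 := by
  obtain ⟨B, hB, hAB⟩ := exists_complement D A hA h
  obtain ⟨θ, φ, μ, hμ, heq⟩ := exists_angles_pair D A B hA hB hAB
  -- Only the first entry matters, so the global phase is absorbed by the last `Z`-angle, which
  -- enters as `exp (-i φ / 2)`.
  refine ⟨θ, Function.update φ D (φ D - 2 * μ.arg), ?_⟩
  have h1 := congrArg Prod.fst heq
  simp only [zAct, Prod.smul_mk, smul_smul] at h1
  rw [Function.update_self, qcol_congr X D (θ' := θ) (φ' := φ) (fun _ _ => rfl)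
    (fun j hj => Function.update_of_ne (by omega) _ _)]
  conv_lhs => rw [h1]
  congr 1
  have h2 : μ = Complex.exp (μ.arg * Complex.I) := by
    conv_lhs => rw [← Complex.norm_mul_exp_arg_mul_I μ, hμ, Complex.ofReal_one, one_mul]
  conv_lhs => rw [h2]
  rw [zPhase, zPhase, ← Complex.exp_add]
  congr 1
  simp only [sgn_false]; push_cast; ring

end

section

open Matrix Polynomial ComplexConjugate

/-! ### Signal processing on a wire -/

section Run

variable {W : Type} [Fintype W] [DecidableEq W]

/-- The first column of a one-qubit matrix. -/
def colOf (N : Matrix Bool Bool ℂ) : ℂ × ℂ := (N false false, N true false)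

theorem colOf_rotY_mul (θ : ℝ) (N : Matrix Bool Bool ℂ) :
    colOf (rotMatrix .Y θ * N) = yAct θ (colOf N) := by
  simp [colOf, yAct, rotMatrix_Y_apply, Matrix.mul_apply, -Complex.ofReal_cos,
    -Complex.ofReal_sin, sub_eq_add_neg, add_comm]

theorem colOf_diagonal_mul (d : Bool → ℂ) (N : Matrix Bool Bool ℂ) :
    colOf (Matrix.diagonal d * N) = (d false * (colOf N).1, d true * (colOf N).2) := by
  simp [colOf]

theorem colOf_smul (c : ℂ) (N : Matrix Bool Bool ℂ) : colOf (c • N) = c • colOf N := by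
  simp [colOf]

theorem colOf_one : colOf 1 = (1, 0) := by
  simp [colOf]

/-- The circuit `I, S 0, Y 1, S 1, Y 2, …`. -/
def run (I : Circuit W) (S Y : ℕ → Circuit W) : ℕ → Circuit W
  | 0 => I
  | k + 1 => run I S Y k ++ (S k ++ Y (k + 1))

/-- `diag (h, h⁻¹)` is the scalar `h⁻¹` times `diag (h ^ 2, 1)`, so each signal is a step with `w =
h ^ 2` at the price of a factor `h⁻¹`. Angles may depend on the other wires, which is what the
two-branch circuit needs. -/
theorem matrix_run {q : W} {I : Circuit W} {S Y : ℕ → Circuit W} {p h : (W → Bool) → ℂ}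
    {θ φ : (W → Bool) → ℕ → ℝ} (hh : ∀ x, h x ≠ 0)
    (hI : I.matrix = mux q fun x => p x • rotMatrix .Y (θ x 0))
    (hS : ∀ k, (S k).matrix = mux q fun x => Matrix.diagonal fun s =>
      (if s then (h x)⁻¹ else h x) * zPhase (φ x k) s)
    (hY : ∀ k, (Y k).matrix = mux q fun x => rotMatrix .Y (θ x k)) (k : ℕ) :
    ∃ N : (W → Bool) → Matrix Bool Bool ℂ, (run I S Y k).matrix = mux q N ∧
      ∀ x, colOf (N x) = (p x * (h x)⁻¹ ^ k) • qcol (h x ^ 2) (θ x) (φ x) k := by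
  induction k with
  | zero =>
    refine ⟨_, hI, fun x => ?_⟩
    rw [colOf_smul, ← Matrix.mul_one (rotMatrix .Y (θ x 0)), colOf_rotY_mul, colOf_one, pow_zero,
      mul_one]
    rfl
  | succ k ih =>
    obtain ⟨N, hN, hcol⟩ := ih
    refine ⟨fun x => rotMatrix .Y (θ x (k + 1)) * ((Matrix.diagonal fun s =>
        (if s then (h x)⁻¹ else h x) * zPhase (φ x k) s) * N x), ?_, ?_⟩
    · rw [run, Circuit.matrix_append, Circuit.matrix_append, hN, hS, hY, Matrix.mul_assoc, mux_mul,
        mux_mul]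
    · intro x
      rw [colOf_rotY_mul, colOf_diagonal_mul, hcol x, qcol, ← yAct_smul]
      congr 1
      have := hh x
      apply Prod.ext
      · simp only [zAct, Prod.smul_mk, Prod.smul_fst, smul_eq_mul, if_false, Bool.false_eq_true]
        linear_combination (-(h x * zPhase (φ x k) false * p x * (h x)⁻¹ ^ k
          * (qcol (h x ^ 2) (θ x) (φ x) k).1)) * mul_inv_cancel₀ this
      · simp only [zAct, Prod.smul_mk, Prod.smul_snd, smul_eq_mul, if_true]
        ring

theorem rotDepth_run_le {I : Circuit W} {S Y : ℕ → Circuit W} {i r : ℕ} (hI : I.rotDepth ≤ i)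
    (hSY : ∀ k, (S k).rotDepth + (Y (k + 1)).rotDepth ≤ r) (k : ℕ) :
    (run I S Y k).rotDepth ≤ i + r * k := by
  induction k with
  | zero => simpa [run] using hI
  | succ k ih =>
    rw [run, Circuit.rotDepth_append, Circuit.rotDepth_append]
    have := hSY k
    rw [mul_add]
    omega

theorem tofDepth_run_le {I : Circuit W} {S Y : ℕ → Circuit W} {i r : ℕ} (hI : I.tofDepth ≤ i)
    (hSY : ∀ k, (S k).tofDepth + (Y (k + 1)).tofDepth ≤ r) (k : ℕ) :
    (run I S Y k).tofDepth ≤ i + r * k := by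
  induction k with
  | zero => simpa [run] using hI
  | succ k ih =>
    rw [run, Circuit.tofDepth_append, Circuit.tofDepth_append]
    have := hSY k
    rw [mul_add]
    omega

/-- A rotation of `q` about `X ≠ p` by `δ` or `-δ`, according to the wire `c`. -/
theorem cx_conj_rot {c q : W} {p : Axis} (h : c ∉ ({q} : Finset W))
    (hp : ∀ θ, pauli .X * rotMatrix p θ * pauli .X = rotMatrix p (-θ)) (μ δ : ℝ) :
    (Gate.fanout c {q} h).matrix * onQubit q (rotMatrix p δ) * (Gate.fanout c {q} h).matrix
      * onQubit q (rotMatrix p μ) = mux q fun x => rotMatrix p (μ + sgn (x c) * δ) := by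
  rw [cx_eq_mux, onQubit_eq_mux, onQubit_eq_mux, mux_mul, mux_mul, mux_mul]
  congr 1
  funext x
  cases x c
  · simp only [Bool.false_eq_true, if_false, Matrix.one_mul, Matrix.mul_one, rotMatrix_mul]
    congr 1; simp [add_comm]
  · simp only [if_true, hp, rotMatrix_mul]
    congr 1; simp [add_comm]

theorem onQubit_mul_apply (q : W) (M : Matrix Bool Bool ℂ) (N : Matrix (W → Bool) (W → Bool) ℂ)
    (x y : W → Bool) :
    (onQubit q M * N) x y = ∑ s, M (x q) s * N (Function.update x q s) y := by
  rw [Matrix.mul_apply]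
  symm
  apply Fintype.sum_of_injective (fun s : Bool => Function.update x q s)
    (fun s t hst => by simpa using congrFun hst q)
  · intro z hz
    simp only [onQubit, Matrix.of_apply]
    rw [if_neg, zero_mul]
    intro h
    apply hz
    refine ⟨z q, ?_⟩
    simp only
    rw [update_eq_of_agree h, Function.update_eq_self]
  · intro s
    simp only [onQubit, Matrix.of_apply, Function.update_self]
    rw [if_pos]
    intro w hw
    simp [Function.update_of_ne hw]

theorem mul_onQubit_apply (q : W) (M : Matrix Bool Bool ℂ) (N : Matrix (W → Bool) (W → Bool) ℂ)
    (x y : W → Bool) :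
    (N * onQubit q M) x y = ∑ s, N x (Function.update y q s) * M s (y q) := by
  rw [Matrix.mul_apply]
  symm
  apply Fintype.sum_of_injective (fun s : Bool => Function.update y q s)
    (fun s t hst => by simpa using congrFun hst q)
  · intro z hz
    simp only [onQubit, Matrix.of_apply]
    rw [if_neg, mul_zero]
    intro h
    apply hz
    refine ⟨z q, ?_⟩
    simp only
    rw [← update_eq_of_agree h, Function.update_eq_self]
  · intro s
    simp only [onQubit, Matrix.of_apply, Function.update_self]
    rw [if_pos]
    intro w hw
    simp [Function.update_of_ne hw]

end Run

/-! ### Fourier sums -/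

section Fourier

variable {n : ℕ}

/-- The symmetric coordinate `1 - 2 x` of a grid point `x`. -/
def symPoint (b : Fin n → Bool) : ℝ := ∑ l : Fin n, 2 ^ (l : ℕ) / ((2 : ℝ) ^ n - 1) * sgn (b l)

theorem two_pow_sub_one_pos (hn : 1 ≤ n) : (0 : ℝ) < 2 ^ n - 1 := by
  have : (1 : ℝ) < 2 ^ n := one_lt_pow₀ (by norm_num) (by omega)
  linarith

theorem symPoint_eq (hn : 1 ≤ n) (b : Fin n → Bool) : symPoint b = 1 - 2 * gridPoint b := by
  have hpos := two_pow_sub_one_pos hn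
  have h1 : ∀ l : Fin n, (2 : ℝ) ^ (l : ℕ) / ((2 : ℝ) ^ n - 1) * sgn (b l)
      = 2 ^ (l : ℕ) / ((2 : ℝ) ^ n - 1)
        - 2 * ((if b l then (2 : ℝ) ^ (l : ℕ) else 0) / ((2 : ℝ) ^ n - 1)) := by
    intro l
    cases b l <;> simp
    ring
  have h2 : ∑ l : Fin n, (2 : ℝ) ^ (l : ℕ) = 2 ^ n - 1 := by
    rw [Fin.sum_univ_eq_sum_range (fun i => (2 : ℝ) ^ i) n, geom_sum_eq (by norm_num)]
    norm_num
  rw [symPoint, Finset.sum_congr rfl fun l _ => h1 l, Finset.sum_sub_distrib, ← Finset.sum_div, h2,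
    div_self hpos.ne', ← Finset.mul_sum, ← Finset.sum_div]
  rfl

/-- This is why `1 - 2 x` replaces `x`: a fan-out from one ancilla inverts every data phase at once,
so a controlled data phase costs a single rotation layer. -/
theorem symPoint_xor (b : Fin n → Bool) (s : Bool) :
    symPoint (fun l => xor (b l) s) = symPoint b * sgn s := by
  simp only [symPoint, sgn_xor, Finset.sum_mul, mul_assoc]

/-- The phase of a layer of `Z`-rotations of the data. -/
def dPhase (ψ : ℝ) (b : Fin n → Bool) : ℂ :=
  Complex.exp (-(Complex.I * ((ψ / 2 * symPoint b : ℝ) : ℂ)))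

/-- The wire that carries the signal-processing rotations. -/
def qW : Fin n ⊕ Fin 2 := Sum.inr 0

/-- The wire that chooses one of two branches. -/
def cW : Fin n ⊕ Fin 2 := Sum.inr 1

/-- The angles `ψ 2 ^ l / (2 ^ n - 1)` on the data and `θ` on the wire `qW`. -/
def anglesAt (ψ θ : ℝ) : Fin n ⊕ Fin 2 → ℝ
  | .inl l => ψ * (2 ^ (l : ℕ) / ((2 : ℝ) ^ n - 1))
  | .inr i => if i = 0 then θ else 0

/-- The axes `Z` on the data, `p` elsewhere. -/
def axesAt (p : Axis) : Fin n ⊕ Fin 2 → Axis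
  | .inl _ => .Z
  | .inr _ => p

/-- Rotations of the data about `Z` and of the wire `qW` about `p`. -/
def dqLayer (p : Axis) (ψ θ : ℝ) : Layer (Fin n ⊕ Fin 2) := rotLayer (axesAt p) (anglesAt ψ θ)

/-- The data and `qW` are different wires, so their rotations share one layer. -/
theorem matrix_dqLayer (p : Axis) (ψ θ : ℝ) :
    (dqLayer (n := n) p ψ θ).matrix = Matrix.diagonal (fun x => dPhase ψ (x ∘ Sum.inl))
      * onQubit qW (rotMatrix p θ) := by
  let d : Fin n ⊕ Fin 2 → Bool → ℂ := Sum.elim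
    (fun l b => Complex.exp (-(Complex.I *
      ((ψ * (2 ^ (l : ℕ) / ((2 : ℝ) ^ n - 1)) / 2 * sgn b : ℝ) : ℂ)))) fun _ _ => 1
  have hd : (Matrix.diagonal fun x : Fin n ⊕ Fin 2 → Bool => dPhase ψ (x ∘ Sum.inl))
      = tens fun w => Matrix.diagonal (d w) := by
    rw [tens_diagonal]
    congr 1
    funext x
    rw [Fintype.prod_sum_type]
    simp only [d, Sum.elim_inl, Sum.elim_inr, Finset.prod_const_one, mul_one]
    rw [← Complex.exp_sum, dPhase]
    congr 1
    rw [Finset.sum_neg_distrib, ← Finset.mul_sum, ← Complex.ofReal_sum, symPoint, Finset.mul_sum]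
    congr 3
    apply Finset.sum_congr rfl
    intro l _
    simp only [Function.comp_apply]
    ring
  rw [dqLayer, matrix_rotLayer, hd, onQubit_eq_tens, tens_mul]
  congr 1
  funext w
  rcases w with l | i
  · rw [Function.update_of_ne (by simp [qW]), Matrix.mul_one]
    exact rotMatrix_Z_eq _
  · have h1 : Matrix.diagonal (d (Sum.inr i)) = 1 := by simp [d]
    rw [h1, Matrix.one_mul]
    by_cases hi : i = 0
    · subst hi
      rw [show (Sum.inr 0 : Fin n ⊕ Fin 2) = qW from rfl, Function.update_self]
      rfl
    · rw [Function.update_of_ne (by simpa [qW] using hi)]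
      simp [axesAt, anglesAt, hi, rotMatrix_zero]

theorem dPhase_zero (b : Fin n → Bool) : dPhase 0 b = 1 := by simp [dPhase]

theorem matrix_dqLayer_zero (p : Axis) (θ : ℝ) :
    (dqLayer (n := n) p 0 θ).matrix = onQubit qW (rotMatrix p θ) := by
  rw [matrix_dqLayer]
  simp [dPhase_zero]

/-- The data wires. -/
def dataW (n : ℕ) : Finset (Fin n ⊕ Fin 2) := Finset.univ.map ⟨Sum.inl, Sum.inl_injective⟩

theorem inr_notMem_dataW (i : Fin 2) : (Sum.inr i : Fin n ⊕ Fin 2) ∉ dataW n := by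
  simp [dataW]

/-- The fan-out from an ancilla to the data. -/
def fanData (i : Fin 2) : Gate (Fin n ⊕ Fin 2) :=
  .fanout (Sum.inr i) (dataW n) (inr_notMem_dataW i)

theorem fanData_conj (i : Fin 2) (d : (Fin n ⊕ Fin 2 → Bool) → ℂ) :
    (fanData i).matrix * Matrix.diagonal d * (fanData i).matrix
      = Matrix.diagonal fun x => d (Sum.elim (fun l => xor (x (.inl l)) (x (.inr i)))
          fun j => x (.inr j)) := by
  rw [fanData, matrix_fanout, ofBasisMap_conj_diagonal _ _ (fanMap_fanMap _ _ (inr_notMem_dataW i))]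
  congr 1
  funext x
  rw [Function.comp_apply]
  congr 1
  funext w
  rcases w with l | j <;> simp [fanMap, dataW]

theorem dPhase_xor (ψ : ℝ) (b : Fin n → Bool) (s : Bool) :
    dPhase ψ (fun l => xor (b l) s) = dPhase (ψ * sgn s) b := by
  simp only [dPhase, symPoint_xor]
  congr 4
  ring

theorem dPhase_add (ψ η : ℝ) (b : Fin n → Bool) :
    dPhase (ψ + η) b = dPhase ψ b * dPhase η b := by
  rw [dPhase, dPhase, dPhase, ← Complex.exp_add]
  congr 1
  push_cast; ring

/-- The signal: rotations of the data controlled by `qW`, together with a rotation of `qW`. -/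
def signal (φ : ℝ) : Circuit (Fin n ⊕ Fin 2) :=
  seq [fanData 0] ++ ([dqLayer .Z (1 / 2) φ] ++ seq [fanData 0])

theorem rotDepth_signal_le (φ : ℝ) : (signal (n := n) φ).rotDepth ≤ 1 := by
  have h := rotDepth_rotLayer_le (W := Fin n ⊕ Fin 2) (axesAt .Z) (anglesAt (1 / 2) φ)
  rw [← dqLayer] at h
  rw [signal, Circuit.rotDepth_append, Circuit.rotDepth_append, rotDepth_seq]
  exact (by simpa [fanData, Gate.isRotation] using h)

theorem tofDepth_signal (φ : ℝ) : (signal (n := n) φ).tofDepth = 0 := by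
  have h := tofDepth_rotLayer (W := Fin n ⊕ Fin 2) (axesAt .Z) (anglesAt (1 / 2) φ)
  rw [← dqLayer] at h
  rw [signal, Circuit.tofDepth_append, Circuit.tofDepth_append, tofDepth_seq]
  simpa [fanData, Gate.isToffoli] using h

theorem dPhase_neg (ψ : ℝ) (b : Fin n → Bool) : dPhase (-ψ) b = (dPhase ψ b)⁻¹ := by
  rw [dPhase, dPhase, ← Complex.exp_neg]
  congr 1
  push_cast; ring

/-- With `s` on `qW`, the fan-outs replace the digits by `b ⊕ s` and hence invert the data phase
when `s` is set; the rotation of `qW` commutes with them. -/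
theorem matrix_signal (φ : ℝ) :
    (signal (n := n) φ).matrix = mux qW fun x => Matrix.diagonal fun s =>
      (if s then (dPhase (1 / 2) (x ∘ Sum.inl))⁻¹ else dPhase (1 / 2) (x ∘ Sum.inl))
        * zPhase φ s := by
  rw [signal, Circuit.matrix_append, Circuit.matrix_append, matrix_seq_cons, matrix_seq_nil,
    Matrix.one_mul, Circuit.matrix_singleton, matrix_dqLayer, rotMatrix_Z_eq, onQubit_diagonal,
    Matrix.diagonal_mul_diagonal, fanData_conj, diagonal_eq_mux qW]
  congr 1
  funext x
  congr 1
  funext s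
  have h0 : Function.update x qW s (Sum.inr 0) = s := Function.update_self _ _ _
  have h1 : ((Sum.elim (fun l => xor (Function.update x qW s (Sum.inl l))
      (Function.update x qW s (Sum.inr 0))) fun j => Function.update x qW s (Sum.inr j)) ∘ Sum.inl
      : Fin n → Bool) = fun l => xor ((x ∘ Sum.inl) l) s := by
    funext l
    simp only [Function.comp_apply, Sum.elim_inl, h0]
    rw [Function.update_of_ne (by simp [qW])]
  have h2 : (Sum.elim (fun l => xor (Function.update x qW s (Sum.inl l))
      (Function.update x qW s (Sum.inr 0))) fun j => Function.update x qW s (Sum.inr j)) qW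
      = s := h0
  rw [h1, h2, dPhase_xor]
  cases s
  · rw [sgn_false, mul_one]; rfl
  · rw [sgn_true, mul_neg, mul_one, dPhase_neg]; rfl

/-- The polynomial whose signal-processing sequence yields `exp (i κ x) A (exp (i x))`. -/
def shiftPoly (κ : ℝ) (A : ℂ[X]) : ℂ[X] :=
  C (Complex.exp (Complex.I * κ / 2)) * A.comp (C (Complex.exp (Complex.I / 2)) * X)

theorem natDegree_shiftPoly_le (κ : ℝ) {A : ℂ[X]} {D : ℕ} (hA : A.natDegree ≤ D) :
    (shiftPoly κ A).natDegree ≤ D := by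
  refine (natDegree_C_mul_le _ _).trans (natDegree_comp_le.trans ?_)
  calc A.natDegree * _ ≤ D * 1 := Nat.mul_le_mul hA ((natDegree_C_mul_le _ _).trans natDegree_X_le)
    _ = D := mul_one D

theorem norm_shiftPoly_le (κ : ℝ) {A : ℂ[X]} (h : ∀ z : ℂ, ‖z‖ = 1 → ‖A.eval z‖ ≤ 1) (z : ℂ)
    (hz : ‖z‖ = 1) : ‖(shiftPoly κ A).eval z‖ ≤ 1 := by
  have e : ∀ t : ℝ, ‖Complex.exp (Complex.I * t / 2)‖ = 1 := by
    intro t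
    rw [show Complex.I * t / 2 = ((t / 2 : ℝ) : ℂ) * Complex.I by push_cast; ring]
    exact Complex.norm_exp_ofReal_mul_I _
  have e1 : ‖Complex.exp (Complex.I / 2)‖ = 1 := by simpa using e 1
  simp only [shiftPoly, eval_mul, eval_C, eval_comp, eval_X, norm_mul, e, one_mul]
  exact h _ (by rw [norm_mul, e1, hz, one_mul])

/-- `dPhase (1 / 2) b ^ 2` is `exp (-i / 2) * exp (i x)`, which the substitution in `shiftPoly`
corrects. The initial phase `D / 2` cancels the factor left by `D` signals, and `κ` shifts the
frequencies. -/
theorem shift_identity (hn : 1 ≤ n) (κ : ℝ) (A : ℂ[X]) (D : ℕ) (b : Fin n → Bool) :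
    dPhase (κ + D / 2) b * (dPhase (1 / 2) b)⁻¹ ^ D
        * (shiftPoly κ A).eval (dPhase (1 / 2) b ^ 2)
      = Complex.exp (Complex.I * κ * gridPoint b) * A.eval (Complex.exp (Complex.I * gridPoint b)) := by
  have h1 : Complex.exp (Complex.I / 2) * dPhase (1 / 2) b ^ 2
      = Complex.exp (Complex.I * gridPoint b) := by
    rw [dPhase, ← Complex.exp_nat_mul, ← Complex.exp_add, symPoint_eq hn]
    congr 1
    push_cast; ring
  have h2 : dPhase (κ + D / 2) b * (dPhase (1 / 2) b)⁻¹ ^ D * Complex.exp (Complex.I * κ / 2)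
      = Complex.exp (Complex.I * κ * gridPoint b) := by
    rw [← dPhase_neg, dPhase, dPhase, ← Complex.exp_nat_mul, ← Complex.exp_add,
      ← Complex.exp_add, symPoint_eq hn]
    congr 1
    push_cast; ring
  rw [shiftPoly, eval_mul, eval_C, eval_comp, eval_mul, eval_C, eval_X, h1, ← mul_assoc, h2]

/-- A bounded trigonometric polynomial as a block of a circuit. -/
theorem exists_trig_circuit (hn : 1 ≤ n) (D : ℕ) (A : ℂ[X]) (hA : A.natDegree ≤ D)
    (h : ∀ z : ℂ, ‖z‖ = 1 → ‖A.eval z‖ ≤ 1) (κ : ℝ) :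
    ∃ c : Circuit (Fin n ⊕ Fin 2), c.rotDepth ≤ 2 * D + 2 ∧ c.tofDepth = 0 ∧
      ∀ i j : Fin n → Bool, c.matrix (Sum.elim i fun _ => false) (Sum.elim j fun _ => false)
        = Matrix.diagonal (fun b => Complex.exp (Complex.I * κ * gridPoint b)
            * A.eval (Complex.exp (Complex.I * gridPoint b))) i j := by
  obtain ⟨θ, φ, hθφ⟩ := exists_angles D (shiftPoly κ A) (natDegree_shiftPoly_le κ hA)
    (norm_shiftPoly_le κ h)
  let I : Circuit (Fin n ⊕ Fin 2) := [dqLayer .Y (κ + D / 2) (θ 0)]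
  let Y : ℕ → Circuit (Fin n ⊕ Fin 2) := fun k => [dqLayer .Y 0 (θ k)]
  have hI : I.matrix = mux qW fun x => dPhase (κ + D / 2) (x ∘ Sum.inl) • rotMatrix .Y (θ 0) := by
    rw [Circuit.matrix_singleton, matrix_dqLayer, onQubit_eq_mux, diagonal_eq_mux qW, mux_mul]
    congr 1
    funext x
    have h1 : ∀ s, (Function.update x qW s ∘ Sum.inl : Fin n → Bool) = x ∘ Sum.inl := by
      intro s; funext l; simp [qW]
    simp only [h1]
    rw [← Matrix.smul_one_eq_diagonal, Matrix.smul_mul, Matrix.one_mul]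
  have hY : ∀ k, (Y k).matrix = mux qW fun _ => rotMatrix .Y (θ k) := fun k => by
    rw [Circuit.matrix_singleton, matrix_dqLayer_zero]; rfl
  obtain ⟨N, hN, hcol⟩ := matrix_run (θ := fun _ => θ) (φ := fun _ => φ) (q := qW)
    (h := fun x => dPhase (1 / 2) (x ∘ Sum.inl)) (fun x => Complex.exp_ne_zero _) hI
    (fun k => matrix_signal (φ k)) hY D
  refine ⟨run I (fun k => signal (φ k)) Y D ++ [dqLayer .Z 0 (φ D)], ?_, ?_, ?_⟩
  -- One layer at the start, where data phase and first `Y`-rotation coincide; two per degree; one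
  -- final `Z`-layer.
  · have h1 := rotDepth_run_le (I := I) (S := fun k => signal (φ k)) (Y := Y) (i := 1) (r := 2)
      (rotDepth_rotLayer_le _ _) (fun k => by
        have h2 := rotDepth_signal_le (n := n) (φ k)
        have h3 : (Y (k + 1)).rotDepth ≤ 1 := rotDepth_rotLayer_le _ _
        omega) D
    have h4 : Circuit.rotDepth [dqLayer (n := n) .Z 0 (φ D)] ≤ 1 := rotDepth_rotLayer_le _ _
    rw [Circuit.rotDepth_append]
    omega
  · have h1 := tofDepth_run_le (I := I) (S := fun k => signal (φ k)) (Y := Y) (i := 0) (r := 0)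
      (tofDepth_rotLayer _ _).le (fun k => by
        have h2 := tofDepth_signal (n := n) (φ k)
        have h3 : (Y (k + 1)).tofDepth = 0 := tofDepth_rotLayer _ _
        omega) D
    have h4 : Circuit.tofDepth [dqLayer (n := n) .Z 0 (φ D)] = 0 := tofDepth_rotLayer _ _
    rw [Circuit.tofDepth_append]
    omega
  · intro i j
    rw [Circuit.matrix_append, hN, Circuit.matrix_singleton, matrix_dqLayer_zero, onQubit_eq_mux,
      mux_mul]
    simp only [mux, Matrix.of_apply]
    have hq : Function.update (Sum.elim j fun _ => false : Fin n ⊕ Fin 2 → Bool) qW false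
        = Sum.elim j fun _ => false := by
      rw [Function.update_eq_self_iff]; rfl
    have hcond : (∀ w : Fin n ⊕ Fin 2, w ≠ qW → (Sum.elim i fun _ => false : _ → Bool) w
        = (Sum.elim j fun _ => false : _ → Bool) w) ↔ i = j := by
      constructor
      · intro hw; funext l
        exact hw (Sum.inl l) (by simp [qW])
      · rintro rfl w _; rfl
    rw [hq, Matrix.diagonal_apply]
    simp only [hcond]
    by_cases hij : i = j
    · subst hij
      rw [if_pos rfl, if_pos rfl, ← shift_identity hn κ A D, hθφ, rotMatrix_Z_eq]
      have h1 := congrArg Prod.fst (hcol (Sum.elim i fun _ => false))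
      have h2 : (Sum.elim i fun _ => false : Fin n ⊕ Fin 2 → Bool) ∘ Sum.inl = i := rfl
      have h3 := congrArg Prod.fst (qcol_map (aeval (dPhase (1 / 2) i ^ 2)) (X : ℂ[X]) θ φ D)
      simp only [aeval_X, coe_aeval_eq_eval] at h3
      simp only [colOf, h2, Prod.smul_fst, smul_eq_mul] at h1
      simp only [eval_smul, smul_eq_mul]
      rw [show (Sum.elim i fun _ => false : Fin n ⊕ Fin 2 → Bool) qW = false from rfl,
        Matrix.diagonal_mul, h1, h3, zPhase]
      ring
    · rw [if_neg hij, if_neg hij]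

end Fourier

end

/-! ### Two signal-processing sequences on a branch qubit -/

section

open Matrix Polynomial ComplexConjugate

section TwoBranches

variable {n : ℕ}

theorem cW_notMem : (cW : Fin n ⊕ Fin 2) ∉ ({qW} : Finset (Fin n ⊕ Fin 2)) := by
  simp [cW, qW]

/-- The `CX` gate from the branch wire to the signal-processing wire. -/
def branchGate : Gate (Fin n ⊕ Fin 2) := .fanout cW {qW} cW_notMem

/-- A rotation of `qW` about `p` by `δ` or `-δ`, according to the branch. -/
def branchRot (p : Axis) (δ : ℝ) : Circuit (Fin n ⊕ Fin 2) :=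
  seq [branchGate] ++ ([dqLayer p 0 δ] ++ seq [branchGate])

theorem matrix_branchRot {p : Axis}
    (hp : ∀ θ, pauli .X * rotMatrix p θ * pauli .X = rotMatrix p (-θ)) (δ : ℝ) :
    (branchRot (n := n) p δ).matrix = mux qW fun x => rotMatrix p (sgn (x cW) * δ) := by
  have h := cx_conj_rot (cW_notMem (n := n)) hp 0 δ
  rw [rotMatrix_zero, onQubit_one, Matrix.mul_one] at h
  rw [branchRot, Circuit.matrix_append, Circuit.matrix_append, matrix_seq_cons, matrix_seq_nil,
    Circuit.matrix_singleton, matrix_dqLayer_zero, Matrix.one_mul, branchGate, h]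
  simp only [zero_add]

theorem rotDepth_branchRot_le (p : Axis) (δ : ℝ) : (branchRot (n := n) p δ).rotDepth ≤ 1 := by
  have h := rotDepth_rotLayer_le (W := Fin n ⊕ Fin 2) (axesAt p) (anglesAt 0 δ)
  rw [← dqLayer] at h
  rw [branchRot, Circuit.rotDepth_append, Circuit.rotDepth_append, rotDepth_seq]
  simpa [branchGate, Gate.isRotation] using h

theorem tofDepth_branchRot (p : Axis) (δ : ℝ) : (branchRot (n := n) p δ).tofDepth = 0 := by
  have h := tofDepth_rotLayer (W := Fin n ⊕ Fin 2) (axesAt p) (anglesAt 0 δ)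
  rw [← dqLayer] at h
  rw [branchRot, Circuit.tofDepth_append, Circuit.tofDepth_append, tofDepth_seq]
  simpa [branchGate, Gate.isToffoli] using h

/-- A phase layer of the data by `ψ` or `-ψ`, according to the branch. -/
def branchPhase (ψ : ℝ) : Circuit (Fin n ⊕ Fin 2) :=
  seq [fanData 1] ++ ([dqLayer .Z ψ 0] ++ seq [fanData 1])

theorem matrix_branchPhase (ψ : ℝ) :
    (branchPhase (n := n) ψ).matrix
      = Matrix.diagonal fun x => dPhase (ψ * sgn (x cW)) (x ∘ Sum.inl) := by
  rw [branchPhase, Circuit.matrix_append, Circuit.matrix_append, matrix_seq_cons, matrix_seq_nil,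
    Circuit.matrix_singleton, matrix_dqLayer, Matrix.one_mul, rotMatrix_zero, onQubit_one,
    Matrix.mul_one, fanData_conj]
  congr 1
  funext x
  exact dPhase_xor ψ (x ∘ Sum.inl) (x cW)

theorem rotDepth_branchPhase_le (ψ : ℝ) : (branchPhase (n := n) ψ).rotDepth ≤ 1 := by
  have h := rotDepth_rotLayer_le (W := Fin n ⊕ Fin 2) (axesAt .Z) (anglesAt ψ 0)
  rw [← dqLayer] at h
  rw [branchPhase, Circuit.rotDepth_append, Circuit.rotDepth_append, rotDepth_seq]
  simpa [fanData, Gate.isRotation] using h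

theorem tofDepth_branchPhase (ψ : ℝ) : (branchPhase (n := n) ψ).tofDepth = 0 := by
  have h := tofDepth_rotLayer (W := Fin n ⊕ Fin 2) (axesAt .Z) (anglesAt ψ 0)
  rw [← dqLayer] at h
  rw [branchPhase, Circuit.tofDepth_append, Circuit.tofDepth_append, tofDepth_seq]
  simpa [fanData, Gate.isToffoli] using h

theorem rotDepth_dqLayer_le (p : Axis) (ψ θ : ℝ) :
    Circuit.rotDepth [dqLayer (n := n) p ψ θ] ≤ 1 := rotDepth_rotLayer_le _ _

theorem tofDepth_dqLayer (p : Axis) (ψ θ : ℝ) :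
    Circuit.tofDepth [dqLayer (n := n) p ψ θ] = 0 := tofDepth_rotLayer _ _

/-- Half the sum of the two values of `f`. -/
def mean (f : Bool → ℝ) : ℝ := (f false + f true) / 2

/-- Half the difference of the two values of `f`. -/
def gap (f : Bool → ℝ) : ℝ := (f false - f true) / 2

/-- Hence a branch-dependent rotation is an unconditional one by the mean followed by one by the gap
inside a pair of `CX` gates. -/
theorem mean_add_gap (f : Bool → ℝ) (c : Bool) : sgn c * gap f + mean f = f c := by
  cases c <;> simp [mean, gap] <;> ring

theorem zPhase_add (φ η : ℝ) (s : Bool) : zPhase (φ + η) s = zPhase φ s * zPhase η s := by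
  rw [zPhase, zPhase, zPhase, ← Complex.exp_add]
  congr 1
  push_cast; ring

/-- The state `j` of the data, with the branch `s`. -/
def branchState (j : Fin n → Bool) (s : Bool) : Fin n ⊕ Fin 2 → Bool :=
  Function.update (Sum.elim j fun _ => false) cW s

theorem branchState_comp (j : Fin n → Bool) (s : Bool) : branchState j s ∘ Sum.inl = j := by
  funext l
  rw [Function.comp_apply, branchState, Function.update_of_ne (by simp [cW])]
  rfl

theorem branchState_cW (j : Fin n → Bool) (s : Bool) : branchState j s cW = s :=
  Function.update_self _ _ _

theorem branchState_qW (j : Fin n → Bool) (s : Bool) : branchState j s qW = false := by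
  rw [branchState, Function.update_of_ne (by simp [qW, cW])]
  rfl

theorem branchState_inj {i j : Fin n → Bool} {s t : Bool} :
    (∀ w, w ≠ qW → branchState i s w = branchState j t w) ↔ i = j ∧ s = t := by
  constructor
  · intro h
    refine ⟨?_, ?_⟩
    · rw [← branchState_comp i s, ← branchState_comp j t]
      funext l
      exact h _ (by simp [qW])
    · rw [← branchState_cW i s, ← branchState_cW j t]
      exact h _ (by simp [qW, cW])
  · rintro ⟨rfl, rfl⟩ w _
    rfl

theorem mux_branchState (N : (Fin n ⊕ Fin 2 → Bool) → Matrix Bool Bool ℂ) (i j : Fin n → Bool)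
    (s t : Bool) :
    mux qW N (branchState i s) (branchState j t)
      = if i = j ∧ s = t then N (branchState j t) false false else 0 := by
  simp only [mux, Matrix.of_apply, branchState_inj, branchState_qW]
  have : Function.update (branchState j t) qW false = branchState j t := by
    rw [Function.update_eq_self_iff, branchState_qW]
  rw [this]

/-- The Hadamard gates prepare the branch wire in the uniform superposition and project it back, so
an operator that preserves the branch contributes the mean over the branches. -/
theorem hadamard_mux_block (N : (Fin n ⊕ Fin 2 → Bool) → Matrix Bool Bool ℂ)
    (i j : Fin n → Bool) :
    (onQubit cW hadamardMatrix * mux qW N * onQubit cW hadamardMatrix :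
        Matrix (Fin n ⊕ Fin 2 → Bool) (Fin n ⊕ Fin 2 → Bool) ℂ) (Sum.elim i fun _ => false) (Sum.elim j fun _ => false)
      = Matrix.diagonal (fun b => (1 / 2 : ℂ) * ∑ s, N (branchState b s) false false) i j := by
  have hf : (Sum.elim i fun _ => false : Fin n ⊕ Fin 2 → Bool) cW = false := rfl
  have hf' : (Sum.elim j fun _ => false : Fin n ⊕ Fin 2 → Bool) cW = false := rfl
  have hs : (1 / (Real.sqrt 2 : ℂ)) * (1 / (Real.sqrt 2 : ℂ)) = 1 / 2 := by
    have := sqrt_two_inv_mul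
    rw [← this]; push_cast; ring
  have hH : ∀ s, hadamardMatrix false s = 1 / (Real.sqrt 2 : ℂ) := by
    intro s; simp [hadamardMatrix]
  have hH' : ∀ s, hadamardMatrix s false = 1 / (Real.sqrt 2 : ℂ) := by
    intro s; simp [hadamardMatrix]
  have hstate : ∀ (i : Fin n → Bool) s, Function.update (Sum.elim i fun _ => false) cW s
    = branchState i s := fun _ _ => rfl
  rw [mul_onQubit_apply]
  simp only [onQubit_mul_apply, hf, hf', hH, hH', hstate, mux_branchState, Fintype.sum_bool,
    Matrix.diagonal_apply]
  by_cases h : i = j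
  · subst h
    simp only [if_true, true_and]
    simp only [Bool.true_eq_false, Bool.false_eq_true, if_false]
    linear_combination (N (branchState i true) false false
      + N (branchState i false) false false) * hs
  · simp [h]

/-- The mean of two bounded trigonometric polynomials as a block of a circuit. -/
theorem exists_trig_circuit_two (hn : 1 ≤ n) (D : ℕ) (A : Bool → ℂ[X])
    (hA : ∀ s, (A s).natDegree ≤ D) (h : ∀ s (z : ℂ), ‖z‖ = 1 → ‖(A s).eval z‖ ≤ 1)
    (κ : Bool → ℝ) :
    ∃ c : Circuit (Fin n ⊕ Fin 2), c.rotDepth ≤ 4 * D + 6 ∧ c.tofDepth = 0 ∧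
      ∀ i j : Fin n → Bool, c.matrix (Sum.elim i fun _ => false) (Sum.elim j fun _ => false)
        = Matrix.diagonal (fun b => (1 / 2 : ℂ) * ∑ s,
            Complex.exp (Complex.I * κ s * gridPoint b)
              * (A s).eval (Complex.exp (Complex.I * gridPoint b))) i j := by
  choose θ φ hθφ using fun s => exists_angles D (shiftPoly (κ s) (A s))
    (natDegree_shiftPoly_le _ (hA s)) (norm_shiftPoly_le _ (h s))
  let κ' : Bool → ℝ := fun s => κ s + D / 2
  let Y : ℕ → Circuit (Fin n ⊕ Fin 2) := fun k =>
    [dqLayer .Y 0 (mean fun s => θ s k)] ++ branchRot .Y (gap fun s => θ s k)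
  let S : ℕ → Circuit (Fin n ⊕ Fin 2) := fun k =>
    signal (mean fun s => φ s k) ++ branchRot .Z (gap fun s => φ s k)
  let I : Circuit (Fin n ⊕ Fin 2) :=
    Y 0 ++ ([dqLayer .Z (mean κ') 0] ++ branchPhase (gap κ'))
  have hY : ∀ k, (Y k).matrix = mux qW fun x => rotMatrix .Y (θ (x cW) k) := by
    intro k
    rw [Circuit.matrix_append, matrix_branchRot pauli_X_conj_Y, Circuit.matrix_singleton,
      matrix_dqLayer_zero, onQubit_eq_mux, mux_mul]
    congr 1
    funext x
    rw [rotMatrix_mul, mean_add_gap fun s => θ s k]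
  have hS : ∀ k, (S k).matrix = mux qW fun x => Matrix.diagonal fun s =>
      (if s then (dPhase (1 / 2) (x ∘ Sum.inl))⁻¹ else dPhase (1 / 2) (x ∘ Sum.inl))
        * zPhase (φ (x cW) k) s := by
    intro k
    rw [Circuit.matrix_append, matrix_branchRot pauli_X_conj_Z, matrix_signal, mux_mul]
    congr 1
    funext x
    rw [rotMatrix_Z_eq, Matrix.diagonal_mul_diagonal]
    congr 1
    funext s
    have h1 : zPhase (φ (x cW) k) s = zPhase (sgn (x cW) * gap fun s => φ s k) s
        * zPhase (mean fun s => φ s k) s := by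
      rw [← zPhase_add, mean_add_gap fun s => φ s k]
    rw [h1]
    change zPhase _ s * (_ * zPhase _ s) = _
    ring
  have hI : I.matrix = mux qW fun x => dPhase (κ' (x cW)) (x ∘ Sum.inl)
      • rotMatrix .Y (θ (x cW) 0) := by
    rw [Circuit.matrix_append, Circuit.matrix_append, hY, matrix_branchPhase,
      Circuit.matrix_singleton, matrix_dqLayer, rotMatrix_zero, onQubit_one, Matrix.mul_one,
      Matrix.diagonal_mul_diagonal, diagonal_eq_mux qW, mux_mul]
    congr 1
    funext x
    have h1 : ∀ s, (Function.update x qW s ∘ Sum.inl : Fin n → Bool) = x ∘ Sum.inl := by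
      intro s; funext l; simp [qW]
    have h2 : ∀ s, Function.update x qW s cW = x cW :=
      fun s => Function.update_of_ne (by simp [qW, cW]) _ _
    simp only [h1, h2, ← dPhase_add]
    rw [mul_comm, mean_add_gap κ', ← Matrix.smul_one_eq_diagonal, Matrix.smul_mul, Matrix.one_mul]
  obtain ⟨N, hN, hcol⟩ := matrix_run (θ := fun x => θ (x cW)) (φ := fun x => φ (x cW)) (q := qW)
    (h := fun x => dPhase (1 / 2) (x ∘ Sum.inl)) (fun x => Complex.exp_ne_zero _) hI hS hY D
  have hrY : ∀ k, (Y k).rotDepth ≤ 2 := fun k => by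
    have h1 := rotDepth_dqLayer_le (n := n) .Y 0 (mean fun s => θ s k)
    have h2 := rotDepth_branchRot_le (n := n) .Y (gap fun s => θ s k)
    rw [Circuit.rotDepth_append]
    omega
  have htY : ∀ k, (Y k).tofDepth = 0 := fun k => by
    rw [Circuit.tofDepth_append, tofDepth_dqLayer, tofDepth_branchRot]
  refine ⟨seq [.hadamard cW] ++ (run I S Y D ++ ([dqLayer .Z 0 (mean fun s => φ s D)] ++
    (branchRot .Z (gap fun s => φ s D) ++ seq [.hadamard cW]))), ?_, ?_, ?_⟩
  -- Every angle is split into mean and gap: four layers to start (`Y`-rotations and data phases),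
  -- four per degree, two for the closing `Z`-rotation.
  · have h1 := rotDepth_run_le (I := I) (S := S) (Y := Y) (i := 4) (r := 4) (by
        have h1 := hrY 0
        have h2 := rotDepth_dqLayer_le (n := n) .Z (mean κ') 0
        have h3 := rotDepth_branchPhase_le (n := n) (gap κ')
        have h4 : I.rotDepth = (Y 0).rotDepth + _ := Circuit.rotDepth_append _ _
        have h5 := Circuit.rotDepth_append [dqLayer (n := n) .Z (mean κ') 0]
          (branchPhase (gap κ'))
        omega) (fun k => by
        have h1 := hrY (k + 1)
        have h2 := rotDepth_signal_le (n := n) (mean fun s => φ s k)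
        have h3 := rotDepth_branchRot_le (n := n) .Z (gap fun s => φ s k)
        rw [Circuit.rotDepth_append]
        omega) D
    have h2 := rotDepth_dqLayer_le (n := n) .Z 0 (mean fun s => φ s D)
    have h3 := rotDepth_branchRot_le (n := n) .Z (gap fun s => φ s D)
    have h4 : (seq [Gate.hadamard (cW (n := n))]).rotDepth = 0 := by
      simp [rotDepth_seq, Gate.isRotation]
    simp only [Circuit.rotDepth_append, h4]
    omega
  · have h1 := tofDepth_run_le (I := I) (S := S) (Y := Y) (i := 0) (r := 0) (by
        have h4 : I.tofDepth = (Y 0).tofDepth + _ := Circuit.tofDepth_append _ _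
        rw [h4, htY, Circuit.tofDepth_append, tofDepth_dqLayer, tofDepth_branchPhase]) (fun k => by
        rw [Circuit.tofDepth_append, htY, tofDepth_signal, tofDepth_branchRot]) D
    have h4 : (seq [Gate.hadamard (cW (n := n))]).tofDepth = 0 := by
      simp [tofDepth_seq, Gate.isToffoli]
    simp only [Circuit.tofDepth_append, h4, tofDepth_dqLayer, tofDepth_branchRot]
    omega
  · intro i j
    have hmat : (seq [.hadamard cW] ++ (run I S Y D ++ ([dqLayer .Z 0 (mean fun s => φ s D)] ++
        (branchRot .Z (gap fun s => φ s D) ++ seq [.hadamard cW])))).matrix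
        = onQubit cW hadamardMatrix * mux qW (fun x => rotMatrix .Z (φ (x cW) D) * N x)
          * onQubit cW hadamardMatrix := by
      simp only [Circuit.matrix_append, matrix_seq_cons, matrix_seq_nil, Matrix.one_mul,
        Circuit.matrix_singleton, hN, matrix_dqLayer_zero, matrix_branchRot pauli_X_conj_Z,
        Gate.matrix]
      rw [onQubit_eq_mux qW]
      simp only [Matrix.mul_assoc]
      rw [← Matrix.mul_assoc (mux qW _) (mux qW N), mux_mul,
        ← Matrix.mul_assoc (mux qW _) (mux qW _), mux_mul]
      congr 3
      funext x
      rw [← Matrix.mul_assoc, rotMatrix_mul, mean_add_gap fun s => φ s D]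
    rw [hmat, hadamard_mux_block, Matrix.diagonal_apply, Matrix.diagonal_apply]
    by_cases hij : i = j
    · subst hij
      rw [if_pos rfl, if_pos rfl]
      congr 1
      apply Finset.sum_congr rfl
      intro s _
      rw [← shift_identity hn (κ s) (A s) D, hθφ, rotMatrix_Z_eq]
      have h1 := congrArg Prod.fst (hcol (branchState i s))
      have h3 := congrArg Prod.fst
        (qcol_map (aeval (dPhase (1 / 2) i ^ 2)) (X : ℂ[X]) (θ s) (φ s) D)
      simp only [aeval_X, coe_aeval_eq_eval] at h3
      simp only [colOf, branchState_comp, branchState_cW, Prod.smul_fst, smul_eq_mul] at h1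
      simp only [eval_smul, smul_eq_mul]
      rw [Matrix.diagonal_mul, h1, h3, zPhase, branchState_cW]
      ring
    · rw [if_neg hij, if_neg hij]

end TwoBranches

end

section

open Matrix Polynomial ComplexConjugate

/-! ### Estimates of logarithms -/

theorem lg_mono {x y : ℝ} (hx : 0 < x) (h : x ≤ y) : lg x ≤ lg y :=
  Real.logb_le_logb_of_le (by norm_num) hx h

theorem lg_two : lg 2 = 1 := Real.logb_self_eq_one (by norm_num)

theorem div_le_lg {x : ℝ} {p q : ℕ} (hq : 0 < q) (h : (2 : ℝ) ^ p ≤ x ^ q) :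
    (p : ℝ) / q ≤ lg x := by
  have h1 := lg_mono (by positivity) h
  rw [lg, lg, Real.logb_pow, Real.logb_pow, Real.logb_self_eq_one (by norm_num), mul_one] at h1
  rw [div_le_iff₀ (by exact_mod_cast hq), mul_comm]
  exact h1

theorem one_le_lg {x : ℝ} (h : 2 ≤ x) : 1 ≤ lg x := by
  rw [← lg_two]
  exact lg_mono (by norm_num) h

/-- Rests on `2 ^ 3 ≤ 3 ^ 2` and `2 ≤ (3 / 2) ^ 2`. It keeps the Toffoli bounds nonnegative for the
smallest `S` and `n`. -/
theorem half_le_lg_lg {x : ℝ} (h : 3 ≤ x) : 1 / 2 ≤ lg (lg x) := by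
  have h1 : (3 : ℝ) / 2 ≤ lg x := by
    have := div_le_lg (x := 3) (p := 3) (q := 2) (by norm_num) (by norm_num)
    push_cast at this
    exact this.trans (lg_mono (by norm_num) h)
  have h2 : (1 : ℝ) / 2 ≤ lg (3 / 2) := by
    have := div_le_lg (x := 3 / 2) (p := 1) (q := 2) (by norm_num) (by norm_num)
    push_cast at this
    exact this
  exact h2.trans (lg_mono (by norm_num) h1)

/-! ### Polynomials of Fourier sums -/

/-- The polynomial with coefficients `y`. -/
def polyOf {S : ℕ} (y : Fin S → ℂ) : ℂ[X] := ∑ k : Fin S, C (y k) * X ^ (k : ℕ)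

theorem eval_polyOf {S : ℕ} (y : Fin S → ℂ) (z : ℂ) :
    (polyOf y).eval z = ∑ k : Fin S, y k * z ^ (k : ℕ) := by
  simp [polyOf, eval_finsetSum]

theorem natDegree_polyOf_le {S : ℕ} (y : Fin S → ℂ) : (polyOf y).natDegree ≤ S - 1 := by
  apply natDegree_sum_le_of_forall_le
  intro k _
  refine (natDegree_C_mul_X_pow_le _ _).trans ?_
  omega

theorem norm_eval_polyOf_le {S : ℕ} {y : Fin S → ℂ} {α : ℝ} (hα : 0 < α)
    (hy : ∑ k, ‖y k‖ ≤ α) {z : ℂ} (hz : ‖z‖ ≤ 1) :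
    ‖(polyOf fun k => y k / α).eval z‖ ≤ 1 := by
  rw [eval_polyOf]
  calc ‖∑ k : Fin S, y k / α * z ^ (k : ℕ)‖ ≤ ∑ k : Fin S, ‖y k‖ / α := by
        refine (norm_sum_le _ _).trans (Finset.sum_le_sum fun k _ => ?_)
        rw [norm_mul, norm_pow, norm_div, Complex.norm_real, Real.norm_of_nonneg hα.le]
        exact mul_le_of_le_one_right (by positivity) (pow_le_one₀ (norm_nonneg _) hz)
    _ ≤ 1 := by rwa [← Finset.sum_div, div_le_one hα]

theorem fourierSum_eq {n S : ℕ} (k₀ : ℤ) (y : Fin S → ℂ) (α : ℝ) (b : Fin n → Bool) :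
    fourierSum k₀ y b / α = Complex.exp (Complex.I * k₀ * gridPoint b)
      * (polyOf fun k => y k / α).eval (Complex.exp (Complex.I * gridPoint b)) := by
  rw [fourierSum, eval_polyOf, Finset.sum_div, Finset.mul_sum]
  apply Finset.sum_congr rfl
  intro k _
  rw [← Complex.exp_nat_mul, mul_left_comm, ← Complex.exp_add]
  rw [show Complex.I * ((k₀ : ℂ) + ((k : ℕ) : ℂ)) * ((gridPoint b : ℝ) : ℂ)
    = Complex.I * k₀ * gridPoint b + ((k : ℕ) : ℂ) * (Complex.I * gridPoint b) by ring]
  ring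

/-- The even (`ε = 0`) or odd (`ε = 1`) part of a polynomial, evaluated. -/
theorem eval_parity_part (P : ℝ[X]) {d ε : ℕ} (hd : P.natDegree ≤ d) (hε : ε ≤ 1) (hεd : ε ≤ d)
    (x : ℝ) :
    (P.eval x + (-1) ^ ε * P.eval (-x)) / 2
      = ∑ i ∈ Finset.range ((d - ε) / 2 + 1), P.coeff (2 * i + ε) * x ^ (2 * i + ε) := by
  rw [eval_eq_sum_range' (Nat.lt_succ_of_le hd), eval_eq_sum_range' (Nat.lt_succ_of_le hd),
    Finset.mul_sum, ← Finset.sum_add_distrib, Finset.sum_div]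
  symm
  apply Finset.sum_of_injOn (fun i => 2 * i + ε)
  · intro i _ j _ hij
    simp only at hij
    omega
  · intro i hi
    simp only [Finset.coe_range, Set.mem_Iio] at hi ⊢
    omega
  · intro j hj hj'
    have hodd : Odd (ε + j) := by
      by_contra hcon
      rw [Nat.not_odd_iff_even] at hcon
      obtain ⟨r, hr⟩ := hcon
      apply hj'
      simp only [Finset.mem_range] at hj
      refine ⟨(j - ε) / 2, ?_, ?_⟩
      · simp only [Finset.coe_range, Set.mem_Iio]
        omega
      · simp only
        omega
    have h1 : (-1 : ℝ) ^ ε * (-1) ^ j = -1 := by rw [← pow_add, hodd.neg_one_pow]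
    rw [neg_pow x]
    linear_combination (P.coeff j * x ^ j / 2) * h1
  · intro i _
    have h1 : (-1 : ℝ) ^ ε * (-1) ^ (2 * i + ε) = 1 := by
      rw [← pow_add, show ε + (2 * i + ε) = 2 * (i + ε) by ring, pow_mul]
      norm_num
    rw [neg_pow x]
    linear_combination (-(P.coeff (2 * i + ε) * x ^ (2 * i + ε) / 2)) * h1

/-- A polynomial of definite parity, composed with a trigonometric polynomial. -/
theorem exists_composed_poly (q : ℕ → ℝ) (M ε m : ℕ) (h : ℂ[X]) (hm : h.natDegree ≤ m)
    (hh : ∀ z : ℂ, ‖z‖ = 1 → ‖h.eval z‖ ≤ 1)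
    (hq : ∀ x ∈ Set.Icc (0 : ℝ) 1, |∑ i ∈ Finset.range (M + 1), q i * x ^ (2 * i + ε)| ≤ 1) :
    ∃ A : ℂ[X], A.natDegree ≤ m * (2 * M + ε) ∧ (∀ z : ℂ, ‖z‖ = 1 → ‖A.eval z‖ ≤ 1) ∧
      ∀ z : ℂ, ‖z‖ = 1 → A.eval z = z ^ (m * M) * (h.eval z) ^ ε
        * ((∑ i ∈ Finset.range (M + 1), q i * ‖h.eval z‖ ^ (2 * i) : ℝ) : ℂ) := by
  -- On the circle `h * conjReflect m h` is `z ^ m * |h| ^ 2`; the extra power of `X` brings all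
  -- summands to the common factor `z ^ (m * M)`.
  let A : ℂ[X] := ∑ i ∈ Finset.range (M + 1),
    C ((q i : ℝ) : ℂ) * ((h * conjReflect m h) ^ i * h ^ ε * X ^ (m * (M - i)))
  have hA : ∀ z : ℂ, ‖z‖ = 1 → A.eval z = z ^ (m * M) * (h.eval z) ^ ε
        * ((∑ i ∈ Finset.range (M + 1), q i * ‖h.eval z‖ ^ (2 * i) : ℝ) : ℂ) := by
    intro z hz
    simp only [A, eval_finsetSum, eval_mul, eval_C, eval_pow, eval_X,
      eval_conjReflect_of_norm hm hz]
    push_cast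
    rw [Finset.mul_sum]
    apply Finset.sum_congr rfl
    intro i hi
    have hi' : i ≤ M := by simpa [Nat.lt_succ_iff] using hi
    have h1 : h.eval z * (z ^ m * conj (h.eval z)) = z ^ m * (‖h.eval z‖ : ℂ) ^ 2 := by
      rw [mul_left_comm, Complex.mul_conj']
    rw [h1, mul_pow, ← pow_mul, ← pow_mul]
    have h2 : z ^ (m * M) = z ^ (m * i) * z ^ (m * (M - i)) := by
      rw [← pow_add, ← mul_add, Nat.add_sub_cancel' hi']
    rw [h2]
    ring
  refine ⟨A, ?_, ?_, hA⟩
  · apply natDegree_sum_le_of_forall_le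
    intro i hi
    have hi' : i ≤ M := by simpa [Nat.lt_succ_iff] using hi
    refine (natDegree_C_mul_le _ _).trans ?_
    have h1 : ((h * conjReflect m h) ^ i).natDegree ≤ i * (m + m) :=
      natDegree_pow_le_of_le i (natDegree_mul_le_of_le hm (natDegree_conjReflect_le hm))
    have h2 : (h ^ ε).natDegree ≤ ε * m := natDegree_pow_le_of_le ε hm
    refine (natDegree_mul_le_of_le (natDegree_mul_le_of_le h1 h2) (natDegree_X_pow_le _)).trans ?_
    obtain ⟨r, rfl⟩ := Nat.exists_eq_add_of_le hi'
    rw [Nat.add_sub_cancel_left]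
    nlinarith [Nat.zero_le (m * r)]
  -- The modulus is that of the given sum at `|h z|`, a point of `[0, 1]`.
  · intro z hz
    rw [hA z hz, norm_mul, norm_mul, norm_pow, norm_pow, hz, one_pow, one_mul, Complex.norm_real,
      Real.norm_eq_abs, ← abs_of_nonneg (pow_nonneg (norm_nonneg (h.eval z)) ε), ← abs_mul,
      Finset.mul_sum]
    refine le_of_eq_of_le ?_ (hq ‖h.eval z‖ ⟨norm_nonneg _, hh z hz⟩)
    congr 1
    apply Finset.sum_congr rfl
    intro i _
    rw [pow_add]; ring

/-- A polynomial of definite parity of a real Fourier sum, as a trigonometric polynomial. -/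
theorem exists_composed_trig {n S d ε : ℕ} (P : ℝ[X]) (hd : P.natDegree ≤ d) (hε : ε ≤ 1)
    (hεd : ε ≤ d) (hP : ∀ x ∈ Set.Icc (-1 : ℝ) 1, |P.eval x| ≤ 1) (k₀ : ℤ) (y : Fin S → ℂ)
    {α : ℝ} (hα : 0 < α) (hy : ∑ k, ‖y k‖ ≤ α) (g : (Fin n → Bool) → ℝ)
    (hg : ∀ b, fourierSum k₀ y b = (g b : ℂ)) :
    ∃ (A : ℂ[X]) (κ : ℝ), A.natDegree ≤ d * (S - 1) ∧ (∀ z : ℂ, ‖z‖ = 1 → ‖A.eval z‖ ≤ 1) ∧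
      ∀ b, Complex.exp (Complex.I * κ * gridPoint b)
          * A.eval (Complex.exp (Complex.I * gridPoint b))
        = (((P.eval (g b / α) + (-1) ^ ε * P.eval (-(g b / α))) / 2 : ℝ) : ℂ) := by
  set h := polyOf fun k => y k / α with hh
  obtain ⟨A, hA1, hA2, hA3⟩ := exists_composed_poly (fun i => P.coeff (2 * i + ε)) ((d - ε) / 2) ε
    (S - 1) h (natDegree_polyOf_le _) (fun z hz => norm_eval_polyOf_le hα hy hz.le) (by
      intro x hx
      rw [← eval_parity_part P hd hε hεd]
      have h1 := hP x ⟨by linarith [hx.1], hx.2⟩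
      have h2 := hP (-x) ⟨by linarith [hx.2], by linarith [hx.1]⟩
      rw [abs_div, abs_two, div_le_one (by norm_num)]
      refine (abs_add_le _ _).trans ?_
      rw [abs_mul, abs_pow, abs_neg, abs_one, one_pow, one_mul]
      linarith)
  -- The shift supplies `exp (i k₀ x)` for the odd factor `h ^ ε` and divides out the common power
  -- of `z`.
  refine ⟨A, ε * k₀ - ((S - 1) * ((d - ε) / 2) : ℕ), hA1.trans ?_, hA2, fun b => ?_⟩
  · rw [mul_comm]
    exact Nat.mul_le_mul_right _ (by omega)
  · set z := Complex.exp (Complex.I * gridPoint b) with hz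
    have hz1 : ‖z‖ = 1 := by
      rw [hz, mul_comm]; exact Complex.norm_exp_ofReal_mul_I _
    set w := Complex.exp (Complex.I * k₀ * gridPoint b) with hw
    have hw1 : ‖w‖ = 1 := by
      rw [hw, show Complex.I * k₀ * gridPoint b = ((k₀ * gridPoint b : ℝ) : ℂ) * Complex.I by
        push_cast; ring]
      exact Complex.norm_exp_ofReal_mul_I _
    have hu : ((g b / α : ℝ) : ℂ) = w * h.eval z := by
      have := fourierSum_eq k₀ y α b
      rw [hg] at this
      push_cast
      exact this
    -- Reality enters here: even powers of the real number `g b / α` are powers of `|h| ^ 2`.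
    have habs : ‖h.eval z‖ = |g b / α| := by
      rw [← Real.norm_eq_abs, ← Complex.norm_real, hu, norm_mul, hw1, one_mul]
    have hexp : Complex.exp (Complex.I * ((ε * k₀ - ((S - 1) * ((d - ε) / 2) : ℕ) : ℝ) : ℂ)
        * gridPoint b) * z ^ ((S - 1) * ((d - ε) / 2)) = w ^ ε := by
      rw [hz, hw, ← Complex.exp_nat_mul, ← Complex.exp_nat_mul, ← Complex.exp_add]
      congr 1
      push_cast; ring
    rw [hA3 z hz1, eval_parity_part P hd hε hεd, ← mul_assoc, ← mul_assoc, hexp, ← mul_pow, ← hu,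
      habs, ← Complex.ofReal_pow, ← Complex.ofReal_mul, Finset.mul_sum]
    congr 1
    apply Finset.sum_congr rfl
    intro i _
    rw [pow_mul, sq_abs, ← pow_mul, pow_add]
    ring

theorem isBlockEncoding_fourierSum {n S : ℕ} (hn : 1 ≤ n) (hS : 2 ≤ S) (k₀ : ℤ) (y : Fin S → ℂ)
    {α : ℝ} (hα : 0 < α) (hy : ∑ k, ‖y k‖ ≤ α) :
    ∃ c : Circuit (Fin n ⊕ Fin 2), IsBlockEncoding α c.matrix (Matrix.diagonal (fourierSum k₀ y)) ∧
      (c.rotDepth : ℝ) ≤ fourierRot S ∧ c.tofDepth = 0 := by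
  obtain ⟨c, h1, h2, h3⟩ := exists_trig_circuit hn (S - 1) (polyOf fun k => y k / α)
    (natDegree_polyOf_le _) (fun z hz => norm_eval_polyOf_le hα hy hz.le) k₀
  refine ⟨c, ⟨hα, ?_, fun i j => ?_⟩, ?_, h2⟩
  · exact Circuit.matrix_mem_unitaryGroup c
  · rw [h3, Matrix.diagonal_apply, Matrix.diagonal_apply]
    by_cases hij : i = j
    · rw [if_pos hij, if_pos hij, fourierSum_eq]; simp
    · rw [if_neg hij, if_neg hij, zero_div]
  -- The rotation depth is at most `2 S`, which is within the bound because `lg S ≥ 1`.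
  · have h4 : (c.rotDepth : ℝ) ≤ 2 * ((S - 1 : ℕ) : ℝ) + 2 := by exact_mod_cast h1
    have h5 := one_le_lg (x := S) (by exact_mod_cast hS)
    rw [Nat.cast_sub (by omega)] at h4
    rw [fourierRot]
    push_cast at h4
    linarith

theorem composedFourierTof_nonneg {S : ℕ} (hS : 3 ≤ S) : 0 ≤ composedFourierTof S := by
  have := half_le_lg_lg (x := S) (by exact_mod_cast hS)
  rw [composedFourierTof]
  linarith

theorem isBlockEncoding_parity_fourierSum {n S d : ℕ} (hn : 1 ≤ n) (hS : 3 ≤ S) (k₀ : ℤ)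
    (y : Fin S → ℂ) {α : ℝ} (hα : 0 < α) (hy : ∑ k, ‖y k‖ ≤ α) (g : (Fin n → Bool) → ℝ)
    (hg : ∀ b, fourierSum k₀ y b = (g b : ℂ)) (P : ℝ[X]) (hd1 : 1 ≤ d) (hd : P.natDegree = d)
    (hP : ∀ x ∈ Set.Icc (-1 : ℝ) 1, |P.eval x| ≤ 1)
    (hpar : ∀ x : ℝ, P.eval (-x) = (-1) ^ d * P.eval x) :
    ∃ c : Circuit (Fin n ⊕ Fin 2), IsBlockEncoding 1 c.matrix (composedDiag P g α) ∧
      (c.rotDepth : ℝ) ≤ composedFourierRot S * d ∧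
      (c.tofDepth : ℝ) ≤ composedFourierTof S * d := by
  -- For `ε` the parity of `d`, the parity part of `P` is `P` itself.
  obtain ⟨A, κ, hA1, hA2, hA3⟩ := exists_composed_trig (ε := d % 2) P hd.le (by omega) (by omega)
    hP k₀ y hα hy g hg
  obtain ⟨c, h1, h2, h3⟩ := exists_trig_circuit hn _ A hA1 hA2 κ
  refine ⟨c, ⟨one_pos, ?_, fun i j => ?_⟩, ?_, ?_⟩
  · exact Circuit.matrix_mem_unitaryGroup c
  · rw [h3, composedDiag]
    simp only [hA3, Complex.ofReal_one, div_one, hpar]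
    congr 1
    funext b
    congr 1
    have : (-1 : ℝ) ^ (d % 2) * (-1) ^ d = 1 := by
      rw [← pow_add]
      exact Even.neg_one_pow (by rw [Nat.even_iff]; omega)
    linear_combination (P.eval (g b / α) / 2) * this
  · have h4 : (c.rotDepth : ℝ) ≤ 2 * ((d : ℝ) * ((S - 1 : ℕ) : ℝ)) + 2 := by exact_mod_cast h1
    have h5 := one_le_lg (x := S) (by exact_mod_cast (by omega : 2 ≤ S))
    have h6 : (1 : ℝ) ≤ d := by exact_mod_cast hd1
    rw [Nat.cast_sub (by omega)] at h4
    rw [composedFourierRot]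
    push_cast at h4
    nlinarith
  · rw [h2]
    have := composedFourierTof_nonneg hS
    push_cast
    positivity

theorem isBlockEncoding_composed_fourierSum {n S d : ℕ} (hn : 1 ≤ n) (hS : 3 ≤ S) (k₀ : ℤ)
    (y : Fin S → ℂ) {α : ℝ} (hα : 0 < α) (hy : ∑ k, ‖y k‖ ≤ α) (g : (Fin n → Bool) → ℝ)
    (hg : ∀ b, fourierSum k₀ y b = (g b : ℂ)) (P : ℝ[X]) (hd1 : 1 ≤ d) (hd : P.natDegree = d)
    (hP : ∀ x ∈ Set.Icc (-1 : ℝ) 1, |P.eval x| ≤ 1) :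
    ∃ c : Circuit (Fin n ⊕ Fin 2), IsBlockEncoding 2 c.matrix (composedDiag P g α) ∧
      (c.rotDepth : ℝ) ≤ 2 * (composedFourierRot S * d) ∧
      (c.tofDepth : ℝ) ≤ 2 * (composedFourierTof S * d) := by
  -- One branch carries the even part of `P`, the other the odd part; the mean of the branches is `P
  -- / 2`.
  choose A κ hA1 hA2 hA3 using fun s : Bool => exists_composed_trig (ε := if s then 1 else 0) P
    hd.le (by cases s <;> simp) (by cases s <;> simp [hd1]) hP k₀ y hα hy g hg
  obtain ⟨c, h1, h2, h3⟩ := exists_trig_circuit_two hn _ A hA1 hA2 κ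
  refine ⟨c, ⟨two_pos, ?_, fun i j => ?_⟩, ?_, ?_⟩
  · exact Circuit.matrix_mem_unitaryGroup c
  · rw [h3, composedDiag, Matrix.diagonal_apply, Matrix.diagonal_apply]
    by_cases hij : i = j
    · rw [if_pos hij, if_pos hij]
      simp only [hA3, Fintype.sum_bool]
      rw [← Complex.ofReal_add]
      simp only [if_true, Bool.false_eq_true, if_false]
      push_cast
      ring
    · rw [if_neg hij, if_neg hij, zero_div]
  · have h4 : (c.rotDepth : ℝ) ≤ 4 * ((d : ℝ) * ((S - 1 : ℕ) : ℝ)) + 6 := by exact_mod_cast h1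
    have h5 := one_le_lg (x := S) (by exact_mod_cast (by omega : 2 ≤ S))
    have h6 : (1 : ℝ) ≤ d := by exact_mod_cast hd1
    rw [Nat.cast_sub (by omega)] at h4
    rw [composedFourierRot]
    push_cast at h4
    nlinarith
  · rw [h2]
    have := composedFourierTof_nonneg hS
    push_cast
    positivity

end

section

open Matrix ComplexConjugate

/-! ### Diagonal operators through parities -/

section Walsh

variable {V : Type} [Fintype V] [DecidableEq V]

/-- The character `x ↦ (-1) ^ (∑ v ∈ s, x v)`. -/
def walsh (s : Finset V) (x : V → Bool) : ℝ := ∏ v ∈ s, sgn (x v)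

/-- The sum over subsets factorises into `∏ (sgn (x v) * sgn (y v) + 1)`, and a coordinate where `x`
and `y` differ gives the factor `0`. -/
theorem sum_walsh_mul (x y : V → Bool) :
    ∑ s : Finset V, walsh s x * walsh s y = if x = y then 2 ^ Fintype.card V else 0 := by
  have h1 : ∑ s : Finset V, walsh s x * walsh s y = ∏ v : V, (sgn (x v) * sgn (y v) + 1) := by
    rw [Finset.prod_add_one, Finset.powerset_univ]
    simp only [walsh, Finset.prod_mul_distrib]
  rw [h1]
  split_ifs with h
  · subst h
    simp only [sgn_mul_self]
    norm_num
  · obtain ⟨v, hv⟩ := Function.ne_iff.1 h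
    apply Finset.prod_eq_zero (Finset.mem_univ v)
    revert hv
    cases x v <;> cases y v <;> simp

theorem exists_walsh_expansion (ω : (V → Bool) → ℝ) :
    ∃ θ : Finset V → ℝ, ∀ x, ∑ s, θ s * walsh s x = ω x := by
  refine ⟨fun s => ∑ y, ω y * walsh s y / 2 ^ Fintype.card V, fun x => ?_⟩
  simp only [Finset.sum_mul]
  rw [Finset.sum_comm]
  have h1 : ∀ y, ∑ s : Finset V, ω y * walsh s y / 2 ^ Fintype.card V * walsh s x
      = if y = x then ω y else 0 := by
    intro y
    have : ∀ s : Finset V, ω y * walsh s y / 2 ^ Fintype.card V * walsh s x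
        = ω y / 2 ^ Fintype.card V * (walsh s y * walsh s x) := fun s => by ring
    simp only [this]
    rw [← Finset.mul_sum, sum_walsh_mul]
    split_ifs
    · field_simp
    · simp
  simp [h1]

/-- The scrap wires that contain `v`. -/
def scrapW (v : V) : Finset (V ⊕ Finset V) :=
  (Finset.univ.filter fun s : Finset V => v ∈ s).map ⟨Sum.inr, Sum.inr_injective⟩

theorem inl_notMem_scrapW (v w : V) : (Sum.inl w : V ⊕ Finset V) ∉ scrapW v := by
  simp [scrapW]

theorem inr_mem_scrapW (v : V) (s : Finset V) : (Sum.inr s : V ⊕ Finset V) ∈ scrapW v ↔ v ∈ s := by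
  simp [scrapW]

/-- Adds the value of the wire `v` to all scrap wires that contain `v`. -/
def scrapGate (v : V) : Gate (V ⊕ Finset V) := .fanout (.inl v) (scrapW v) (inl_notMem_scrapW v v)

theorem sgn_runMap_scrapGate_inr (l : List V) (x : V ⊕ Finset V → Bool) (s : Finset V) :
    sgn (runMap (l.map scrapGate) x (.inr s)) = sgn (x (.inr s))
      * (l.map fun v => if v ∈ s then sgn (x (.inl v)) else 1).prod := by
  induction l generalizing x with
  | nil => simp [runMap]
  | cons w l ih =>
    rw [List.map_cons, runMap, ih, List.map_cons, List.prod_cons]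
    have h1 : ∀ v, (scrapGate w).basisMap x (.inl v) = x (.inl v) :=
      fun v => if_neg (inl_notMem_scrapW w v)
    simp only [h1]
    rw [scrapGate, Gate.basisMap, fanMap]
    by_cases h : w ∈ s
    · rw [if_pos ((inr_mem_scrapW w s).2 h), if_pos h, sgn_xor, mul_assoc]
    · rw [if_neg (fun h' => h ((inr_mem_scrapW w s).1 h')), if_neg h, one_mul]

/-- Every diagonal unitary is obtained with one layer of rotations on exponentially many scrap
wires. -/
theorem exists_phase_circuit (ω : (V → Bool) → ℝ) :
    ∃ (c : Circuit (V ⊕ Finset V)) (d : (V ⊕ Finset V → Bool) → ℂ), c.rotDepth ≤ 1 ∧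
      c.tofDepth = 0 ∧ c.matrix = Matrix.diagonal d ∧
      ∀ x, d (Sum.elim x fun _ => false) = Complex.exp (Complex.I * ω x) := by
  -- A `Z`-rotation by `θ` contributes `exp (-i θ / 2 * sgn)`, whence the factor `-2`.
  obtain ⟨θ, hθ⟩ := exists_walsh_expansion fun x => -2 * ω x
  let η : V ⊕ Finset V → ℝ := Sum.elim (fun _ => 0) θ
  let c₀ : Circuit (V ⊕ Finset V) := [rotLayer (fun _ => .Z) η]
  have h0 : c₀.matrix = Matrix.diagonal fun x => ∏ w,
      Complex.exp (-(Complex.I * ((η w / 2 * sgn (x w) : ℝ) : ℂ))) := by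
    rw [Circuit.matrix_singleton, matrix_rotLayer,
      ← tens_diagonal fun w b => Complex.exp (-(Complex.I * ((η w / 2 * sgn b : ℝ) : ℂ)))]
    simp only [rotMatrix_Z_eq]
  have hcl : ∀ g ∈ (Finset.univ : Finset V).toList.map scrapGate, g.IsClassical := by
    simp [scrapGate, Gate.IsClassical]
  -- The fan-outs leave on each scrap wire the parity of its subset, so one layer of rotations
  -- produces all characters simultaneously.
  refine ⟨conjBy ((Finset.univ : Finset V).toList.map scrapGate) c₀, _, ?_, ?_,
    matrix_conjBy_of_diagonal hcl h0, fun x => ?_⟩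
  · rw [rotDepth_conjBy hcl]
    exact rotDepth_rotLayer_le _ _
  · have h1 : ((Finset.univ : Finset V).toList.map scrapGate).countP Gate.isToffoli = 0 := by
      simp [List.countP_map, Function.comp_def, scrapGate, Gate.isToffoli]
    rw [tofDepth_conjBy, h1]
    rw [mul_zero, zero_add]; exact tofDepth_rotLayer (fun _ => .Z) η
  · have h1 : ∀ s, sgn (runMap ((Finset.univ : Finset V).toList.map scrapGate)
        (Sum.elim x fun _ => false) (.inr s)) = walsh s x := by
      intro s
      rw [sgn_runMap_scrapGate_inr, Finset.prod_map_toList, Finset.prod_ite_mem, Finset.univ_inter]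
      simp [walsh]
    rw [Function.comp_apply, ← Complex.exp_sum, Fintype.sum_sum_type]
    simp only [η, Sum.elim_inl, Sum.elim_inr, h1]
    congr 1
    have h2 := congrArg (fun t : ℝ => (t : ℂ)) (hθ x)
    push_cast at h2
    simp only [zero_div, zero_mul, Complex.ofReal_zero, mul_zero, neg_zero,
      Finset.sum_const_zero, zero_add]
    rw [Finset.sum_neg_distrib, ← Finset.mul_sum]
    have h3 : ∑ i, ((θ i / 2 * walsh i x : ℝ) : ℂ) = (∑ i, (θ i : ℂ) * (walsh i x : ℂ)) / 2 := by
      rw [Finset.sum_div]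
      apply Finset.sum_congr rfl
      intro i _
      push_cast; ring
    rw [h3, h2]
    ring

end Walsh

/-- The two unit numbers have arguments `arg z ± arccos |z|`. -/
theorem exists_two_phases {z : ℂ} (hz : ‖z‖ ≤ 1) : ∃ ω : Bool → ℝ,
    (1 / 2 : ℂ) * ∑ s, Complex.exp (Complex.I * ω s) = z := by
  refine ⟨fun s => z.arg + sgn s * Real.arccos ‖z‖, ?_⟩
  have h1 : (‖z‖ : ℂ) = Complex.cos (Real.arccos ‖z‖) := by
    rw [← Complex.ofReal_cos, Real.cos_arccos (by linarith [norm_nonneg z]) hz]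
  have h2 := Complex.norm_mul_exp_arg_mul_I z
  rw [h1, Complex.cos, div_mul_eq_mul_div, add_mul, ← Complex.exp_add, ← Complex.exp_add] at h2
  conv_rhs => rw [← h2]
  simp only [Fintype.sum_bool, sgn_true, sgn_false]
  push_cast
  rw [show Complex.I * (z.arg + -1 * (Real.arccos ‖z‖ : ℂ))
      = -(Real.arccos ‖z‖ : ℂ) * Complex.I + z.arg * Complex.I by ring,
    show Complex.I * (z.arg + 1 * (Real.arccos ‖z‖ : ℂ))
      = (Real.arccos ‖z‖ : ℂ) * Complex.I + z.arg * Complex.I by ring]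
  ring

/-- Every bounded function on the cube is a block of a circuit with one layer of rotations. -/
theorem exists_diagonal_circuit {n : ℕ} (F : (Fin n → Bool) → ℂ) (hF : ∀ b, ‖F b‖ ≤ 1) :
    ∃ c : Circuit (Fin n ⊕ (Unit ⊕ Finset (Fin n ⊕ Unit))), c.rotDepth ≤ 1 ∧ c.tofDepth = 0 ∧
      ∀ i j : Fin n → Bool, c.matrix (Sum.elim i fun _ => false) (Sum.elim j fun _ => false)
        = Matrix.diagonal F i j := by
  choose ω hω using fun b => exists_two_phases (hF b)
  -- The additional wire chooses one of the two phases whose mean is `F b`; Hadamard gates on it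
  -- take the mean.
  obtain ⟨c, d, hr, ht, hm, hd⟩ := exists_phase_circuit fun x : Fin n ⊕ Unit → Bool =>
    ω (x ∘ Sum.inl) (x (.inr ()))
  let q : (Fin n ⊕ Unit) ⊕ Finset (Fin n ⊕ Unit) := .inl (.inr ())
  let e := Equiv.sumAssoc (Fin n) Unit (Finset (Fin n ⊕ Unit))
  let c' : Circuit ((Fin n ⊕ Unit) ⊕ Finset (Fin n ⊕ Unit)) :=
    seq [.hadamard q] ++ (c ++ seq [.hadamard q])
  refine ⟨c'.mapWires e.toEmbedding, ?_, ?_, fun i j => ?_⟩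
  · rw [Circuit.rotDepth_mapWires]
    have h4 : (seq [Gate.hadamard q]).rotDepth = 0 := by simp [rotDepth_seq, Gate.isRotation]
    simp only [c', Circuit.rotDepth_append, h4]
    omega
  · rw [Circuit.tofDepth_mapWires]
    have h4 : (seq [Gate.hadamard q]).tofDepth = 0 := by simp [tofDepth_seq, Gate.isToffoli]
    simp only [c', Circuit.tofDepth_append, h4]
    omega
  · let st : (Fin n → Bool) → Bool → (Fin n ⊕ Unit) ⊕ Finset (Fin n ⊕ Unit) → Bool :=
      fun j s => Sum.elim (Sum.elim j fun _ => s) fun _ => false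
    have h1 : ∀ j : Fin n → Bool, (Sum.elim j fun _ => false :
        Fin n ⊕ (Unit ⊕ Finset (Fin n ⊕ Unit)) → Bool) ∘ e = st j false := by
      intro j; funext w
      rcases w with (_ | _) | _ <;> rfl
    have h2 : ∀ j s t, Function.update (st j s) q t = st j t := by
      intro j s t; funext w
      rcases w with (l | u) | w
      · rw [Function.update_of_ne (by simp [q])]; rfl
      · exact Function.update_self (β := fun _ => Bool) q t (st j s)
      · rw [Function.update_of_ne (by simp [q])]; rfl
    have h3 : ∀ j, st j false q = false := fun _ => rfl
    have h4 : ∀ s t, st i s = st j t ↔ i = j ∧ s = t := by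
      intro s t
      constructor
      · intro h
        exact ⟨funext fun l => congrFun h (.inl (.inl l)), congrFun h q⟩
      · rintro ⟨rfl, rfl⟩; rfl
    have hs : (1 / (Real.sqrt 2 : ℂ)) * (1 / (Real.sqrt 2 : ℂ)) = 1 / 2 := by
      have := sqrt_two_inv_mul
      rw [← this]; push_cast; ring
    have hH : ∀ s, hadamardMatrix false s = 1 / (Real.sqrt 2 : ℂ) := by
      intro s; simp [hadamardMatrix]
    have hH' : ∀ s, hadamardMatrix s false = 1 / (Real.sqrt 2 : ℂ) := by
      intro s; simp [hadamardMatrix]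
    have hc' : c'.matrix = onQubit q hadamardMatrix * Matrix.diagonal d
        * onQubit q hadamardMatrix := by
      simp only [c', Circuit.matrix_append, matrix_seq_cons, matrix_seq_nil, Matrix.one_mul, hm]
      rfl
    rw [Circuit.matrix_mapWires, lift_equiv, h1, h1, hc', mul_onQubit_apply]
    simp only [onQubit_mul_apply, h2, h3, hH, hH', Matrix.diagonal_apply, h4, Fintype.sum_bool]
    by_cases hij : i = j
    · subst hij
      have hd' : ∀ s, d (st i s) = Complex.exp (Complex.I * ω i s) := fun s => hd (Sum.elim i _)
      rw [if_pos rfl, ← hω i, Fintype.sum_bool, ← hd', ← hd']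
      simp only [and_true, Bool.true_eq_false, Bool.false_eq_true, and_false, if_true, if_false]
      linear_combination (d (st i true) + d (st i false)) * hs
    · simp [hij]

end

section

open Matrix Polynomial ComplexConjugate

/-! ### Random selection of a digit -/

theorem runMap_select_list {W ι : Type} [Fintype W] [DecidableEq W] (c : W) (u v : ι → W)
    (hcu : ∀ i, c ≠ u i) (hcv : ∀ i, c ≠ v i) (huv : ∀ i j, u i ≠ v j)
    (hu : Function.Injective u) (hv : Function.Injective v) (l : List ι) (hl : l.Nodup)
    (x : W → Bool) :
    (∀ i ∈ l, runMap (l.flatMap fun i => selectGates c (u i) (v i) (hcu i) (hcv i) (huv i i)) x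
      (u i) = if x c then x (v i) else x (u i)) ∧
    ∀ w, (∀ i ∈ l, w ≠ u i ∧ w ≠ v i) →
      runMap (l.flatMap fun i => selectGates c (u i) (v i) (hcu i) (hcv i) (huv i i)) x w
        = x w := by
  induction l generalizing x with
  | nil => simp [runMap]
  | cons k l ih =>
    obtain ⟨hk, hl⟩ := List.nodup_cons.1 hl
    set y := runMap (selectGates c (u k) (v k) (hcu k) (hcv k) (huv k k)) x with hy
    have hy' := runMap_selectGates c (u k) (v k) (hcu k) (hcv k) (huv k k) x
    rw [← hy] at hy'
    have hyw : ∀ w, w ≠ u k → w ≠ v k → y w = x w := fun w h1 h2 => by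
      rw [hy', Function.update_of_ne h1, Function.update_of_ne h2]
    obtain ⟨h1, h2⟩ := ih hl y
    rw [List.flatMap_cons, runMap_append, ← hy]
    refine ⟨?_, fun w hw => ?_⟩
    · intro i hi
      by_cases hik : i = k
      · subst hik
        rw [h2 _ fun j hj => ⟨hu.ne (by rintro rfl; exact hk hj), huv _ _⟩, hy',
          Function.update_self]
      · rw [h1 i (by simpa [hik] using hi), hyw c (hcu k) (hcv k),
          hyw (v i) (huv k i).symm (hv.ne hik), hyw (u i) (hu.ne hik) (huv i k)]
    · rw [h2 w fun i hi => hw i (by simp [hi]), hyw w (hw k (by simp)).1 (hw k (by simp)).2]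

/-- The probability of the digits `c` if the digit `i` is set with probability `t i`,
independently. -/
def prodWeight {ι : Type} [Fintype ι] (t : ι → ℝ) (c : ι → Bool) : ℝ :=
  ∏ i, if c i then t i else 1 - t i

theorem sum_prodWeight {ι : Type} [Fintype ι] [DecidableEq ι] (t : ι → ℝ) :
    ∑ c, prodWeight t c = 1 := by
  have h := Finset.prod_univ_sum (fun _ : ι => (Finset.univ : Finset Bool))
    fun i b => if b then t i else 1 - t i
  rw [Fintype.piFinset_univ] at h
  simp only [prodWeight]
  rw [← h]
  simp

theorem sum_cons_bool {L : ℕ} {M : Type} [AddCommMonoid M] (f : (Fin (L + 1) → Bool) → M) :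
    ∑ c, f c = ∑ b : Bool, ∑ c : Fin L → Bool, f (Fin.cons b c) := by
  rw [← (Fin.consEquiv fun _ : Fin (L + 1) => Bool).sum_comp, Fintype.sum_prod_type]
  rfl

theorem sum_prodWeight_cons {L : ℕ} (τ : ℝ) (t : Fin L → ℝ) (f : (Fin (L + 1) → Bool) → ℝ) :
    ∑ c, prodWeight (Fin.cons τ t : Fin (L + 1) → ℝ) c * f c
      = τ * ∑ c : Fin L → Bool, prodWeight t c * f (Fin.cons true c)
        + (1 - τ) * ∑ c : Fin L → Bool, prodWeight t c * f (Fin.cons false c) := by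
  rw [sum_cons_bool, Fintype.sum_bool, Finset.mul_sum, Finset.mul_sum]
  simp only [prodWeight, Fin.prod_univ_succ, Fin.cons_zero, Fin.cons_succ, if_true,
    Bool.false_eq_true, if_false, mul_assoc]

/-- The digits of `n`-digit numbers can be selected with probabilities proportional to their
weights by `L` independent control digits and less than `n` Toffoli gates: after the circuit, the
wire `u 0` holds the selected digit. -/
def HasSelector (n L : ℕ) : Prop :=
  ∃ (t : Fin L → ℝ) (out : (Fin n → Bool) → (Fin L → Bool) → Bool),
    (∀ i, t i ∈ Set.Icc (0 : ℝ) 1) ∧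
    (∀ x, ∑ c, prodWeight t c * sgn (out x c) = symPoint x) ∧
    ∀ (W : Type) [Fintype W] [DecidableEq W] (u : Fin n → W) (k : Fin L → W),
      Function.Injective u → (∀ i j, k i ≠ u j) →
      ∃ gs : List (Gate W), (∀ g ∈ gs, g.IsClassical) ∧ gs.countP Gate.isToffoli + 1 ≤ n ∧
        ∀ x, (∀ h0 : 0 < n, runMap gs x (u ⟨0, h0⟩) = out (x ∘ u) (x ∘ k)) ∧
          ∀ w, (∀ j, w ≠ u j) → runMap gs x w = x w

theorem hasSelector_one : HasSelector 1 0 := by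
  refine ⟨fun _ => 0, fun x _ => x 0, by simp, fun x => ?_, ?_⟩
  · simp only [symPoint, prodWeight, Finset.univ_unique, Finset.sum_singleton,
      Finset.univ_eq_empty, Finset.prod_empty]
    norm_num
  · intro W _ _ u k _ _
    exact ⟨[], by simp, by simp, fun x => ⟨fun _ => rfl, fun _ _ => rfl⟩⟩

theorem countP_flatMap_selectGates {W ι : Type} [Fintype W] [DecidableEq W] (c : W) (u v : ι → W)
    (hcu : ∀ i, c ≠ u i) (hcv : ∀ i, c ≠ v i) (huv : ∀ i j, u i ≠ v j) (l : List ι) :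
    (l.flatMap fun i => selectGates c (u i) (v i) (hcu i) (hcv i) (huv i i)).countP Gate.isToffoli
      = l.length := by
  induction l with
  | nil => rfl
  | cons k l ih =>
    rw [List.flatMap_cons, List.countP_append, ih, List.length_cons, selectGates]
    simp [List.countP_cons, Gate.isToffoli, add_comm]

theorem cons_mem_Icc {L : ℕ} {τ : ℝ} {t : Fin L → ℝ} (hτ : τ ∈ Set.Icc (0 : ℝ) 1)
    (ht : ∀ i, t i ∈ Set.Icc (0 : ℝ) 1) (i : Fin (L + 1)) :
    (Fin.cons τ t : Fin (L + 1) → ℝ) i ∈ Set.Icc (0 : ℝ) 1 := by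
  refine Fin.cases ?_ (fun j => ?_) i
  · exact hτ
  · exact ht j

/-- As `2 ^ (2 h) - 1 = (2 ^ h - 1) (2 ^ h + 1)`, the upper half has total weight `2 ^ h / (2 ^ h +
1)`, and both halves have the same relative weights. A new control digit selects the half, digit by
digit with `h` Toffoli gates; the old selector then needs at most `h - 1`. -/
theorem HasSelector.double {h L : ℕ} (hpos : 1 ≤ h) (hs : HasSelector h L) :
    HasSelector (h + h) (L + 1) := by
  obtain ⟨t, out, ht, hsum, hgs⟩ := hs
  have h1 := two_pow_sub_one_pos hpos
  have h2 : (0 : ℝ) < 2 ^ h + 1 := by positivity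
  refine ⟨Fin.cons (2 ^ h / (2 ^ h + 1)) t, fun x c => out (fun l => if c 0 then
    x (Fin.natAdd h l) else x (Fin.castAdd h l)) (Fin.tail c), cons_mem_Icc ⟨by positivity, by
      rw [div_le_one h2]; linarith⟩ ht, fun x => ?_, ?_⟩
  · have h3 : (2 : ℝ) ^ (h + h) - 1 = (2 ^ h - 1) * (2 ^ h + 1) := by rw [pow_add]; ring
    have h4 : (1 : ℝ) - 2 ^ h / (2 ^ h + 1) = 1 / (2 ^ h + 1) := by field_simp; ring
    rw [sum_prodWeight_cons]
    simp only [Fin.cons_zero, Fin.tail_cons, if_true, Bool.false_eq_true, if_false, hsum]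
    rw [symPoint, symPoint, symPoint, Fin.sum_univ_add, h3, h4, Finset.mul_sum, Finset.mul_sum,
      add_comm]
    congr 1
    · apply Finset.sum_congr rfl
      intro l _
      rw [Fin.val_castAdd]
      field_simp
    · apply Finset.sum_congr rfl
      intro l _
      rw [Fin.val_natAdd, pow_add]
      field_simp
  · intro W _ _ u k hu hku
    have hca : Function.Injective (u ∘ Fin.castAdd (n := h) h) :=
      hu.comp (Fin.castAdd_injective h h)
    have hna : Function.Injective (u ∘ Fin.natAdd h (m := h)) :=
      hu.comp (Fin.natAdd_injective h h)
    have huv : ∀ i j, (u ∘ Fin.castAdd (n := h) h) i ≠ (u ∘ Fin.natAdd h (m := h)) j := by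
      intro i j hij
      have := congrArg Fin.val (hu hij)
      simp only [Fin.val_castAdd, Fin.val_natAdd] at this
      omega
    obtain ⟨gs, hcl, hcount, hrun⟩ := hgs W (u ∘ Fin.castAdd h) (k ∘ Fin.succ) hca
      fun i j => hku _ _
    have hsel := runMap_select_list (k 0) (u ∘ Fin.castAdd (n := h) h) (u ∘ Fin.natAdd h (m := h))
      (fun i => hku _ _) (fun i => hku _ _) huv hca hna (List.finRange h) (List.nodup_finRange h)
    have hcnt := countP_flatMap_selectGates (k 0) (u ∘ Fin.castAdd (n := h) h)
      (u ∘ Fin.natAdd h (m := h)) (fun i => hku _ _) (fun i => hku _ _) huv (List.finRange h)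
    refine ⟨((List.finRange h).flatMap fun i => selectGates (k 0)
      ((u ∘ Fin.castAdd (n := h) h) i) ((u ∘ Fin.natAdd h (m := h)) i) (hku _ _) (hku _ _)
      (huv i i)) ++ gs, ?_, ?_, fun x => ?_⟩
    · intro g hg
      rcases List.mem_append.1 hg with hg | hg
      · obtain ⟨i, -, hi⟩ := List.mem_flatMap.1 hg
        exact isClassical_selectGates _ _ _ _ _ _ g hi
      · exact hcl g hg
    · rw [List.countP_append, hcnt, List.length_finRange]
      omega
    · obtain ⟨hs1, hs2⟩ := hsel x
      obtain ⟨hr1, hr2⟩ := hrun (runMap ((List.finRange h).flatMap fun i =>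
        selectGates (k 0) ((u ∘ Fin.castAdd (n := h) h) i)
        ((u ∘ Fin.natAdd h (m := h)) i) (hku _ _) (hku _ _) (huv i i)) x)
      rw [runMap_append]
      refine ⟨fun h0 => ?_, fun w hw => ?_⟩
      · have h5 := hr1 hpos
        rw [show u ⟨0, h0⟩ = (u ∘ Fin.castAdd h) ⟨0, hpos⟩ from rfl, h5]
        congr 1
        · funext l
          exact hs1 l (List.mem_finRange l)
        · funext i
          exact hs2 _ fun j _ => ⟨hku _ _, hku _ _⟩
      · rw [hr2 w fun j => hw _, hs2 w fun j _ => ⟨hw _, hw _⟩]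

/-- The top digit has weight `2 ^ n / (2 ^ (n + 1) - 1)`. One more control digit and one Toffoli
gate replace the digit selected among the lower ones by it. -/
theorem HasSelector.succ {n L : ℕ} (hpos : 1 ≤ n) (hs : HasSelector n L) :
    HasSelector (n + 1) (L + 1) := by
  obtain ⟨t, out, ht, hsum, hgs⟩ := hs
  have h1 := two_pow_sub_one_pos hpos
  have h2 := two_pow_sub_one_pos (n := n + 1) (by omega)
  have h5 : (2 : ℝ) ^ (n + 1) = 2 * 2 ^ n := by rw [pow_succ]; ring
  refine ⟨Fin.cons (2 ^ n / (2 ^ (n + 1) - 1)) t, fun x c => if c 0 then x (Fin.last n) else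
    out (fun l => x (Fin.castSucc l)) (Fin.tail c), cons_mem_Icc ⟨by positivity, by
      rw [div_le_one h2]; linarith⟩ ht, fun x => ?_, ?_⟩
  · have h4 : (1 : ℝ) - 2 ^ n / (2 ^ (n + 1) - 1) = (2 ^ n - 1) / (2 ^ (n + 1) - 1) := by
      rw [eq_div_iff h2.ne', sub_mul, div_mul_cancel₀ _ h2.ne']
      linarith
    rw [sum_prodWeight_cons]
    simp only [Fin.cons_zero, Fin.tail_cons, if_true, Bool.false_eq_true, if_false, hsum]
    rw [← Finset.sum_mul, sum_prodWeight, one_mul, symPoint, symPoint, Fin.sum_univ_castSucc, h4,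
      Finset.mul_sum, add_comm]
    congr 1
    apply Finset.sum_congr rfl
    intro l _
    rw [Fin.val_castSucc]
    field_simp
  · intro W _ _ u k hu hku
    have hca : Function.Injective (u ∘ Fin.castSucc (n := n)) :=
      hu.comp (Fin.castSucc_injective n)
    have h0 : u ⟨0, by omega⟩ ≠ u (Fin.last n) := fun h => by
      have := congrArg Fin.val (hu h)
      simp only [Fin.val_last] at this
      omega
    obtain ⟨gs, hcl, hcount, hrun⟩ := hgs W (u ∘ Fin.castSucc) (k ∘ Fin.succ) hca
      fun i j => hku _ _
    refine ⟨gs ++ selectGates (k 0) (u ⟨0, by omega⟩) (u (Fin.last n)) (hku _ _) (hku _ _) h0,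
      ?_, ?_, fun x => ?_⟩
    · intro g hg
      rcases List.mem_append.1 hg with hg | hg
      · exact hcl g hg
      · exact isClassical_selectGates _ _ _ _ _ _ g hg
    · rw [List.countP_append, selectGates]
      simp only [List.countP_cons, Gate.isToffoli, List.countP_nil]
      simp only [Bool.false_eq_true, if_false, if_true]
      omega
    · obtain ⟨hr1, hr2⟩ := hrun x
      rw [runMap_append, runMap_selectGates]
      have hne : ∀ j, u (Fin.last n) ≠ (u ∘ Fin.castSucc) j := fun j h => by
        have := congrArg Fin.val (hu h)
        simp only [Fin.val_last, Fin.val_castSucc] at this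
        omega
      refine ⟨fun _ => ?_, fun w hw => ?_⟩
      · rw [Function.update_self, hr2 _ fun j => hku _ _, hr2 _ hne]
        have := hr1 hpos
        rw [show (u ∘ Fin.castSucc) ⟨0, hpos⟩ = u ⟨0, by omega⟩ from rfl] at this
        rw [this]
        rfl
      · rw [Function.update_of_ne (hw _), Function.update_of_ne (hw _), hr2 w fun j => hw _]

/-- Each halving of `n` costs one control digit, and a second one if `n` is odd. -/
theorem exists_hasSelector (n : ℕ) (hn : 1 ≤ n) : ∃ L ≤ 2 * Nat.log 2 n, HasSelector n L := by
  induction n using Nat.strong_induction_on with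
  | _ n ih =>
    rcases Nat.lt_or_ge n 2 with h | h
    · obtain rfl : n = 1 := by omega
      exact ⟨0, by simp, hasSelector_one⟩
    · obtain ⟨L, hL, hs⟩ := ih (n / 2) (by omega) (by omega)
      have hlog : Nat.log 2 n = Nat.log 2 (n / 2) + 1 := by
        rw [Nat.log_of_one_lt_of_le (by norm_num) h]
      rcases Nat.even_or_odd' n with ⟨r, hr | hr⟩
      · refine ⟨L + 1, by omega, ?_⟩
        have := hs.double (by omega)
        rwa [show n / 2 + n / 2 = n by omega] at this
      · refine ⟨L + 2, by omega, ?_⟩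
        have := (hs.double (by omega)).succ (by omega)
        rwa [show n / 2 + n / 2 + 1 = n by omega] at this

end

section

open Matrix Polynomial ComplexConjugate

/-! ### Signal processing of a controlled operator -/

section Walk

variable {V : Type} [Fintype V] [DecidableEq V]

/-- The vector with the parts `a` and `b` where the wire `none` holds `0` and `1`. -/
def pairVec (a b : (V → Bool) → ℂ) (x : Option V → Bool) : ℂ :=
  if x none then b (x ∘ some) else a (x ∘ some)

theorem sum_option_bool {M : Type} [AddCommMonoid M] (f : (Option V → Bool) → M) :
    ∑ x, f x = ∑ s : Bool, ∑ z : V → Bool, f fun o => o.elim s z := by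
  rw [← (Equiv.piOptionEquivProd (β := fun _ : Option V => Bool)).symm.sum_comp,
    Fintype.sum_prod_type]
  apply Finset.sum_congr rfl
  intro s _
  apply Finset.sum_congr rfl
  intro z _
  congr 1
  funext o
  cases o <;> rfl

theorem pairVec_elim (a b : (V → Bool) → ℂ) (s : Bool) (z : V → Bool) :
    pairVec a b (fun o => o.elim s z) = if s then b z else a z := rfl

theorem tens_mulVec_pairVec (N : Matrix Bool Bool ℂ) (M : V → Matrix Bool Bool ℂ)
    (a b : (V → Bool) → ℂ) :
    tens (fun o : Option V => o.elim N M) *ᵥ pairVec a b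
      = pairVec (N false false • (tens M *ᵥ a) + N false true • (tens M *ᵥ b))
          (N true false • (tens M *ᵥ a) + N true true • (tens M *ᵥ b)) := by
  funext x
  have h : ∀ s z, tens (fun o : Option V => o.elim N M) x (fun o => o.elim s z)
      = N (x none) s * tens M (x ∘ some) z := by
    intro s z
    rw [tens_apply, Fintype.prod_option, tens_apply]
    rfl
  simp only [Matrix.mulVec, dotProduct]
  rw [sum_option_bool]
  simp only [h, pairVec_elim, Fintype.sum_bool, if_true, Bool.false_eq_true, if_false, mul_assoc,
    ← Finset.mul_sum]
  unfold pairVec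
  cases x none <;>
  simp only [Matrix.mulVec, dotProduct, if_true, Bool.false_eq_true, if_false, Pi.add_apply,
    Pi.smul_apply, smul_eq_mul] <;> ring

theorem onQubit_none_mulVec_pairVec (N : Matrix Bool Bool ℂ) (a b : (V → Bool) → ℂ) :
    onQubit none N *ᵥ pairVec a b
      = pairVec (N false false • a + N false true • b) (N true false • a + N true true • b) := by
  have h : onQubit (none : Option V) N
      = tens (fun o : Option V => o.elim N fun _ => 1) := by
    rw [onQubit_eq_tens]
    congr 1
    funext o
    cases o
    · exact Function.update_self _ _ _
    · exact Function.update_of_ne (by simp) _ _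
  rw [h, tens_mulVec_pairVec, tens_one]
  simp only [Matrix.one_mulVec]

theorem tens_elim_one_mulVec_pairVec (M : V → Matrix Bool Bool ℂ) (a b : (V → Bool) → ℂ) :
    tens (fun o : Option V => o.elim 1 M) *ᵥ pairVec a b
      = pairVec (tens M *ᵥ a) (tens M *ᵥ b) := by
  rw [tens_mulVec_pairVec]
  simp

theorem diagonal_mulVec_pairVec (d : (V → Bool) → ℂ) (a b : (V → Bool) → ℂ) :
    (Matrix.diagonal fun x : Option V → Bool => if x none then 1 else d (x ∘ some))
      *ᵥ pairVec a b = pairVec (Matrix.diagonal d *ᵥ a) b := by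
  funext x
  rw [Matrix.mulVec_diagonal]
  unfold pairVec
  cases x none <;> simp [Matrix.mulVec_diagonal]

theorem rotation_Y_mulVec_pairVec (θ : ℝ)
    (w : Matrix (V → Bool) (V → Bool) ℂ × Matrix (V → Bool) (V → Bool) ℂ)
    (v : (V → Bool) → ℂ) :
    (seq [Gate.rotation .Y θ (none : Option V)]).matrix *ᵥ pairVec (w.1 *ᵥ v) (w.2 *ᵥ v)
      = pairVec ((yAct θ w).1 *ᵥ v) ((yAct θ w).2 *ᵥ v) := by
  rw [matrix_seq_cons, matrix_seq_nil, Matrix.one_mul]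
  change onQubit none (rotMatrix .Y θ) *ᵥ _ = _
  rw [onQubit_none_mulVec_pairVec, rotMatrix_Y_apply]
  simp only [Matrix.of_apply, yAct, Matrix.add_mulVec, Matrix.smul_mulVec,
    if_true, Bool.false_eq_true, Bool.true_eq_false, if_false, neg_smul, sub_eq_add_neg, Matrix.neg_mulVec]

theorem rotation_Z_mulVec_pairVec (φ : ℝ) (a b : (V → Bool) → ℂ) :
    (seq [Gate.rotation .Z φ (none : Option V)]).matrix *ᵥ pairVec a b
      = pairVec (zPhase φ false • a) (zPhase φ true • b) := by
  rw [matrix_seq_cons, matrix_seq_nil, Matrix.one_mul]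
  change onQubit none (rotMatrix .Z φ) *ᵥ _ = _
  rw [onQubit_none_mulVec_pairVec, rotMatrix_Z_eq]
  simp [zPhase]

/-- The repetition of a circuit. -/
def iter (c : Circuit V) : ℕ → Circuit V
  | 0 => []
  | m + 1 => iter c m ++ c

theorem rotDepth_iter (c : Circuit V) (m : ℕ) : (iter c m).rotDepth = m * c.rotDepth := by
  induction m with
  | zero => simp [iter, Circuit.rotDepth]
  | succ m ih => rw [iter, Circuit.rotDepth_append, ih]; ring

theorem tofDepth_iter (c : Circuit V) (m : ℕ) : (iter c m).tofDepth = m * c.tofDepth := by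
  induction m with
  | zero => simp [iter, Circuit.tofDepth]
  | succ m ih => rw [iter, Circuit.tofDepth_append, ih]; ring

theorem iter_mulVec_pairVec {c : Circuit (Option V)} {C : Matrix (V → Bool) (V → Bool) ℂ}
    (hc : ∀ a b, c.matrix *ᵥ pairVec a b = pairVec (C *ᵥ a) b) (m : ℕ) (a b : (V → Bool) → ℂ) :
    (iter c m).matrix *ᵥ pairVec a b = pairVec (C ^ m *ᵥ a) b := by
  induction m with
  | zero => simp [iter, Circuit.matrix_nil]
  | succ m ih =>
    rw [iter, Circuit.matrix_append, ← Matrix.mulVec_mulVec, ih, hc, pow_succ',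
      Matrix.mulVec_mulVec]

/-- A bounded polynomial of a controlled operator. -/
theorem exists_walk_circuit {cW cI : Circuit (Option V)} {C C' : Matrix (V → Bool) (V → Bool) ℂ}
    (hW : ∀ a b, cW.matrix *ᵥ pairVec a b = pairVec (C *ᵥ a) b)
    (hI : ∀ a b, cI.matrix *ᵥ pairVec a b = pairVec (C' *ᵥ a) b)
    {N : ℕ} {A : ℂ[X]} (hA : A.natDegree ≤ N) (hA1 : ∀ z : ℂ, ‖z‖ = 1 → ‖A.eval z‖ ≤ 1) (m : ℕ) :
    ∃ c : Circuit (Option V), c.rotDepth ≤ 2 + (cW.rotDepth + 2) * N + m * cI.rotDepth ∧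
      c.tofDepth ≤ cW.tofDepth * N + m * cI.tofDepth ∧
      ∀ v, ∃ b, c.matrix *ᵥ pairVec v 0 = pairVec (C' ^ m *ᵥ (aeval C A *ᵥ v)) b := by
  obtain ⟨θ, φ, hθφ⟩ := exists_angles N A hA hA1
  let Y : ℕ → Circuit (Option V) := fun k => seq [.rotation .Y (θ k) none]
  let Z : ℕ → Circuit (Option V) := fun k => seq [.rotation .Z (φ k) none]
  have hYr : ∀ k, (Y k).rotDepth = 1 := fun k => by simp [Y, rotDepth_seq, Gate.isRotation]
  have hZr : ∀ k, (Z k).rotDepth = 1 := fun k => by simp [Z, rotDepth_seq, Gate.isRotation]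
  have hYt : ∀ k, (Y k).tofDepth = 0 := fun k => by simp [Y, tofDepth_seq, Gate.isToffoli]
  have hZt : ∀ k, (Z k).tofDepth = 0 := fun k => by simp [Z, tofDepth_seq, Gate.isToffoli]
  have hrun : ∀ k v, (run (Y 0) (fun k => cW ++ Z k) Y k).matrix *ᵥ pairVec v 0
      = pairVec ((qcol C θ φ k).1 *ᵥ v) ((qcol C θ φ k).2 *ᵥ v) := by
    intro k v
    induction k with
    | zero =>
      have := rotation_Y_mulVec_pairVec (θ 0) (1, 0) v
      rw [Matrix.one_mulVec, Matrix.zero_mulVec] at this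
      exact this
    | succ k ih =>
      rw [run, Circuit.matrix_append, Circuit.matrix_append, Circuit.matrix_append,
        ← Matrix.mulVec_mulVec, ← Matrix.mulVec_mulVec, ← Matrix.mulVec_mulVec, ih, hW,
        rotation_Z_mulVec_pairVec, qcol]
      rw [Matrix.mulVec_mulVec, ← Matrix.smul_mulVec, ← Matrix.smul_mulVec]
      exact rotation_Y_mulVec_pairVec _ (zAct (φ k) (C * (qcol C θ φ k).1, (qcol C θ φ k).2)) v
  -- The signal-processing sequence with `C` for the variable, followed by `m` applications of `C'`
  -- that will remove surplus powers of `C`.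
  refine ⟨run (Y 0) (fun k => cW ++ Z k) Y N ++ (Z N ++ iter cI m), ?_, ?_, fun v => ?_⟩
  · have := rotDepth_run_le (I := Y 0) (S := fun k => cW ++ Z k) (Y := Y) (i := 1)
      (r := cW.rotDepth + 2) (hYr 0).le (fun k => by
        rw [Circuit.rotDepth_append, hYr, hZr]) N
    rw [Circuit.rotDepth_append, Circuit.rotDepth_append, rotDepth_iter, hZr]
    omega
  · have := tofDepth_run_le (I := Y 0) (S := fun k => cW ++ Z k) (Y := Y) (i := 0)
      (r := cW.tofDepth) (hYt 0).le (fun k => by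
        rw [Circuit.tofDepth_append, hYt, hZt]; omega) N
    rw [Circuit.tofDepth_append, Circuit.tofDepth_append, tofDepth_iter, hZt]
    omega
  · refine ⟨zPhase (φ N) true • ((qcol C θ φ N).2 *ᵥ v), ?_⟩
    rw [Circuit.matrix_append, Circuit.matrix_append, ← Matrix.mulVec_mulVec,
      ← Matrix.mulVec_mulVec, hrun, rotation_Z_mulVec_pairVec, iter_mulVec_pairVec hI]
    rw [← Matrix.smul_mulVec]
    have h1 := congrArg Prod.fst (qcol_map (aeval C) (X : ℂ[X]) θ φ N)
    simp only [aeval_X] at h1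
    rw [h1, ← map_smul, ← hθφ]

/-! ### Chebyshev walks -/

/-- The polynomial `z ^ D * p ((1 - Re z) / 2)` on the circle. -/
def chebLift (D : ℕ) (p : ℂ[X]) : ℂ[X] :=
  ∑ k ∈ Finset.range (D + 1), C (p.coeff k) * (X ^ (D - k) * (C (-(1 / 4)) * (X - 1) ^ 2) ^ k)

theorem natDegree_chebLift_le (D : ℕ) (p : ℂ[X]) : (chebLift D p).natDegree ≤ 2 * D := by
  apply natDegree_sum_le_of_forall_le
  intro k hk
  have hk' : k ≤ D := by simpa [Nat.lt_succ_iff] using hk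
  refine (natDegree_C_mul_le _ _).trans ?_
  have h1 : ((X - 1 : ℂ[X])).natDegree ≤ 1 := by
    simpa using natDegree_X_sub_C_le (1 : ℂ)
  have h2 : ((C (-(1 / 4)) * (X - 1) ^ 2 : ℂ[X]) ^ k).natDegree ≤ k * (2 * 1) :=
    natDegree_pow_le_of_le k ((natDegree_C_mul_le _ _).trans (natDegree_pow_le_of_le 2 h1))
  refine (natDegree_mul_le_of_le (natDegree_X_pow_le _) h2).trans ?_
  omega

theorem norm_eval_chebLift_le {D : ℕ} {p : ℂ[X]} (hp : p.natDegree ≤ D)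
    (h : ∀ s ∈ Set.Icc (0 : ℝ) 1, ‖p.eval (s : ℂ)‖ ≤ 1) {z : ℂ} (hz : ‖z‖ = 1) :
    ‖(chebLift D p).eval z‖ ≤ 1 := by
  have hre := Complex.abs_re_le_norm z
  rw [hz, abs_le] at hre
  have hzz : z * conj z = 1 := by rw [mul_comm, conj_mul_self_of_norm hz]
  -- On the circle `(z - 1) ^ 2 = z * (z + conj z - 2)`.
  have h1 : -(1 / 4) * (z - 1) ^ 2 = z * (((1 - z.re) / 2 : ℝ) : ℂ) := by
    have h2 : (z.re : ℂ) = (z + conj z) / 2 := by rw [Complex.re_eq_add_conj]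
    push_cast
    rw [h2]
    linear_combination (1 / 4 : ℂ) * hzz
  have h2 : (chebLift D p).eval z = z ^ D * p.eval (((1 - z.re) / 2 : ℝ) : ℂ) := by
    rw [chebLift, eval_finsetSum, eval_eq_sum_range' (Nat.lt_succ_of_le hp), Finset.mul_sum]
    apply Finset.sum_congr rfl
    intro k hk
    have hk' : k ≤ D := by simpa [Nat.lt_succ_iff] using hk
    simp only [eval_mul, eval_C, eval_pow, eval_X, eval_sub, eval_one]
    rw [h1, mul_pow, ← mul_assoc (z ^ (D - k)), ← pow_add, Nat.sub_add_cancel hk']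
    ring
  rw [h2, norm_mul, norm_pow, hz, one_pow, one_mul]
  exact h _ ⟨by linarith [hre.2], by linarith [hre.1]⟩

/-- Modulo the quadratic, `(X - 1) ^ 2` is `-4 s X`, so the summand of index `k` becomes `p.coeff k
* s ^ k * X ^ D`. -/
theorem dvd_chebLift_sub {D : ℕ} {p : ℂ[X]} (hp : p.natDegree ≤ D) (s : ℂ) :
    (X ^ 2 - C (2 * (1 - 2 * s)) * X + 1 : ℂ[X]) ∣ chebLift D p - C (p.eval s) * X ^ D := by
  have h0 : (X ^ 2 - C (2 * (1 - 2 * s)) * X + 1 : ℂ[X])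
      ∣ C (-(1 / 4)) * (X - 1) ^ 2 - C s * X := by
    refine ⟨C (-(1 / 4)), ?_⟩
    have h4 : (C (-(1 / 4)) : ℂ[X]) * 4 = -1 := by
      rw [show (4 : ℂ[X]) = C 4 from rfl, ← C_mul]; norm_num
    simp only [C_mul, C_sub, C_1, show (C 2 : ℂ[X]) = 2 from rfl]
    linear_combination (-(C s * X)) * h4
  rw [chebLift, eval_eq_sum_range' (Nat.lt_succ_of_le hp), map_sum, Finset.sum_mul,
    ← Finset.sum_sub_distrib]
  apply Finset.dvd_sum
  intro k hk
  have hk' : k ≤ D := by simpa [Nat.lt_succ_iff] using hk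
  have h1 : C (p.coeff k) * (X ^ (D - k) * (C (-(1 / 4)) * (X - 1) ^ 2) ^ k)
      - C (p.coeff k * s ^ k) * X ^ D
      = C (p.coeff k) * X ^ (D - k) * ((C (-(1 / 4)) * (X - 1) ^ 2) ^ k - (C s * X) ^ k) := by
    have h2 : (X : ℂ[X]) ^ D = X ^ (D - k) * X ^ k := by rw [← pow_add, Nat.sub_add_cancel hk']
    rw [h2, C_mul, C_pow, mul_pow]
    ring
  rw [h1]
  exact (h0.trans (sub_dvd_pow_sub_pow _ _ k)).mul_left _

/-- The recurrence says that the quadratic in `C₀` annihilates `v`; divisibility thus takes the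
place of a diagonalisation of the walk. -/
theorem chebLift_mulVec {D : ℕ} {p : ℂ[X]} (hp : p.natDegree ≤ D) (s : ℂ)
    {C₀ : Matrix (V → Bool) (V → Bool) ℂ} {v : (V → Bool) → ℂ}
    (hv : C₀ *ᵥ (C₀ *ᵥ v) = (2 * (1 - 2 * s)) • (C₀ *ᵥ v) - v) :
    aeval C₀ (chebLift D p) *ᵥ v = p.eval s • (C₀ ^ D *ᵥ v) := by
  obtain ⟨Q, hQ⟩ := dvd_chebLift_sub hp s
  have h1 : chebLift D p = Q * (X ^ 2 - C (2 * (1 - 2 * s)) * X + 1) + C (p.eval s) * X ^ D := by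
    linear_combination hQ
  have h2 : aeval C₀ (X ^ 2 - C (2 * (1 - 2 * s)) * X + 1 : ℂ[X]) *ᵥ v = 0 := by
    rw [map_add, map_sub, map_mul, map_pow, aeval_X, aeval_C, map_one, Algebra.algebraMap_eq_smul_one,
      Matrix.smul_mul, Matrix.one_mul, Matrix.add_mulVec, Matrix.sub_mulVec, Matrix.smul_mulVec,
      Matrix.one_mulVec, sq, ← Matrix.mulVec_mulVec, hv]
    abel
  rw [h1, map_add, map_mul _ Q, map_mul _ _ (X ^ D), map_pow, aeval_X, aeval_C, Matrix.add_mulVec,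
    ← Matrix.mulVec_mulVec, h2, Matrix.mulVec_zero, zero_add, Algebra.algebraMap_eq_smul_one,
    Matrix.smul_mul, Matrix.one_mul, Matrix.smul_mulVec]

end Walk

end

section

open Matrix Polynomial ComplexConjugate

/-! ### The walk of the grid points -/

section Flag

variable {V : Type} [Fintype V] [DecidableEq V]

/-- The sign of the wire `w` after the gates `gs`, unless the wire `none` is set. -/
def flagCircuit (gs : List (Gate (Option V))) (w : V) : Circuit (Option V) :=
  conjBy gs (seq (czGates none (some w) (by simp) ++ [.phase (some w), .phase (some w)]))

/-- The value of the wire `w` after the gates `gs`. -/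
def flagBit (gs : List (Gate (Option V))) (w : V) (z : V → Bool) : Bool :=
  runMap gs (fun o => o.elim false z) (some w)

/-- `CZ` from `none` and `Z` on `w` cancel when `none` is set, so the control itself needs no
Toffoli gate; the surrounding classical gates uncompute themselves in either case. -/
theorem matrix_flagCircuit {gs : List (Gate (Option V))} (hcl : ∀ g ∈ gs, g.IsClassical) (w : V)
    (hq : ∀ x, runMap gs x none = x none) :
    (flagCircuit gs w).matrix = Matrix.diagonal fun x : Option V → Bool =>
      if x none then 1 else ((sgn (flagBit gs w (x ∘ some)) : ℝ) : ℂ) := by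
  have h0 : (seq (czGates (none : Option V) (some w) (by simp) ++
      [.phase (some w), .phase (some w)])).matrix = Matrix.diagonal fun x : Option V → Bool =>
        if x none then 1 else ((sgn (x (some w)) : ℝ) : ℂ) := by
    rw [matrix_seq_append, matrix_czGates, matrix_phase_phase, Matrix.diagonal_mul_diagonal]
    congr 1
    funext x
    rw [← Complex.ofReal_mul]
    cases x none <;> cases x (some w) <;> simp
  rw [flagCircuit, matrix_conjBy_of_diagonal hcl h0]
  congr 1
  funext x
  rw [Function.comp_apply, hq]
  cases h : x none
  · have hx : x = fun o => o.elim false (x ∘ some) := by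
      funext o
      cases o
      · exact h
      · rfl
    rw [flagBit, ← hx]
  · rfl

theorem rotDepth_flagCircuit {gs : List (Gate (Option V))} (hcl : ∀ g ∈ gs, g.IsClassical) (w : V) :
    (flagCircuit gs w).rotDepth = 0 := by
  rw [flagCircuit, rotDepth_conjBy hcl, rotDepth_seq]
  simp [czGates, Gate.isRotation]

theorem tofDepth_flagCircuit (gs : List (Gate (Option V))) (w : V) :
    (flagCircuit gs w).tofDepth = 2 * gs.countP Gate.isToffoli := by
  rw [flagCircuit, tofDepth_conjBy, tofDepth_seq]
  simp [czGates, Gate.isToffoli]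

/-- A layer of `Y`-rotations of all wires except `none`. -/
def tiltLayer (η : V → ℝ) : Layer (Option V) := rotLayer (fun _ => .Y) fun o => o.elim 0 η

/-- The product of the `Y`-rotations by the angles `η`. -/
def tilt (η : V → ℝ) : Matrix (V → Bool) (V → Bool) ℂ := tens fun w => rotMatrix .Y (η w)

theorem tiltLayer_mulVec_pairVec (η : V → ℝ) (a b : (V → Bool) → ℂ) :
    (tiltLayer η).matrix *ᵥ pairVec a b = pairVec (tilt η *ᵥ a) (tilt η *ᵥ b) := by
  rw [tilt, ← tens_elim_one_mulVec_pairVec, tiltLayer, matrix_rotLayer]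
  congr 2
  funext o
  cases o
  · exact rotMatrix_zero _
  · rfl

theorem tilt_neg_mul (η : V → ℝ) : tilt (fun w => -η w) * tilt η = 1 := by
  simp only [tilt, tens_mul, rotMatrix_mul, neg_add_cancel, rotMatrix_zero, tens_one]

theorem tilt_mul_neg (η : V → ℝ) : tilt η * tilt (fun w => -η w) = 1 := by
  simp only [tilt, tens_mul, rotMatrix_mul, add_neg_cancel, rotMatrix_zero, tens_one]

theorem tilt_neg_apply (η : V → ℝ) (x y : V → Bool) : tilt (fun w => -η w) x y = tilt η y x := by
  simp only [tilt, tens_apply]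
  apply Finset.prod_congr rfl
  intro w _
  rw [rotMatrix_Y_apply, rotMatrix_Y_apply]
  cases x w <;> cases y w <;> simp [neg_div, -Complex.ofReal_cos, -Complex.ofReal_sin]

theorem eq_of_tilt_ne_zero {η : V → ℝ} {x y : V → Bool} (h : tilt η x y ≠ 0) {w : V}
    (hw : η w = 0) : x w = y w := by
  by_contra hne
  apply h
  rw [tilt, tens_apply]
  apply Finset.prod_eq_zero (Finset.mem_univ w)
  rw [hw, rotMatrix_zero, Matrix.one_apply_ne hne]

/-- Conjugation of a diagonal matrix of signs by a tilt. -/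
def tiltSign (η : V → ℝ) (u : (V → Bool) → Bool) : Matrix (V → Bool) (V → Bool) ℂ :=
  tilt (fun w => -η w) * (Matrix.diagonal (fun x => ((sgn (u x) : ℝ) : ℂ)) * tilt η)

theorem signs_mul_self (u : (V → Bool) → Bool) :
    (Matrix.diagonal fun x => ((sgn (u x) : ℝ) : ℂ)) * (Matrix.diagonal fun x =>
      ((sgn (u x) : ℝ) : ℂ)) = 1 := by
  rw [Matrix.diagonal_mul_diagonal, ← Matrix.diagonal_one]
  congr 1
  funext x
  rw [← Complex.ofReal_mul, sgn_mul_self, Complex.ofReal_one]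

theorem tiltSign_mul_self (η : V → ℝ) (u : (V → Bool) → Bool) :
    tiltSign η u * tiltSign η u = 1 := by
  rw [tiltSign, Matrix.mul_assoc, Matrix.mul_assoc, ← Matrix.mul_assoc (tilt η), tilt_mul_neg,
    Matrix.one_mul, ← Matrix.mul_assoc (Matrix.diagonal _), signs_mul_self, Matrix.one_mul,
    tilt_neg_mul]

theorem tiltSign_apply (η : V → ℝ) (u : (V → Bool) → Bool) (x y : V → Bool) :
    tiltSign η u x y = ∑ z, tilt η z x * (((sgn (u z) : ℝ) : ℂ) * tilt η z y) := by
  rw [tiltSign, Matrix.mul_apply]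
  simp only [Matrix.diagonal_mul, tilt_neg_apply]

theorem eq_of_tiltSign_ne_zero {η : V → ℝ} {u : (V → Bool) → Bool} {x y : V → Bool}
    (h : tiltSign η u x y ≠ 0) {w : V} (hw : η w = 0) : x w = y w := by
  rw [tiltSign_apply] at h
  obtain ⟨z, -, hz⟩ := Finset.exists_ne_zero_of_sum_ne_zero h
  have h1 := left_ne_zero_of_mul hz
  have h2 := right_ne_zero_of_mul (right_ne_zero_of_mul hz)
  rw [← eq_of_tilt_ne_zero h1 hw, eq_of_tilt_ne_zero h2 hw]

/-- The circuit of `tiltSign`, controlled by the wire `none`. -/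
def tiltCircuit (η : V → ℝ) (gs : List (Gate (Option V))) (w : V) : Circuit (Option V) :=
  [tiltLayer η] ++ (flagCircuit gs w ++ [tiltLayer fun w => -η w])

theorem flagCircuit_mulVec_pairVec {gs : List (Gate (Option V))} (hcl : ∀ g ∈ gs, g.IsClassical)
    (w : V) (hq : ∀ x, runMap gs x none = x none) (a b : (V → Bool) → ℂ) :
    (flagCircuit gs w).matrix *ᵥ pairVec a b
      = pairVec ((Matrix.diagonal fun z => ((sgn (flagBit gs w z) : ℝ) : ℂ)) *ᵥ a) b := by
  rw [matrix_flagCircuit hcl w hq, diagonal_mulVec_pairVec fun z => ((sgn (flagBit gs w z) : ℝ) : ℂ)]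

/-- Only the signs are controlled: when `none` is set, the tilt meets its own inverse. -/
theorem tiltCircuit_mulVec_pairVec {gs : List (Gate (Option V))} (hcl : ∀ g ∈ gs, g.IsClassical)
    (w : V) (hq : ∀ x, runMap gs x none = x none) (η : V → ℝ) (a b : (V → Bool) → ℂ) :
    (tiltCircuit η gs w).matrix *ᵥ pairVec a b
      = pairVec (tiltSign η (flagBit gs w) *ᵥ a) b := by
  rw [tiltCircuit, Circuit.matrix_append, Circuit.matrix_append, Circuit.matrix_singleton,
    Circuit.matrix_singleton, ← Matrix.mulVec_mulVec, ← Matrix.mulVec_mulVec,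
    tiltLayer_mulVec_pairVec, flagCircuit_mulVec_pairVec hcl w hq, tiltLayer_mulVec_pairVec,
    Matrix.mulVec_mulVec b, tilt_neg_mul, Matrix.one_mulVec, tiltSign, Matrix.mulVec_mulVec,
    Matrix.mulVec_mulVec, Matrix.mul_assoc]

theorem rotDepth_tiltCircuit_le {gs : List (Gate (Option V))} (hcl : ∀ g ∈ gs, g.IsClassical)
    (w : V) (η : V → ℝ) : (tiltCircuit η gs w).rotDepth ≤ 2 := by
  have h1 : Circuit.rotDepth [tiltLayer η] ≤ 1 := rotDepth_rotLayer_le _ _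
  have h2 : Circuit.rotDepth [tiltLayer fun w => -η w] ≤ 1 := rotDepth_rotLayer_le _ _
  rw [tiltCircuit, Circuit.rotDepth_append, Circuit.rotDepth_append, rotDepth_flagCircuit hcl]
  omega

theorem tofDepth_tiltCircuit (gs : List (Gate (Option V))) (w : V) (η : V → ℝ) :
    (tiltCircuit η gs w).tofDepth = 2 * gs.countP Gate.isToffoli := by
  have h1 : Circuit.tofDepth [tiltLayer η] = 0 := tofDepth_rotLayer _ _
  have h2 : Circuit.tofDepth [tiltLayer fun w => -η w] = 0 := tofDepth_rotLayer _ _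
  rw [tiltCircuit, Circuit.tofDepth_append, Circuit.tofDepth_append, tofDepth_flagCircuit, h1, h2]
  omega

end Flag

/-! ### Two involutions whose product walks with cosine `1 - 2 x` -/

section Grid

variable {n L : ℕ}

/-- The data, the control digits, and scratch wires. -/
abbrev GridWires (n L : ℕ) : Type := Fin n ⊕ (Fin L ⊕ (Fin L ⊕ Unit))

/-- The angles that give the control digits the probabilities `t`. -/
def gridAngles (t : Fin L → ℝ) : GridWires n L → ℝ :=
  Sum.elim (fun _ => 0) (Sum.elim (fun k => 2 * Real.arcsin (Real.sqrt (t k))) fun _ => 0)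

/-- The state with data `i` and control digits `c`. -/
def gridState (i : Fin n → Bool) (c : Fin L → Bool) : GridWires n L → Bool :=
  Sum.elim i (Sum.elim c fun _ => false)

theorem gridState_inj {i j : Fin n → Bool} {c e : Fin L → Bool} :
    gridState i c = gridState j e ↔ i = j ∧ c = e := by
  constructor
  · intro h
    exact ⟨funext fun l => congrFun h (.inl l), funext fun k => congrFun h (.inr (.inl k))⟩
  · rintro ⟨rfl, rfl⟩; rfl

/-- With the angle `2 arcsin √t` the squared amplitudes of a control digit are `t` and `1 - t`; the
digits are independent. -/
theorem tilt_gridState {t : Fin L → ℝ} (ht : ∀ k, t k ∈ Set.Icc (0 : ℝ) 1) (i : Fin n → Bool)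
    (c : Fin L → Bool) :
    tilt (gridAngles t) (gridState i c) (gridState i fun _ => false)
        * tilt (gridAngles t) (gridState i c) (gridState i fun _ => false)
      = ((prodWeight t c : ℝ) : ℂ) := by
  rw [tilt, tens_apply, Fintype.prod_sum_type, Fintype.prod_sum_type]
  simp only [gridAngles, gridState, Sum.elim_inl, Sum.elim_inr, rotMatrix_zero, Matrix.one_apply_eq,
    Finset.prod_const_one, one_mul, mul_one]
  rw [← Finset.prod_mul_distrib, prodWeight, Complex.ofReal_prod]
  apply Finset.prod_congr rfl
  intro k _
  have h1 : Real.sin (Real.arcsin (Real.sqrt (t k))) = Real.sqrt (t k) :=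
    Real.sin_arcsin (by linarith [Real.sqrt_nonneg (t k)]) (Real.sqrt_le_one.2 (ht k).2)
  have h2 : Real.sqrt (t k) * Real.sqrt (t k) = t k := Real.mul_self_sqrt (ht k).1
  have h3 := Real.cos_sq_add_sin_sq (Real.arcsin (Real.sqrt (t k)))
  rw [rotMatrix_Y_apply, mul_div_cancel_left₀ _ (two_ne_zero' ℝ)]
  cases c k
  · simp only [Matrix.of_apply, if_true, Bool.false_eq_true, if_false]
    rw [← Complex.ofReal_mul]
    congr 1
    rw [h1] at h3
    linarith
  · simp only [Matrix.of_apply, if_true, Bool.true_eq_false, if_false]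
    rw [← Complex.ofReal_mul, h1, h2]

/-- The diagonal entry is the expected sign in the tilted state. The tilt fixes all wires but the
control digits, so only grid states with data `i` contribute. -/
theorem tiltSign_gridState {t : Fin L → ℝ} (ht : ∀ k, t k ∈ Set.Icc (0 : ℝ) 1)
    {u : (GridWires n L → Bool) → Bool} {out : (Fin n → Bool) → (Fin L → Bool) → Bool}
    (hu : ∀ i c, u (gridState i c) = out i c) (i : Fin n → Bool) :
    tiltSign (gridAngles t) u (gridState i fun _ => false) (gridState i fun _ => false)
      = ((∑ c, prodWeight t c * sgn (out i c) : ℝ) : ℂ) := by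
  rw [tiltSign_apply, Complex.ofReal_sum]
  symm
  apply Fintype.sum_of_injective (fun c => gridState i c)
    (fun c e hce => (gridState_inj.1 hce).2)
  · intro z hz
    by_contra hne
    have h1 := left_ne_zero_of_mul hne
    apply hz
    refine ⟨fun k => z (.inr (.inl k)), ?_⟩
    funext w
    rcases w with l | k | w
    · exact (eq_of_tilt_ne_zero h1 (w := .inl l) rfl).symm
    · rfl
    · exact (eq_of_tilt_ne_zero h1 (w := .inr (.inr w)) rfl).symm
  · intro c
    rw [Complex.ofReal_mul, ← tilt_gridState ht i c, hu]
    ring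

/-- Let `U` be the tilted sign, an involution with diagonal entry `τ = 1 - 2 x` at the basis state
`v`. The signs `R` fix `v` and negate every other basis state that occurs in `U v`, so `R U v = 2 τ
v - U v`. Applying `R U` again and using `U U v = v`, `R v = v` gives the Chebyshev recurrence. -/
theorem grid_walk {t : Fin L → ℝ} (ht : ∀ k, t k ∈ Set.Icc (0 : ℝ) 1)
    {u r : (GridWires n L → Bool) → Bool} {out : (Fin n → Bool) → (Fin L → Bool) → Bool}
    (hu : ∀ i c, u (gridState i c) = out i c)
    (hr : ∀ i c, r (gridState i c) = false ↔ c = fun _ => false)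
    (hsum : ∀ i, ∑ c, prodWeight t c * sgn (out i c) = symPoint i) (hn : 1 ≤ n)
    (i : Fin n → Bool) {C₀ : Matrix (GridWires n L → Bool) (GridWires n L → Bool) ℂ}
    (hC : C₀ = (Matrix.diagonal fun x => ((sgn (r x) : ℝ) : ℂ)) * tiltSign (gridAngles t) u)
    {v : (GridWires n L → Bool) → ℂ} (hv : v = Pi.single (gridState i fun _ => false) 1) :
    C₀ *ᵥ (C₀ *ᵥ v) = (2 * (1 - 2 * (gridPoint i : ℂ))) • (C₀ *ᵥ v) - v := by
  set U := tiltSign (gridAngles t) u with hU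
  set R : Matrix (GridWires n L → Bool) (GridWires n L → Bool) ℂ :=
    Matrix.diagonal fun x => ((sgn (r x) : ℝ) : ℂ) with hR
  set b : GridWires n L → Bool := gridState i fun _ => false with hb
  have ht' : U b b = 1 - 2 * (gridPoint i : ℂ) := by
    rw [hU, hb, tiltSign_gridState ht hu i, hsum, symPoint_eq hn]
    push_cast; ring
  have hrb : r b = false := (hr i _).2 rfl
  have h1 : R *ᵥ v = v := by
    funext x
    rw [hR, Matrix.mulVec_diagonal, hv]
    by_cases hx : x = b
    · subst hx; simp [hrb]
    · simp [hx]
  have h2 : R *ᵥ (U *ᵥ v) = (2 * (1 - 2 * (gridPoint i : ℂ))) • v - U *ᵥ v := by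
    funext x
    rw [hR, Matrix.mulVec_diagonal, hv, Matrix.mulVec_single_one, Pi.sub_apply, Pi.smul_apply,
      Matrix.col_apply, smul_eq_mul]
    by_cases hx : x = b
    · subst hx
      rw [hrb, ht', Pi.single_eq_same]
      simp only [sgn_false, Complex.ofReal_one]
      ring
    · rw [Pi.single_eq_of_ne hx]
      by_cases hz : U x b = 0
      · rw [hz]; simp
      · have hxs : x = gridState i fun k => x (.inr (.inl k)) := by
          funext w
          rcases w with l | k | w
          · exact eq_of_tiltSign_ne_zero hz (w := .inl l) rfl
          · rfl
          · exact eq_of_tiltSign_ne_zero hz (w := .inr (.inr w)) rfl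
        have hrx : r x = true := by
          by_contra hcon
          rw [Bool.not_eq_true, hxs, hr] at hcon
          apply hx
          rw [hxs, hcon]
        rw [hrx]
        simp
  have h3 : C₀ *ᵥ v = (2 * (1 - 2 * (gridPoint i : ℂ))) • v - U *ᵥ v := by
    rw [hC, ← Matrix.mulVec_mulVec, h2]
  have h4 : U *ᵥ (U *ᵥ v) = v := by
    rw [Matrix.mulVec_mulVec, tiltSign_mul_self, Matrix.one_mulVec]
  conv_lhs => rw [h3]
  rw [Matrix.mulVec_sub, Matrix.mulVec_smul]
  congr 1
  rw [hC, ← Matrix.mulVec_mulVec, h4, h1]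

/-- Moves the extra wire to the ancillas. -/
def optionWires (n : ℕ) (Z : Type) : Option (Fin n ⊕ Z) ≃ Fin n ⊕ Option Z where
  toFun o := o.elim (.inr none) (Sum.elim .inl fun z => .inr (some z))
  invFun := Sum.elim (fun l => some (.inl l)) fun o => o.elim none fun z => some (.inr z)
  left_inv o := by rcases o with _ | l | z <;> rfl
  right_inv w := by rcases w with l | _ | z <;> rfl

/-- The gates that store in the last wire whether a control digit is set. -/
def anyGates (n L : ℕ) : List (Gate (Option (GridWires n L))) :=
  firstHit (fun k => some (.inr (.inl k))) (fun k => some (.inr (.inr (.inl k))))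
    (some (.inr (.inr (.inr ())))) (by simp) (by simp) (by simp) (List.finRange L)

theorem runMap_firstHit_of_ne {W ι : Type} [Fintype W] [DecidableEq W] (d h : ι → W) (m : W)
    (hdh : ∀ i j, d i ≠ h j) (hd : ∀ i, d i ≠ m) (hh : ∀ i, h i ≠ m) (l : List ι) (x : W → Bool)
    (w : W) (hwm : w ≠ m) (hwh : ∀ k, w ≠ h k) :
    runMap (firstHit d h m hdh hd hh l) x w = x w := by
  induction l generalizing x with
  | nil => rfl
  | cons k l ih =>
    simp only [firstHit, runMap, basisMap_cx, basisMap_toffoli, ih, Function.update_of_ne hwm,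
      Function.update_of_ne (hwh k)]

theorem flagBit_anyGates (i : Fin n → Bool) (c : Fin L → Bool) :
    flagBit (anyGates n L) (.inr (.inr (.inr ()))) (gridState i c) = false
      ↔ c = fun _ => false := by
  have h := (runMap_firstHit (fun k => (some (.inr (.inl k)) : Option (GridWires n L)))
    (fun k => some (.inr (.inr (.inl k)))) (some (.inr (.inr (.inr ())))) (by simp) (by simp)
    (by simp) (fun a b hab => by simpa using hab) (List.finRange L) (List.nodup_finRange L)
    (fun o => o.elim false (gridState i c)) (fun k _ => rfl)).1
  rw [flagBit, anyGates, h]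
  simp only [Option.elim_some, gridState, Sum.elim_inr, Sum.elim_inl, Bool.false_or,
    List.any_eq_false, List.mem_finRange, true_imp_iff, Bool.not_eq_true]
  exact funext_iff.symm

/-- A bounded polynomial of the grid points as a block of a circuit. -/
theorem exists_polynomial_circuit (hn : 1 ≤ n) (hs : HasSelector n L) {D : ℕ} {p : ℂ[X]}
    (hp : p.natDegree ≤ D) (hp1 : ∀ s ∈ Set.Icc (0 : ℝ) 1, ‖p.eval (s : ℂ)‖ ≤ 1) :
    ∃ c : Circuit (Fin n ⊕ Option (Fin L ⊕ (Fin L ⊕ Unit))), c.rotDepth ≤ 10 * D + 2 ∧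
      c.tofDepth ≤ 6 * D * (n + L) ∧
      ∀ i j : Fin n → Bool, c.matrix (Sum.elim i fun _ => false) (Sum.elim j fun _ => false)
        = Matrix.diagonal (fun b => p.eval (gridPoint b : ℂ)) i j := by
  obtain ⟨t, out, ht, hsum, hsel⟩ := hs
  obtain ⟨gs, hcl, hcount, hrun⟩ := hsel (Option (GridWires n L)) (fun l => some (.inl l))
    (fun k => some (.inr (.inl k))) (fun a b hab => by simpa using hab) (by simp)
  have hcl' : ∀ g ∈ anyGates n L, g.IsClassical := isClassical_firstHit _ _ _ _ _ _ _
  let w₀ : GridWires n L := .inl ⟨0, hn⟩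
  let w₁ : GridWires n L := .inr (.inr (.inr ()))
  let u := flagBit gs w₀
  let r := flagBit (anyGates n L) w₁
  have hq : ∀ x, runMap gs x none = x none := fun x => (hrun x).2 none (by simp)
  have hq' : ∀ x, runMap (anyGates n L) x none = x none := fun x =>
    runMap_firstHit_of_ne _ _ _ _ _ _ _ x none (by simp) (by simp)
  have hu : ∀ i c, u (gridState i c) = out i c := fun i c => (hrun _).1 hn
  have hr : ∀ i c, r (gridState i c) = false ↔ c = fun _ => false := flagBit_anyGates
  let η : GridWires n L → ℝ := gridAngles t
  let R : Matrix (GridWires n L → Bool) (GridWires n L → Bool) ℂ :=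
    Matrix.diagonal fun x => ((sgn (r x) : ℝ) : ℂ)
  let C₀ := R * tiltSign η u
  let C' := tiltSign η u * R
  obtain ⟨cU, hcU, hrU, htU⟩ : ∃ c : Circuit (Option (GridWires n L)),
      (∀ a b, c.matrix *ᵥ pairVec a b = pairVec (tiltSign η u *ᵥ a) b) ∧ c.rotDepth ≤ 2 ∧
      c.tofDepth = 2 * gs.countP Gate.isToffoli :=
    ⟨tiltCircuit η gs w₀, tiltCircuit_mulVec_pairVec hcl w₀ hq η, rotDepth_tiltCircuit_le hcl w₀ η,
      tofDepth_tiltCircuit gs w₀ η⟩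
  obtain ⟨cR, hcR, hrR, htR⟩ : ∃ c : Circuit (Option (GridWires n L)),
      (∀ a b, c.matrix *ᵥ pairVec a b = pairVec (R *ᵥ a) b) ∧ c.rotDepth = 0 ∧
      c.tofDepth = 2 * (anyGates n L).countP Gate.isToffoli :=
    ⟨flagCircuit (anyGates n L) w₁, flagCircuit_mulVec_pairVec hcl' w₁ hq',
      rotDepth_flagCircuit hcl' w₁, tofDepth_flagCircuit (anyGates n L) w₁⟩
  rw [anyGates, countP_firstHit, List.length_finRange] at htR
  have hW : ∀ a b, (cU ++ cR).matrix *ᵥ pairVec a b = pairVec (C₀ *ᵥ a) b := by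
    intro a b
    rw [Circuit.matrix_append, ← Matrix.mulVec_mulVec, hcU, hcR, Matrix.mulVec_mulVec]
  have hI : ∀ a b, (cR ++ cU).matrix *ᵥ pairVec a b = pairVec (C' *ᵥ a) b := by
    intro a b
    rw [Circuit.matrix_append, ← Matrix.mulVec_mulVec, hcR, hcU, Matrix.mulVec_mulVec]
  have hinv : C' * C₀ = 1 := by
    rw [Matrix.mul_assoc, ← Matrix.mul_assoc R, signs_mul_self, Matrix.one_mul,
      tiltSign_mul_self]
  -- The lift has degree `2 D`: each of these steps needs at most two rotation layers for the tilts
  -- and two for the angles. The `D` inverse steps need at most two each. All `3 D` steps use at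
  -- most `2 (n + L)` Toffoli layers.
  obtain ⟨c, hcr, hct, hc⟩ := exists_walk_circuit hW hI (natDegree_chebLift_le D p)
    (fun z hz => norm_eval_chebLift_le hp hp1 hz) D
  let e := optionWires n (Fin L ⊕ (Fin L ⊕ Unit))
  refine ⟨c.mapWires e.toEmbedding, ?_, ?_, fun i j => ?_⟩
  · rw [Circuit.rotDepth_mapWires]
    rw [Circuit.rotDepth_append, Circuit.rotDepth_append] at hcr
    have h1 : (cU.rotDepth + cR.rotDepth + 2) * (2 * D) ≤ 4 * (2 * D) :=
      Nat.mul_le_mul_right _ (by omega)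
    have h2 : D * (cR.rotDepth + cU.rotDepth) ≤ D * 2 := Nat.mul_le_mul_left _ (by omega)
    omega
  · rw [Circuit.tofDepth_mapWires]
    rw [Circuit.tofDepth_append, Circuit.tofDepth_append] at hct
    have h1 : (cU.tofDepth + cR.tofDepth) * (2 * D) ≤ (2 * (n + L)) * (2 * D) :=
      Nat.mul_le_mul_right _ (by omega)
    have h2 : D * (cR.tofDepth + cU.tofDepth) ≤ D * (2 * (n + L)) :=
      Nat.mul_le_mul_left _ (by omega)
    nlinarith
  · have hst : ∀ j : Fin n → Bool, (Sum.elim j fun _ => false :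
        Fin n ⊕ Option (Fin L ⊕ (Fin L ⊕ Unit)) → Bool) ∘ e
        = fun o => o.elim false (gridState j fun _ => false) := by
      intro j
      funext o
      rcases o with _ | l | k | k | k <;> rfl
    rw [Circuit.matrix_mapWires, lift_equiv, hst, hst]
    obtain ⟨b, hb⟩ := hc (Pi.single (gridState j fun _ => false) 1)
    have hv := grid_walk ht hu hr hsum hn j (C₀ := C₀) rfl
      (v := Pi.single (gridState j fun _ => false) 1) rfl
    rw [chebLift_mulVec hp _ hv, Matrix.mulVec_smul, Matrix.mulVec_mulVec] at hb
    have hpow : C' ^ D * C₀ ^ D = 1 := by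
      have hcomm : C₀ * C' = 1 := mul_eq_one_comm.1 hinv
      rw [← (show Commute C' C₀ from hinv.trans hcomm.symm).mul_pow, hinv, one_pow]
    rw [hpow, Matrix.one_mulVec] at hb
    have h0 : pairVec (Pi.single (gridState j fun _ => false) 1) 0
        = Pi.single (fun o : Option (GridWires n L) => o.elim false (gridState j fun _ => false))
          (1 : ℂ) := by
      funext x
      unfold pairVec
      by_cases hx : x = fun o => o.elim false (gridState j fun _ => false)
      · subst hx
        rw [Pi.single_eq_same]
        exact Pi.single_eq_same (M := fun _ => ℂ) _ _
      · rw [Pi.single_eq_of_ne hx]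
        cases hxn : x none
        · simp only [Bool.false_eq_true, if_false]
          apply Pi.single_eq_of_ne
          intro hcon
          apply hx
          funext o
          cases o
          · exact hxn
          · exact congrFun hcon _
        · simp
    rw [h0, Matrix.mulVec_single_one] at hb
    have h1 := congrFun hb fun o => o.elim false (gridState i fun _ => false)
    rw [Matrix.col_apply] at h1
    rw [h1, pairVec_elim, Matrix.diagonal_apply]
    simp only [Bool.false_eq_true, if_false, Pi.smul_apply, smul_eq_mul]
    by_cases hij : i = j
    · subst hij; simp
    · rw [if_neg hij, Pi.single_eq_of_ne (fun h => hij (gridState_inj.1 h).1), mul_zero]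

end Grid

end

section

open Matrix Polynomial ComplexConjugate

/-! ### Sums of monomials -/

/-- Beyond the threshold the stated bounds dominate the constants of the walk; up to it, a number of
ancillas exponential in `n` counts as a constant. -/
theorem exists_large_lg_lg : ∃ N : ℕ, ∀ n : ℕ, N < n → 5 ≤ lg (lg n) ∧ 32 ≤ n := by
  refine ⟨2 ^ 32, fun n hn => ?_⟩
  have hn' : (2 : ℝ) ^ 32 ≤ n := by exact_mod_cast hn.le
  have h1 : (32 : ℝ) ≤ lg n := by
    have := div_le_lg (x := n) (p := 32) (q := 1) (by norm_num) (by rw [pow_one]; exact hn')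
    simpa using this
  have h2 : (5 : ℝ) ≤ lg 32 := by
    have := div_le_lg (x := 32) (p := 5) (q := 1) (by norm_num) (by norm_num)
    simpa using this
  refine ⟨h2.trans (lg_mono (by norm_num) h1), ?_⟩
  omega

theorem natLog_le_lg (n : ℕ) : ((Nat.log 2 n : ℕ) : ℝ) ≤ lg n := by
  have := Real.natLog_le_logb n 2
  exact_mod_cast this

/-- Block-encodings of the bounded polynomials of the grid points. -/
theorem exists_polynomial_blockEncoding : ∃ K : ℕ, ∀ (n D : ℕ), 2 ≤ n →
    ∀ p : ℂ[X], p.natDegree ≤ D → (∀ s ∈ Set.Icc (0 : ℝ) 1, ‖p.eval (s : ℂ)‖ ≤ 1) →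
    ∀ (α : ℝ), 0 < α → ∀ f : (Fin n → Bool) → ℂ, (∀ b, f b / α = p.eval (gridPoint b : ℂ)) →
    ∃ (a : ℕ) (c : Circuit (Fin n ⊕ Fin a)), IsBlockEncoding α c.matrix (Matrix.diagonal f) ∧
      (a : ℝ) ≤ K * lg n ∧ ((c.rotDepth ≤ 1 ∧ c.tofDepth = 0) ∨
        (5 ≤ lg (lg n) ∧ 32 ≤ n ∧ c.rotDepth ≤ 10 * D + 2 ∧ c.tofDepth ≤ 18 * D * n)) := by
  obtain ⟨N, hN⟩ := exists_large_lg_lg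
  -- `1 + 2 ^ (N + 1)` covers the branch and parity wires when `n ≤ N`, and `6` covers the `2 L + 2
  -- ≤ 4 lg n + 2` wires of the walk.
  refine ⟨1 + 2 ^ (N + 1) + 6, fun n D hn p hp hp1 α hα f hf => ?_⟩
  have hlg : 1 ≤ lg n := one_le_lg (by exact_mod_cast hn)
  have hdiag : ∀ i j : Fin n → Bool, Matrix.diagonal (fun b => p.eval (gridPoint b : ℂ)) i j
      = Matrix.diagonal f i j / (α : ℂ) := by
    intro i j
    rw [Matrix.diagonal_apply, Matrix.diagonal_apply]
    split_ifs
    · exact (hf i).symm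
    · rw [zero_div]
  rcases Nat.lt_or_ge N n with h | h
  · obtain ⟨h5, h32⟩ := hN n h
    obtain ⟨L, hL, hs⟩ := exists_hasSelector n (by omega)
    obtain ⟨c, hr, ht, hc⟩ := exists_polynomial_circuit (by omega) hs hp hp1
    obtain ⟨c', hc', -, hr', ht'⟩ := exists_blockEncoding c hα (A := Matrix.diagonal f)
      fun i j => (hc i j).trans (hdiag i j)
    refine ⟨_, c', hc', ?_, Or.inr ⟨h5, h32, hr'.trans_le hr, ht'.trans_le (ht.trans ?_)⟩⟩
    · have h1 : Fintype.card (Option (Fin L ⊕ (Fin L ⊕ Unit))) = 2 * L + 2 := by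
        simp only [Fintype.card_option, Fintype.card_sum, Fintype.card_fin, Fintype.card_unit]
        ring
      have h2 := natLog_le_lg n
      have h3 : (L : ℝ) ≤ 2 * (Nat.log 2 n : ℕ) := by exact_mod_cast hL
      have h4 : (0 : ℝ) ≤ (1 + 2 ^ (N + 1)) * lg n := by positivity
      rw [h1]
      push_cast
      rw [add_mul]
      linarith
    · have h1 : Nat.log 2 n ≤ n := Nat.log_le_self 2 n
      have h2 : 6 * D * (n + L) ≤ 6 * D * (3 * n) := Nat.mul_le_mul_left _ (by omega)
      calc 6 * D * (n + L) ≤ 6 * D * (3 * n) := h2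
        _ = 18 * D * n := by ring
  · have hpt : ∀ b : Fin n → Bool, gridPoint b ∈ Set.Icc (0 : ℝ) 1 := by
      intro b
      have h1 := symPoint_eq (by omega) b
      have h2 := two_pow_sub_one_pos (n := n) (by omega)
      have h3 : ∑ l : Fin n, (2 : ℝ) ^ (l : ℕ) = 2 ^ n - 1 := by
        rw [Fin.sum_univ_eq_sum_range (fun i => (2 : ℝ) ^ i) n, geom_sum_eq (by norm_num)]
        norm_num
      constructor
      · apply div_nonneg _ h2.le
        apply Finset.sum_nonneg
        intro l _
        split_ifs <;> positivity
      · rw [gridPoint, div_le_one h2, ← h3]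
        apply Finset.sum_le_sum
        intro l _
        split_ifs
        · exact le_rfl
        · positivity
    obtain ⟨c, hr, ht, hc⟩ := exists_diagonal_circuit (fun b : Fin n → Bool =>
      p.eval (gridPoint b : ℂ)) fun b => hp1 _ (hpt b)
    obtain ⟨c', hc', -, hr', ht'⟩ := exists_blockEncoding c hα (A := Matrix.diagonal f)
      fun i j => (hc i j).trans (hdiag i j)
    refine ⟨_, c', hc', ?_, Or.inl ⟨hr'.trans_le hr, ht'.trans ht⟩⟩
    have h1 : Fintype.card (Unit ⊕ Finset (Fin n ⊕ Unit)) = 1 + 2 ^ (n + 1) := by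
      simp only [Fintype.card_sum, Fintype.card_fin, Fintype.card_unit, Fintype.card_finset]
    have h2 : 1 + 2 ^ (n + 1) ≤ 1 + 2 ^ (N + 1) + 6 := by
      have := Nat.pow_le_pow_right (n := 2) (by norm_num) (show n + 1 ≤ N + 1 by omega)
      omega
    rw [h1]
    have h3 : ((1 + 2 ^ (n + 1) : ℕ) : ℝ) ≤ ((1 + 2 ^ (N + 1) + 6 : ℕ) : ℝ) := by
      exact_mod_cast h2
    exact h3.trans (le_mul_of_one_le_right (Nat.cast_nonneg _) hlg)

/-- With one of the `S - 1` blocks expanded, the terms `-4 lg (lg n)` and `2 n` cancel and the signs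
become visible. -/
theorem monomialTof_eq (S n : ℕ) : monomialTof S n
    = 2 * ((S : ℝ) - 2) * ((n : ℝ) + 1) * (2 * lg (lg n) - 1) + 4 * lg (lg n) * n - 4 := by
  rw [monomialTof]; ring

theorem monomialTof_nonneg {S n : ℕ} (hn : 3 ≤ n) (hS : 2 ≤ S) : 0 ≤ monomialTof S n := by
  have h1 := half_le_lg_lg (x := n) (by exact_mod_cast hn)
  have h2 : (3 : ℝ) ≤ n := by exact_mod_cast hn
  have h3 : (2 : ℝ) ≤ S := by exact_mod_cast hS
  have h4 : 0 ≤ 2 * ((S : ℝ) - 2) * ((n : ℝ) + 1) * (2 * lg (lg n) - 1) :=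
    mul_nonneg (mul_nonneg (by linarith) (by linarith)) (by linarith)
  rw [monomialTof_eq]
  nlinarith

/-- Here `2 lg (lg n) - 1 ≥ 9` yields `18 (S - 2) (n + 1)`, and the remainder is at least `20 n - 4
≥ 18 n`. -/
theorem le_monomialTof {S n : ℕ} (hn : 3 ≤ n) (hS : 2 ≤ S) (h5 : 5 ≤ lg (lg n)) :
    18 * ((S : ℝ) - 1) * n ≤ monomialTof S n := by
  have h2 : (3 : ℝ) ≤ n := by exact_mod_cast hn
  have h3 : (2 : ℝ) ≤ S := by exact_mod_cast hS
  have h4 : 2 * ((S : ℝ) - 2) * ((n : ℝ) + 1) * 9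
      ≤ 2 * ((S : ℝ) - 2) * ((n : ℝ) + 1) * (2 * lg (lg n) - 1) :=
    mul_le_mul_of_nonneg_left (by linarith) (mul_nonneg (by linarith) (by linarith))
  have h6 : 4 * 5 * (n : ℝ) ≤ 4 * lg (lg n) * n := by nlinarith
  rw [monomialTof_eq]
  nlinarith

/-- The difference is `4 lg (lg (S n)) - 2`. -/
theorem monomialTof_le_composed {S n : ℕ} (hn : 3 ≤ n) (hS : 2 ≤ S) :
    monomialTof S n ≤ composedMonomialTof S n := by
  have h1 : (3 : ℝ) ≤ n := by exact_mod_cast hn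
  have h2 : (2 : ℝ) ≤ S := by exact_mod_cast hS
  have h3 := half_le_lg_lg (x := S * n) (by nlinarith)
  rw [monomialTof, composedMonomialTof]
  linarith

theorem monomialSum_eq {n S : ℕ} (y : Fin S → ℂ) (α : ℝ) (b : Fin n → Bool) :
    monomialSum y b / α = (polyOf fun k => y k / α).eval (gridPoint b : ℂ) := by
  rw [monomialSum, eval_polyOf, Finset.sum_div]
  apply Finset.sum_congr rfl
  intro k _
  ring

theorem norm_ofReal_le_one {s : ℝ} (hs : s ∈ Set.Icc (0 : ℝ) 1) : ‖(s : ℂ)‖ ≤ 1 := by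
  rw [Complex.norm_real, Real.norm_of_nonneg hs.1]
  exact hs.2

theorem exists_monomial_blockEncoding {K : ℕ} {n S : ℕ} (hn : 3 ≤ n) (hS : 2 ≤ S)
    (y : Fin S → ℂ) {α : ℝ} (hα : 0 < α) (hy : ∑ k, ‖y k‖ ≤ α)
    (hK : ∀ p : ℂ[X], p.natDegree ≤ S - 1 → (∀ s ∈ Set.Icc (0 : ℝ) 1, ‖p.eval (s : ℂ)‖ ≤ 1) →
      ∀ (α : ℝ), 0 < α → ∀ f : (Fin n → Bool) → ℂ, (∀ b, f b / α = p.eval (gridPoint b : ℂ)) →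
      ∃ (a : ℕ) (c : Circuit (Fin n ⊕ Fin a)), IsBlockEncoding α c.matrix (Matrix.diagonal f) ∧
        (a : ℝ) ≤ K * lg n ∧ ((c.rotDepth ≤ 1 ∧ c.tofDepth = 0) ∨
          (5 ≤ lg (lg n) ∧ 32 ≤ n ∧ c.rotDepth ≤ 10 * (S - 1) + 2 ∧
            c.tofDepth ≤ 18 * (S - 1) * n))) :
    ∃ (a : ℕ) (c : Circuit (Fin n ⊕ Fin a)),
      IsBlockEncoding α c.matrix (Matrix.diagonal (monomialSum y)) ∧
      (a : ℝ) ≤ K * lg n ∧ (c.rotDepth : ℝ) ≤ monomialRot S n ∧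
      (c.tofDepth : ℝ) ≤ monomialTof S n := by
  obtain ⟨a, c, hc, ha, h⟩ := hK (polyOf fun k => y k / α) (natDegree_polyOf_le _)
    (fun s hs => norm_eval_polyOf_le hα hy (norm_ofReal_le_one hs)) α hα (monomialSum y)
    (monomialSum_eq y α)
  refine ⟨a, c, hc, ha, ?_⟩
  have h1 : (3 : ℝ) ≤ n := by exact_mod_cast hn
  have h2 : (2 : ℝ) ≤ S := by exact_mod_cast hS
  rw [monomialRot]
  rcases h with ⟨hr, ht⟩ | ⟨h5, h32, hr, ht⟩
  · have hr' : (c.rotDepth : ℝ) ≤ 1 := by exact_mod_cast hr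
    refine ⟨by nlinarith, ?_⟩
    rw [ht, Nat.cast_zero]
    exact monomialTof_nonneg hn hS
  · have hr' : (c.rotDepth : ℝ) ≤ 10 * ((S - 1 : ℕ) : ℝ) + 2 := by exact_mod_cast hr
    have ht' : (c.tofDepth : ℝ) ≤ 18 * ((S - 1 : ℕ) : ℝ) * n := by exact_mod_cast ht
    have h32' : (32 : ℝ) ≤ n := by exact_mod_cast h32
    rw [Nat.cast_sub (by omega), Nat.cast_one] at hr' ht'
    exact ⟨by nlinarith, ht'.trans (le_monomialTof hn hS h5)⟩

theorem exists_composed_monomial_blockEncoding {K : ℕ} {n S d : ℕ} (hn : 3 ≤ n) (hS : 2 ≤ S)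
    (y : Fin S → ℂ) {α : ℝ} (hα : 0 < α) (hy : ∑ k, ‖y k‖ ≤ α) (g : (Fin n → Bool) → ℝ)
    (hg : ∀ b, monomialSum y b = (g b : ℂ)) (P : ℝ[X]) (hd1 : 1 ≤ d) (hd : P.natDegree = d)
    (hP : ∀ x ∈ Set.Icc (-1 : ℝ) 1, |P.eval x| ≤ 1) {γ : ℝ} (hγ : 1 ≤ γ)
    (hK : ∀ p : ℂ[X], p.natDegree ≤ d * (S - 1) →
      (∀ s ∈ Set.Icc (0 : ℝ) 1, ‖p.eval (s : ℂ)‖ ≤ 1) →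
      ∀ (α : ℝ), 0 < α → ∀ f : (Fin n → Bool) → ℂ, (∀ b, f b / α = p.eval (gridPoint b : ℂ)) →
      ∃ (a : ℕ) (c : Circuit (Fin n ⊕ Fin a)), IsBlockEncoding α c.matrix (Matrix.diagonal f) ∧
        (a : ℝ) ≤ K * lg n ∧ ((c.rotDepth ≤ 1 ∧ c.tofDepth = 0) ∨
          (5 ≤ lg (lg n) ∧ 32 ≤ n ∧ c.rotDepth ≤ 10 * (d * (S - 1)) + 2 ∧
            c.tofDepth ≤ 18 * (d * (S - 1)) * n))) :
    ∃ (a : ℕ) (c : Circuit (Fin n ⊕ Fin a)),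
      IsBlockEncoding γ c.matrix (composedDiag P g α) ∧
      (a : ℝ) ≤ K * lg n ∧ (c.rotDepth : ℝ) ≤ composedMonomialRot S n * d ∧
      (c.tofDepth : ℝ) ≤ composedMonomialTof S n * d := by
  -- The sum is known to be real only on the grid. Taking real parts of the coefficients does not
  -- change the grid values, preserves the norm bound, and gives a polynomial with values in `[-1,
  -- 1]` on all of `[0, 1]`, where `P` is bounded.
  set y' : Fin S → ℂ := fun k => ((y k).re : ℂ) with hy'
  have hy1 : ∑ k, ‖y' k‖ ≤ α := by
    refine (Finset.sum_le_sum fun k _ => ?_).trans hy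
    rw [hy', Complex.norm_real]
    exact Complex.abs_re_le_norm _
  set q := polyOf fun k => y' k / α with hq
  let r : ℝ → ℝ := fun s => ∑ k : Fin S, (y k).re / α * s ^ (k : ℕ)
  have hr : ∀ s : ℝ, q.eval (s : ℂ) = (r s : ℂ) := by
    intro s
    rw [hq, eval_polyOf, Complex.ofReal_sum]
    apply Finset.sum_congr rfl
    intro k _
    push_cast
    rfl
  have hr1 : ∀ s ∈ Set.Icc (0 : ℝ) 1, r s ∈ Set.Icc (-1 : ℝ) 1 := by
    intro s hs
    have h1 := norm_eval_polyOf_le hα hy1 (norm_ofReal_le_one hs)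
    rw [← hq, hr, Complex.norm_real, Real.norm_eq_abs, abs_le] at h1
    exact h1
  have hev : ∀ s : ℝ, (C ((γ⁻¹ : ℝ) : ℂ) * (P.map (algebraMap ℝ ℂ)).comp q).eval (s : ℂ)
      = ((P.eval (r s) / γ : ℝ) : ℂ) := by
    intro s
    rw [eval_mul, eval_C, eval_comp, hr, eval_map, ← Complex.coe_algebraMap, eval₂_at_apply,
      ← map_mul, div_eq_inv_mul]
  have hγ0 : 0 < γ := by linarith
  have hgr : ∀ b, g b / α = r (gridPoint b) := by
    intro b
    have h1 := congrArg Complex.re (hg b)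
    rw [Complex.ofReal_re] at h1
    rw [← h1, monomialSum, Complex.re_sum, Finset.sum_div]
    apply Finset.sum_congr rfl
    intro k _
    rw [← Complex.ofReal_pow, Complex.re_mul_ofReal]
    ring
  obtain ⟨a, c, hc, ha, h⟩ := hK (C ((γ⁻¹ : ℝ) : ℂ) * (P.map (algebraMap ℝ ℂ)).comp q) (by
      refine (natDegree_C_mul_le _ _).trans (natDegree_comp_le.trans ?_)
      refine Nat.mul_le_mul ?_ (natDegree_polyOf_le _)
      exact natDegree_map_le.trans hd.le) (fun s hs => by
      rw [hev, Complex.norm_real, Real.norm_eq_abs, abs_div, abs_of_pos hγ0, div_le_one hγ0]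
      exact (hP _ (hr1 s hs)).trans hγ) γ hγ0 (fun b => ((P.eval (g b / α) : ℝ) : ℂ)) (fun b => by
      rw [hev, hgr]
      push_cast
      rfl)
  refine ⟨a, c, hc, ha, ?_⟩
  have h1 : (3 : ℝ) ≤ n := by exact_mod_cast hn
  have h2 : (2 : ℝ) ≤ S := by exact_mod_cast hS
  have h3 : (1 : ℝ) ≤ d := by exact_mod_cast hd1
  have h4 := monomialTof_le_composed hn hS
  have h6 : monomialTof S n * d ≤ composedMonomialTof S n * d :=
    mul_le_mul_of_nonneg_right h4 (by linarith)
  rw [composedMonomialRot]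
  rcases h with ⟨hr, ht⟩ | ⟨h5, h32, hr, ht⟩
  · have hr' : (c.rotDepth : ℝ) ≤ 1 := by exact_mod_cast hr
    have h7 : (1 : ℝ) ≤ 2 * ((S : ℝ) - 1) * (n + 1) - 1 := by nlinarith
    refine ⟨by nlinarith, ?_⟩
    rw [ht, Nat.cast_zero]
    exact (mul_nonneg (monomialTof_nonneg hn hS) (by linarith)).trans h6
  · have hr' : (c.rotDepth : ℝ) ≤ 10 * (d * ((S - 1 : ℕ) : ℝ)) + 2 := by exact_mod_cast hr
    have ht' : (c.tofDepth : ℝ) ≤ 18 * (d * ((S - 1 : ℕ) : ℝ)) * n := by exact_mod_cast ht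
    have h32' : (32 : ℝ) ≤ n := by exact_mod_cast h32
    rw [Nat.cast_sub (by omega), Nat.cast_one] at hr' ht'
    refine ⟨?_, ?_⟩
    · have h7 : 10 * ((S : ℝ) - 1) + 2 ≤ 2 * ((S : ℝ) - 1) * (n + 1) - 1 := by nlinarith
      have h8 := mul_le_mul_of_nonneg_right h7 (show (0 : ℝ) ≤ d by linarith)
      nlinarith
    · have h8 := mul_le_mul_of_nonneg_right (le_monomialTof hn hS h5)
        (show (0 : ℝ) ≤ d by linarith)
      calc (c.tofDepth : ℝ) ≤ 18 * (d * ((S : ℝ) - 1)) * n := ht'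
        _ = 18 * ((S : ℝ) - 1) * n * d := by ring
        _ ≤ monomialTof S n * d := h8
        _ ≤ _ := h6

end

section

open Matrix

/-! ### Gates on disjoint wires commute -/

section Commute

variable {W : Type} [Fintype W] [DecidableEq W]

/-- The one intermediate state that contributes has the values of `y` on the range of `f` and those
of `x` elsewhere. The resulting formula is symmetric in the two factors, which gives commutation. -/
theorem lift_mul_lift_apply {A B : Type} [Fintype A] [DecidableEq A] [Fintype B] [DecidableEq B]
    (f : A ↪ W) (g : B ↪ W) (hfg : ∀ a b, f a ≠ g b) (M : Matrix (A → Bool) (A → Bool) ℂ)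
    (N : Matrix (B → Bool) (B → Bool) ℂ) (x y : W → Bool) :
    (lift f M * lift g N) x y
      = if ∀ w, w ∉ Set.range f → w ∉ Set.range g → x w = y w then
          M (x ∘ f) (y ∘ f) * N (x ∘ g) (y ∘ g) else 0 := by
  have hf : ∀ a, f a ∉ Set.range g := by
    rintro a ⟨b, hb⟩
    exact hfg a b hb.symm
  have hg : ∀ b, g b ∉ Set.range f := by
    rintro b ⟨a, ha⟩
    exact hfg a b ha
  rw [Matrix.mul_apply, Finset.sum_eq_single (Function.extend f (y ∘ f) x)]
  · have h1 : Function.extend f (y ∘ f) x ∘ f = y ∘ f := extend_comp_embedding f _ _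
    have h2 : ∀ w, w ∉ Set.range f → Function.extend f (y ∘ f) x w = x w :=
      fun w hw => Function.extend_apply' _ _ _ hw
    have h3 : Function.extend f (y ∘ f) x ∘ g = x ∘ g := funext fun b => h2 _ (hg b)
    have h4 : (∀ w, w ∉ Set.range g → Function.extend f (y ∘ f) x w = y w) ↔
        ∀ w, w ∉ Set.range f → w ∉ Set.range g → x w = y w := by
      constructor
      · intro h w hw hw'
        rw [← h2 w hw, h w hw']
      · intro h w hw
        by_cases hwf : w ∈ Set.range f
        · obtain ⟨a, rfl⟩ := hwf
          exact congrFun h1 a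
        · rw [h2 w hwf, h w hwf hw]
    simp only [lift, Matrix.of_apply, h1, h3, h4]
    rw [if_pos fun w hw => (h2 w hw).symm, mul_ite, mul_zero]
  · intro z _ hz
    simp only [lift, Matrix.of_apply]
    split_ifs with h1 h2
    · exfalso
      apply hz
      rw [extend_eq_iff]
      exact ⟨funext fun a => h2 _ (hf a), fun w hw => (h1 w hw).symm⟩
    all_goals simp
  · simp

theorem lift_commute {A B : Type} [Fintype A] [DecidableEq A] [Fintype B] [DecidableEq B]
    (f : A ↪ W) (g : B ↪ W) (hfg : ∀ a b, f a ≠ g b) (M : Matrix (A → Bool) (A → Bool) ℂ)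
    (N : Matrix (B → Bool) (B → Bool) ℂ) : Commute (lift f M) (lift g N) := by
  ext x y
  rw [lift_mul_lift_apply f g hfg, lift_mul_lift_apply g f fun b a => (hfg a b).symm, mul_comm]
  congr 1
  apply propext
  exact ⟨fun h w h1 h2 => h w h2 h1, fun h w h1 h2 => h w h2 h1⟩

theorem Gate.exists_lift (g : Gate W) : ∃ N : Matrix (g.support → Bool) (g.support → Bool) ℂ,
    g.matrix = lift (Function.Embedding.subtype fun w => w ∈ g.support) N := by
  cases g with
  | hadamard q =>
    have hq : q ∈ (Gate.hadamard q).support := by simp [Gate.support]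
    exact ⟨_, (lift_onQubit (Function.Embedding.subtype _) ⟨q, hq⟩ hadamardMatrix).symm⟩
  | phase q =>
    have hq : q ∈ (Gate.phase q).support := by simp [Gate.support]
    exact ⟨_, (lift_onQubit (Function.Embedding.subtype _) ⟨q, hq⟩ phaseMatrix).symm⟩
  | rotation p θ q =>
    have hq : q ∈ (Gate.rotation p θ q).support := by simp [Gate.support]
    exact ⟨_, (lift_onQubit (Function.Embedding.subtype _) ⟨q, hq⟩ (rotMatrix p θ)).symm⟩
  | toffoli c₁ c₂ t h₁₂ h₁ h₂ =>
    have m₁ : c₁ ∈ (Gate.toffoli c₁ c₂ t h₁₂ h₁ h₂).support := by simp [Gate.support]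
    have m₂ : c₂ ∈ (Gate.toffoli c₁ c₂ t h₁₂ h₁ h₂).support := by simp [Gate.support]
    have m₃ : t ∈ (Gate.toffoli c₁ c₂ t h₁₂ h₁ h₂).support := by simp [Gate.support]
    refine ⟨(Gate.toffoli ⟨c₁, m₁⟩ ⟨c₂, m₂⟩ ⟨t, m₃⟩ (fun h => h₁₂ (congrArg Subtype.val h))
      (fun h => h₁ (congrArg Subtype.val h)) (fun h => h₂ (congrArg Subtype.val h))).matrix, ?_⟩
    rw [← Gate.matrix_mapWires]
    rfl
  | fanout c T hc =>
    refine ⟨(Gate.fanout ⟨c, by simp [Gate.support]⟩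
      (Finset.univ.filter fun w => w.1 ∈ T) (by simpa using hc)).matrix, ?_⟩
    rw [← Gate.matrix_mapWires]
    simp only [Gate.mapWires, matrix_fanout]
    congr 2
    ext w
    simp only [Finset.mem_map, Finset.mem_filter, Finset.mem_univ, true_and,
      Function.Embedding.subtype_apply]
    constructor
    · intro hw
      exact ⟨⟨w, by simp [Gate.support, hw]⟩, hw, rfl⟩
    · rintro ⟨v, hv, rfl⟩
      exact hv

theorem Gate.matrix_commute {g h : Gate W} (hgh : Disjoint g.support h.support) :
    Commute g.matrix h.matrix := by
  obtain ⟨M, hM⟩ := g.exists_lift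
  obtain ⟨N, hN⟩ := h.exists_lift
  rw [hM, hN]
  apply lift_commute
  rintro ⟨a, ha⟩ ⟨b, hb⟩ hab
  rw [Function.Embedding.subtype_apply, Function.Embedding.subtype_apply] at hab
  subst hab
  exact Finset.disjoint_left.1 hgh ha hb

/-- The phases of `Z`-rotations of all wires. -/
def zDiag (Θ : W → ℝ) (x : W → Bool) : ℂ := ∏ w, zPhase (Θ w) (x w)

theorem tens_rotMatrix_Z (Θ : W → ℝ) :
    tens (fun w => rotMatrix .Z (Θ w)) = Matrix.diagonal (zDiag Θ) := by
  simp only [rotMatrix_Z_eq]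
  exact tens_diagonal fun w => zPhase (Θ w)

theorem zPhase_zero (b : Bool) : zPhase 0 b = 1 := by simp [zPhase]

theorem zDiag_zero (x : W → Bool) : zDiag (fun _ => 0) x = 1 := by
  simp [zDiag, zPhase_zero]

theorem zDiag_add (Θ Θ' : W → ℝ) (x : W → Bool) :
    zDiag (fun w => Θ w + Θ' w) x = zDiag Θ x * zDiag Θ' x := by
  simp only [zDiag, zPhase_add, Finset.prod_mul_distrib]

theorem zDiag_single (q : W) (θ : ℝ) (x : W → Bool) :
    zDiag (Pi.single q θ) x = zPhase θ (x q) := by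
  rw [zDiag, Finset.prod_eq_single q]
  · rw [Pi.single_eq_same]
  · intro w _ hw
    rw [Pi.single_eq_of_ne hw, zPhase_zero]
  · simp

/-- Off its support the gate preserves the digits, and on its support the phases are trivial. -/
theorem Gate.commute_zDiag {g : Gate W} {Θ : W → ℝ} (h : ∀ w ∈ g.support, Θ w = 0) :
    Commute (Matrix.diagonal (zDiag Θ)) g.matrix := by
  obtain ⟨N, hN⟩ := g.exists_lift
  ext x y
  rw [Matrix.diagonal_mul, Matrix.mul_diagonal, hN]
  simp only [lift, Matrix.of_apply]
  split_ifs with h1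
  · rw [mul_comm]
    congr 1
    apply Finset.prod_congr rfl
    intro w _
    by_cases hw : w ∈ g.support
    · rw [h w hw, zPhase_zero, zPhase_zero]
    · rw [h1 w (by simpa using hw)]
  · rw [mul_zero, zero_mul]

end Commute

/-! ### Operators controlled by a register -/

section Fiber

variable {X B : Type} [Fintype X] [DecidableEq X] [Fintype B] [DecidableEq B]

/-- The operator that acts on the wires `X` by `N b`, where `b` are the values of the wires `B`. -/
def fib (N : (B → Bool) → Matrix (X → Bool) (X → Bool) ℂ) :
    Matrix (X ⊕ B → Bool) (X ⊕ B → Bool) ℂ :=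
  Matrix.of fun x y => if x ∘ Sum.inr = y ∘ Sum.inr then
    N (y ∘ Sum.inr) (x ∘ Sum.inl) (y ∘ Sum.inl) else 0

theorem sum_sum_bool {M : Type} [AddCommMonoid M] (f : (X ⊕ B → Bool) → M) :
    ∑ z, f z = ∑ b : B → Bool, ∑ u : X → Bool, f (Sum.elim u b) := by
  rw [← (Equiv.sumArrowEquivProdArrow X B Bool).symm.sum_comp, Fintype.sum_prod_type_right]
  rfl

theorem elim_comp_inl_inr (x : X ⊕ B → Bool) : Sum.elim (x ∘ Sum.inl) (x ∘ Sum.inr) = x :=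
  Sum.elim_comp_inl_inr x

theorem fib_mul (M N : (B → Bool) → Matrix (X → Bool) (X → Bool) ℂ) :
    fib M * fib N = fib fun b => M b * N b := by
  ext x y
  rw [Matrix.mul_apply, sum_sum_bool, Finset.sum_eq_single (x ∘ Sum.inr)]
  · simp only [fib, Matrix.of_apply, Sum.elim_comp_inr, Sum.elim_comp_inl, if_true]
    split_ifs with h
    · rw [h, Matrix.mul_apply]
      simp only [if_true]
    · exact Finset.sum_eq_zero fun u _ => mul_eq_zero_of_right _ (if_neg h)
  · intro b _ hb
    apply Finset.sum_eq_zero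
    intro u _
    simp [fib, hb.symm]
  · simp

theorem fib_one : fib (fun _ : B → Bool => (1 : Matrix (X → Bool) (X → Bool) ℂ)) = 1 := by
  ext x y
  simp only [fib, Matrix.of_apply, Matrix.one_apply, ← ite_and]
  congr 1
  apply propext
  constructor
  · rintro ⟨h1, h2⟩
    rw [← elim_comp_inl_inr x, ← elim_comp_inl_inr y, h1, h2]
  · rintro rfl
    exact ⟨rfl, rfl⟩

theorem lift_inl (M : Matrix (X → Bool) (X → Bool) ℂ) :
    lift (⟨Sum.inl, Sum.inl_injective⟩ : X ↪ X ⊕ B) M = fib fun _ => M := by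
  ext x y
  simp only [lift, fib, Matrix.of_apply]
  congr 1
  apply propext
  constructor
  · intro h
    funext b
    exact h _ (by simp)
  · rintro h (v | v) hv
    · exact absurd ⟨v, rfl⟩ hv
    · exact congrFun h v

theorem lift_inr_apply (Q : Matrix (B → Bool) (B → Bool) ℂ) (x y : X ⊕ B → Bool) :
    lift (⟨Sum.inr, Sum.inr_injective⟩ : B ↪ X ⊕ B) Q x y
      = if x ∘ Sum.inl = y ∘ Sum.inl then Q (x ∘ Sum.inr) (y ∘ Sum.inr) else 0 := by
  simp only [lift, Matrix.of_apply]
  congr 1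
  apply propext
  constructor
  · intro h
    funext b
    exact h _ (by simp)
  · rintro h (v | v) hv
    · exact congrFun h v
    · exact absurd ⟨v, rfl⟩ hv

theorem lift_mul_fib_mul_lift_apply (Q Q' : Matrix (B → Bool) (B → Bool) ℂ)
    (N : (B → Bool) → Matrix (X → Bool) (X → Bool) ℂ) (x y : X ⊕ B → Bool) :
    (lift (⟨Sum.inr, Sum.inr_injective⟩ : B ↪ X ⊕ B) Q' * fib N
        * lift (⟨Sum.inr, Sum.inr_injective⟩ : B ↪ X ⊕ B) Q) x y
      = ∑ b, Q' (x ∘ Sum.inr) b * N b (x ∘ Sum.inl) (y ∘ Sum.inl) * Q b (y ∘ Sum.inr) := by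
  have h1 : ∀ b u, (lift (⟨Sum.inr, Sum.inr_injective⟩ : B ↪ X ⊕ B) Q' * fib N) x (Sum.elim u b)
      = Q' (x ∘ Sum.inr) b * N b (x ∘ Sum.inl) u := by
    intro b u
    rw [Matrix.mul_apply, sum_sum_bool, Finset.sum_eq_single b,
      Finset.sum_eq_single (x ∘ Sum.inl)]
    · simp [lift_inr_apply, fib]
    · intro v _ hv
      simp [lift_inr_apply, hv.symm]
    · simp
    · intro c _ hc
      apply Finset.sum_eq_zero
      intro v _
      simp [fib, hc]
    · simp
  rw [Matrix.mul_apply, sum_sum_bool]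
  apply Finset.sum_congr rfl
  intro b _
  rw [Finset.sum_eq_single (y ∘ Sum.inl)]
  · rw [h1, lift_inr_apply]
    simp
  · intro v _ hv
    rw [lift_inr_apply, if_neg (by simpa using hv), mul_zero]
  · simp

theorem lift_inr_diagonal (d : (B → Bool) → ℂ) :
    lift (⟨Sum.inr, Sum.inr_injective⟩ : B ↪ X ⊕ B) (Matrix.diagonal d)
      = fib fun b => d b • 1 := by
  ext x y
  rw [lift_inr_apply]
  simp only [fib, Matrix.of_apply, Matrix.smul_apply, Matrix.one_apply, Matrix.diagonal_apply]
  by_cases h1 : x ∘ Sum.inl = y ∘ Sum.inl <;> by_cases h2 : x ∘ Sum.inr = y ∘ Sum.inr <;>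
    simp [h1, h2]

theorem diagonal_eq_fib (d : (X ⊕ B → Bool) → ℂ) :
    Matrix.diagonal d = fib fun b => Matrix.diagonal fun u => d (Sum.elim u b) := by
  ext x y
  simp only [fib, Matrix.of_apply, Matrix.diagonal_apply, ← ite_and]
  have h : x = y ↔ x ∘ Sum.inr = y ∘ Sum.inr ∧ x ∘ Sum.inl = y ∘ Sum.inl := by
    constructor
    · rintro rfl
      exact ⟨rfl, rfl⟩
    · rintro ⟨h1, h2⟩
      rw [← elim_comp_inl_inr x, ← elim_comp_inl_inr y, h1, h2]
  simp only [← h]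
  split_ifs with h1
  · rw [h1, ← (h.1 h1).1, h1, elim_comp_inl_inr]
  · rfl

/-- The wires `X` as a set. -/
def leftWires (X B : Type) [Fintype X] : Finset (X ⊕ B) :=
  Finset.univ.map ⟨Sum.inl, Sum.inl_injective⟩

theorem inr_notMem_leftWires (h : B) : (Sum.inr h : X ⊕ B) ∉ leftWires X B := by
  simp [leftWires]

/-- The rotations by the angles `Θ` of the wires `X`, controlled by the wire `h`. -/
def ctrlRot (h : B) (Θ : X → ℝ) : Circuit (X ⊕ B) :=
  [rotLayer (fun _ => .Z) (Sum.elim (fun w => Θ w / 2) fun _ => 0)] ++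
    (seq [.fanout (.inr h) (leftWires X B) (inr_notMem_leftWires h)] ++
      ([rotLayer (fun _ => .Z) (Sum.elim (fun w => -(Θ w / 2)) fun _ => 0)] ++
        seq [.fanout (.inr h) (leftWires X B) (inr_notMem_leftWires h)]))

/-- A rotation by half the angle meets one by minus half of it inside two fan-outs from `h`: they
cancel if `h` is `0` and add up if it is `1`. One fan-out serves all wires, so the depth does not
depend on their number. -/
theorem matrix_ctrlRot (h : B) (Θ : X → ℝ) :
    (ctrlRot h Θ).matrix = fib fun b => Matrix.diagonal
      (zDiag fun w => (if b h then 1 else 0) * Θ w) := by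
  rw [ctrlRot, Circuit.matrix_append, Circuit.matrix_append, Circuit.matrix_append,
    Circuit.matrix_singleton, Circuit.matrix_singleton, matrix_rotLayer, matrix_rotLayer,
    tens_rotMatrix_Z, tens_rotMatrix_Z, matrix_seq_cons, matrix_seq_nil, Matrix.one_mul,
    matrix_fanout, ofBasisMap_conj_diagonal _ _ (fanMap_fanMap _ _ (inr_notMem_leftWires h)),
    Matrix.diagonal_mul_diagonal, diagonal_eq_fib]
  congr 1
  funext b
  congr 1
  funext u
  simp only [Function.comp_apply, zDiag, Fintype.prod_sum_type, Sum.elim_inl, Sum.elim_inr,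
    zPhase_zero, Finset.prod_const_one, mul_one]
  rw [← Finset.prod_mul_distrib]
  apply Finset.prod_congr rfl
  intro w _
  have hmem : (Sum.inl w : X ⊕ B) ∈ leftWires X B := by simp [leftWires]
  rw [fanMap, if_pos hmem, Sum.elim_inl, Sum.elim_inr]
  cases hb : b h
  · rw [Bool.xor_false, ← zPhase_add, neg_add_cancel]
    simp
  · have h1 : zPhase (-(Θ w / 2)) (u w ^^ true) = zPhase (Θ w / 2) (u w) := by
      cases u w <;> simp [zPhase, neg_div]
    rw [h1, ← zPhase_add]
    simp

end Fiber

end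

section

open Matrix

/-! ### Programs with switchable rotations -/

section Program

variable {X : Type} [Fintype X] [DecidableEq X]

/-- A step of a program: a gate, a `Z`-rotation that can be switched, or nothing. -/
inductive Step (X : Type) : Type
  | gate (g : Gate X)
  | rot (q : X) (θ : ℝ)
  | idle

/-- The wires of a step. -/
def Step.support : Step X → Finset X
  | .gate g => g.support
  | .rot q _ => {q}
  | .idle => ∅

/-- The operator of a step, its switchable rotation being scaled by `σ`. -/
def Step.op (σ : ℝ) : Step X → Matrix (X → Bool) (X → Bool) ℂ
  | .gate g => g.matrix
  | .rot q θ => Matrix.diagonal fun x => zPhase (σ * θ) (x q)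
  | .idle => 1

/-- The operator of a list of steps, the head being applied first. -/
def stepsOp (σ : ℝ) : List (Step X) → Matrix (X → Bool) (X → Bool) ℂ
  | [] => 1
  | s :: l => stepsOp σ l * s.op σ

theorem stepsOp_append (σ : ℝ) (l l' : List (Step X)) :
    stepsOp σ (l ++ l') = stepsOp σ l' * stepsOp σ l := by
  induction l with
  | nil => exact (Matrix.mul_one _).symm
  | cons s l ih => rw [List.cons_append, stepsOp, ih, stepsOp, Matrix.mul_assoc]

/-- At most `L` steps on the wires `A` make up the operators `N`. -/
def HasProgram (A : Finset X) (L : ℕ) (N : ℝ → Matrix (X → Bool) (X → Bool) ℂ) : Prop :=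
  ∃ l : List (Step X), l.length ≤ L ∧ (∀ s ∈ l, s.support ⊆ A) ∧ ∀ σ, stepsOp σ l = N σ

variable {A : Finset X} {L L' : ℕ} {M N : ℝ → Matrix (X → Bool) (X → Bool) ℂ}

theorem HasProgram.mono (h : HasProgram A L N) (hL : L ≤ L') : HasProgram A L' N := by
  obtain ⟨l, h1, h2⟩ := h
  exact ⟨l, h1.trans hL, h2⟩

theorem HasProgram.congr (h : HasProgram A L N) (hN : ∀ σ, N σ = M σ) : HasProgram A L M := by
  obtain ⟨l, h1, h2, h3⟩ := h
  exact ⟨l, h1, h2, fun σ => (h3 σ).trans (hN σ)⟩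

theorem HasProgram.mul (hM : HasProgram A L M) (hN : HasProgram A L' N) :
    HasProgram A (L + L') fun σ => M σ * N σ := by
  obtain ⟨l, h1, h2, h3⟩ := hM
  obtain ⟨l', h1', h2', h3'⟩ := hN
  refine ⟨l' ++ l, by rw [List.length_append]; omega, fun s hs => ?_, fun σ => ?_⟩
  · rcases List.mem_append.1 hs with hs | hs
    · exact h2' s hs
    · exact h2 s hs
  · rw [stepsOp_append, h3, h3']

theorem hasProgram_gate {g : Gate X} (hg : g.support ⊆ A) : HasProgram A 1 fun _ => g.matrix :=
  ⟨[.gate g], le_rfl, by simpa [Step.support] using hg, fun _ => Matrix.one_mul _⟩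

theorem hasProgram_rot {q : X} (hq : q ∈ A) (θ : ℝ) :
    HasProgram A 1 fun σ => Matrix.diagonal fun x => zPhase (σ * θ) (x q) :=
  ⟨[.rot q θ], le_rfl, by simpa [Step.support] using hq, fun _ => Matrix.one_mul _⟩

theorem hasProgram_one : HasProgram A 0 (fun _ => 1) := ⟨[], le_rfl, by simp, fun _ => rfl⟩

theorem HasProgram.conj (h : HasProgram A L N) {g g' : Gate X} (hg : g.support ⊆ A)
    (hg' : g'.support ⊆ A) : HasProgram A (L + 2) fun σ => g.matrix * N σ * g'.matrix :=
  (((hasProgram_gate hg).mul h).mul (hasProgram_gate hg')).mono (by omega)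

theorem HasProgram.diagonal_mul {d e : ℝ → (X → Bool) → ℂ}
    (hd : HasProgram A L fun σ => Matrix.diagonal (d σ))
    (he : HasProgram A L' fun σ => Matrix.diagonal (e σ)) :
    HasProgram A (L + L') fun σ => Matrix.diagonal fun x => d σ x * e σ x :=
  (hd.mul he).congr fun _ => Matrix.diagonal_mul_diagonal _ _

theorem HasProgram.conj_cx {d : ℝ → (X → Bool) → ℂ}
    (hd : HasProgram A L fun σ => Matrix.diagonal (d σ)) {c q : X} (h : c ≠ q) (hc : c ∈ A)
    (hq : q ∈ A) : HasProgram A (L + 2) fun σ => Matrix.diagonal fun x =>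
      d σ (Function.update x q (xor (x q) (x c))) := by
  have hg : c ∉ ({q} : Finset X) := by simpa using h
  have hs : (Gate.fanout c {q} hg).support ⊆ A := by
    simp [Gate.support, Finset.insert_subset_iff, hc, hq]
  refine (hd.conj hs hs).congr fun σ => ?_
  rw [matrix_fanout, ofBasisMap_conj_diagonal _ _ (fanMap_fanMap _ _ hg)]
  congr 1
  funext x
  rw [Function.comp_apply]
  congr 1
  exact basisMap_cx c q hg x

theorem onQubit_hadamard_unit (q : X) :
    onQubit q hadamardMatrix * onQubit q hadamardMatrix = 1 := by
  rw [onQubit_mul, hadamardMatrix_mul_self, onQubit_one]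

/-- A program that makes up `1` if switched off, and `g` up to a phase if switched on. -/
def Gate.HasSwitch (g : Gate X) (L : ℕ) : Prop :=
  ∃ (N : ℝ → Matrix (X → Bool) (X → Bool) ℂ) (u : ℂ), HasProgram g.support L N ∧ ‖u‖ = 1 ∧
    N 0 = 1 ∧ N 1 = u • g.matrix

theorem zPhase_norm (φ : ℝ) (b : Bool) : ‖zPhase φ b‖ = 1 := by
  rw [zPhase, ← mul_neg, ← Complex.ofReal_neg, Complex.norm_exp_I_mul_ofReal]

theorem onQubit_smul (q : X) (c : ℂ) (M : Matrix Bool Bool ℂ) :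
    onQubit q (c • M) = c • onQubit q M := by
  ext x y
  simp [onQubit]

theorem onQubit_rotMatrix_Z (q : X) (θ : ℝ) :
    onQubit q (rotMatrix .Z θ) = Matrix.diagonal fun x => zPhase θ (x q) := by
  rw [rotMatrix_Z_eq, onQubit_diagonal]
  rfl

/-- A one-qubit gate that is, up to a phase, a `Z`-rotation conjugated by rotations. -/
theorem hasProgram_onQubit (q : X) (p : Axis) (φ θ : ℝ) :
    HasProgram {q} 3 fun σ => onQubit q (rotMatrix p φ * rotMatrix .Z (σ * θ) * rotMatrix p (-φ)) := by
  refine ((hasProgram_rot (Finset.mem_singleton_self q) θ).conj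
    (g := .rotation p φ q) (g' := .rotation p (-φ) q) subset_rfl subset_rfl).congr fun σ => ?_
  rw [← onQubit_rotMatrix_Z]
  change onQubit q _ * onQubit q _ * onQubit q _ = _
  rw [onQubit_mul, onQubit_mul]

theorem rotMatrix_conj_zero (p : Axis) (φ : ℝ) :
    rotMatrix p φ * rotMatrix .Z 0 * rotMatrix p (-φ) = 1 := by
  rw [rotMatrix_zero, Matrix.mul_one, rotMatrix_mul, add_neg_cancel, rotMatrix_zero]

/-- A rotation is linear in its Pauli matrix, so it suffices to conjugate that. -/
theorem rotMatrix_conj_of_pauli {p p' : Axis} {φ : ℝ}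
    (h : rotMatrix p φ * pauli .Z * rotMatrix p (-φ) = pauli p') (θ : ℝ) :
    rotMatrix p φ * rotMatrix .Z θ * rotMatrix p (-φ) = rotMatrix p' θ := by
  have h1 := rotMatrix_conj_zero p φ
  rw [rotMatrix_zero, Matrix.mul_one] at h1
  change rotMatrix p φ * ((Real.cos (θ / 2) : ℂ) • (1 : Matrix Bool Bool ℂ)
    - (Complex.I * (Real.sin (θ / 2) : ℂ)) • pauli .Z) * rotMatrix p (-φ)
      = (Real.cos (θ / 2) : ℂ) • (1 : Matrix Bool Bool ℂ)
        - (Complex.I * (Real.sin (θ / 2) : ℂ)) • pauli p'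
  rw [Matrix.mul_sub, Matrix.sub_mul, Matrix.mul_smul, Matrix.mul_smul, Matrix.smul_mul,
    Matrix.smul_mul, Matrix.mul_one, h1, h]

theorem cos_sin_pi_div_two_div_two :
    Real.cos (Real.pi / 2 / 2) = 1 / Real.sqrt 2 ∧ Real.sin (Real.pi / 2 / 2) = 1 / Real.sqrt 2 := by
  rw [div_div, show (2 : ℝ) * 2 = 4 by norm_num, Real.cos_pi_div_four, Real.sin_pi_div_four,
    Real.sqrt_div_self']
  exact ⟨rfl, rfl⟩

theorem rotMatrix_Y_conj_pauli_Z :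
    rotMatrix .Y (Real.pi / 2) * pauli .Z * rotMatrix .Y (-(Real.pi / 2)) = pauli .X := by
  have h := sqrt_two_inv_mul
  obtain ⟨h1, h2⟩ := cos_sin_pi_div_two_div_two
  ext b c
  cases b <;> cases c <;>
    simp only [rotMatrix_Y_apply, pauli, Matrix.mul_apply, Matrix.of_apply, Fintype.sum_bool,
      Bool.false_eq_true, Bool.true_eq_false, if_true, if_false, neg_div, Real.cos_neg,
      Real.sin_neg, h1, h2, Complex.ofReal_neg]
  · ring
  · linear_combination 2 * h
  · linear_combination 2 * h
  · ring

theorem rotMatrix_X_conj_pauli_Z :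
    rotMatrix .X (-(Real.pi / 2)) * pauli .Z * rotMatrix .X (-(-(Real.pi / 2))) = pauli .Y := by
  have h := sqrt_two_inv_mul
  have hI := Complex.I_mul_I
  obtain ⟨h1, h2⟩ := cos_sin_pi_div_two_div_two
  ext b c
  cases b <;> cases c <;>
    simp only [rotMatrix, pauli, Matrix.mul_apply, Matrix.of_apply, Fintype.sum_bool,
      Matrix.sub_apply, Matrix.smul_apply, Matrix.one_apply, smul_eq_mul, neg_neg,
      Bool.false_eq_true, Bool.true_eq_false, if_true, if_false, neg_div, Real.cos_neg,
      Real.sin_neg, h1, h2, Complex.ofReal_neg]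
  · linear_combination ((1 / Real.sqrt 2 : ℝ) : ℂ) ^ 2 * hI
  · linear_combination (-2 * Complex.I) * h
  · linear_combination (2 * Complex.I) * h
  · linear_combination (-((1 / Real.sqrt 2 : ℝ) : ℂ) ^ 2) * hI

theorem rotMatrix_Y_conj_Z_pi :
    rotMatrix .Y (Real.pi / 4) * rotMatrix .Z Real.pi * rotMatrix .Y (-(Real.pi / 4))
      = (-Complex.I) • hadamardMatrix := by
  have h1 : Real.cos (Real.pi / 4 / 2) ^ 2 - Real.sin (Real.pi / 4 / 2) ^ 2 = 1 / Real.sqrt 2 := by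
    rw [← Real.cos_two_mul', ← cos_sin_pi_div_two_div_two.1]
    congr 1; ring
  have h2 : 2 * Real.sin (Real.pi / 4 / 2) * Real.cos (Real.pi / 4 / 2) = 1 / Real.sqrt 2 := by
    rw [← Real.sin_two_mul, ← cos_sin_pi_div_two_div_two.2]
    congr 1; ring
  have h3 := congrArg (fun x : ℝ => (x : ℂ)) h1
  have h4 := congrArg (fun x : ℝ => (x : ℂ)) h2
  simp only [Complex.ofReal_mul, Complex.ofReal_sub, Complex.ofReal_pow, Complex.ofReal_ofNat]
    at h3 h4
  rw [rotMatrix_Y_apply, rotMatrix_Y_apply]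
  ext b c
  cases b <;> cases c <;>
    simp only [hadamardMatrix, rotMatrix, pauli, Matrix.mul_apply,
      Matrix.of_apply, Fintype.sum_bool, Matrix.sub_apply, Matrix.smul_apply, Matrix.one_apply,
      smul_eq_mul, Bool.false_eq_true, Bool.true_eq_false, if_true, if_false, neg_div,
      Real.cos_neg, Real.sin_neg, Complex.ofReal_neg, Real.cos_pi_div_two, Real.sin_pi_div_two,
      Complex.ofReal_zero, Complex.ofReal_one, Bool.and_true, Bool.and_false]
  · linear_combination (-Complex.I) * h3
  · linear_combination (-Complex.I) * h4
  · linear_combination (-Complex.I) * h4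
  · linear_combination Complex.I * h3

theorem hasSwitch_of_conj {g : Gate X} {q : X} (hq : g.support = {q}) {p : Axis} {φ θ : ℝ} {u : ℂ}
    {G : Matrix Bool Bool ℂ} (hg : g.matrix = onQubit q G) (hu : ‖u‖ = 1)
    (h : rotMatrix p φ * rotMatrix .Z θ * rotMatrix p (-φ) = u • G) : g.HasSwitch 3 := by
  refine ⟨_, u, hq ▸ hasProgram_onQubit q p φ θ, hu, ?_, ?_⟩
  · rw [zero_mul, rotMatrix_conj_zero, onQubit_one]
  · rw [one_mul, h, onQubit_smul, hg]

theorem hasSwitch_rotation (p : Axis) (θ : ℝ) (q : X) : (Gate.rotation p θ q).HasSwitch 3 := by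
  cases p with
  | X => exact hasSwitch_of_conj (θ := θ) rfl rfl norm_one ((rotMatrix_conj_of_pauli
      rotMatrix_Y_conj_pauli_Z θ).trans (one_smul _ _).symm)
  | Y => exact hasSwitch_of_conj (θ := θ) rfl rfl norm_one ((rotMatrix_conj_of_pauli
      rotMatrix_X_conj_pauli_Z θ).trans (one_smul _ _).symm)
  | Z =>
    refine hasSwitch_of_conj (p := .Z) (φ := 0) (θ := θ) rfl rfl norm_one ?_
    rw [neg_zero, rotMatrix_zero, Matrix.one_mul, Matrix.mul_one, one_smul]

theorem hasSwitch_hadamard (q : X) : (Gate.hadamard q).HasSwitch 3 :=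
  hasSwitch_of_conj rfl rfl (by simp) rotMatrix_Y_conj_Z_pi

theorem hasSwitch_phase (q : X) : (Gate.phase q).HasSwitch 3 := by
  refine hasSwitch_of_conj (p := .Z) (φ := 0) (θ := Real.pi / 2) rfl rfl
    (zPhase_norm (Real.pi / 2) false) ?_
  rw [neg_zero, rotMatrix_zero, Matrix.one_mul, Matrix.mul_one, rotMatrix_Z_eq, phaseMatrix,
    ← Matrix.diagonal_smul]
  congr 1
  funext b
  rw [Pi.smul_apply, smul_eq_mul]
  cases b
  · rw [if_neg (by simp), mul_one]; rfl
  · calc Complex.exp (-(Complex.I * ((Real.pi / 2 / 2 * sgn true : ℝ) : ℂ)))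
        = zPhase (Real.pi / 2) false * Complex.exp (Real.pi / 2 * Complex.I) := by
          rw [zPhase, ← Complex.exp_add]
          congr 1
          push_cast [sgn_true, sgn_false]
          ring
      _ = _ := by rw [Complex.exp_pi_div_two_mul_I, if_pos rfl]

/-- The sign of a conjunction of wires, if a program makes up the corresponding phases. -/
theorem sgn_eq_of_phase {θ τ : ℝ} {b : Bool} {m : ℤ}
    (h : τ = -(θ / 2) + (if b then Real.pi else 0) + m * (2 * Real.pi)) :
    Complex.exp (Complex.I * (τ : ℂ)) = zPhase θ false * ((sgn b : ℝ) : ℂ) := by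
  have h1 : ((sgn b : ℝ) : ℂ) = Complex.exp (Complex.I * (((if b then Real.pi else 0 : ℝ)) : ℂ)) := by
    cases b
    · simp
    · simp [mul_comm Complex.I, Complex.exp_pi_mul_I]
  rw [h1, zPhase, ← Complex.exp_add, Complex.exp_eq_exp_iff_exists_int]
  refine ⟨m, ?_⟩
  rw [h]
  push_cast [sgn_false]
  ring

theorem zPhase_eq_exp (θ : ℝ) (b : Bool) :
    zPhase θ b = Complex.exp (Complex.I * ((-(θ / 2 * sgn b) : ℝ) : ℂ)) := by
  rw [zPhase, Complex.ofReal_neg, mul_neg]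

/-- From `2 a b = a + b - (a ⊕ b)`, multiplied by `π / 2`. The parity is formed by a `CX` pair, for
`1 + 1 + 3` steps. -/
theorem hasSwitch_cz (c t : X) (h : c ≠ t) {A : Finset X} (hc : c ∈ A) (ht : t ∈ A) :
    ∃ d : ℝ → (X → Bool) → ℂ, HasProgram A 5 (fun σ => Matrix.diagonal (d σ)) ∧
      (∀ x, d 0 x = 1) ∧
      ∀ x, d 1 x = zPhase (Real.pi / 2) false * ((sgn (x c && x t) : ℝ) : ℂ) := by
  refine ⟨_, ((hasProgram_rot hc (Real.pi / 2)).diagonal_mul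
    (hasProgram_rot ht (Real.pi / 2))).diagonal_mul
    ((hasProgram_rot ht (-(Real.pi / 2))).conj_cx h hc ht), fun x => ?_, fun x => ?_⟩
  · simp only [zero_mul, zPhase_zero, mul_one]
  · simp only [one_mul, Function.update_self, zPhase_eq_exp _ (x _), zPhase_eq_exp _ (_ ^^ _),
      ← Complex.exp_add, ← mul_add, ← Complex.ofReal_add]
    apply sgn_eq_of_phase (m := 0)
    cases x c <;> cases x t <;> simp <;> ring

/-- `4 a b c` is the sum of the three digits, minus their three pairwise parities, plus the parity
of all; it is multiplied by `π / 4`. The rotations take `3 * 1 + 3 * 3 + 5 = 17` steps. -/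
theorem hasSwitch_ccz (c₁ c₂ t : X) (h₁₂ : c₁ ≠ c₂) (h₁ : c₁ ≠ t) (h₂ : c₂ ≠ t) {A : Finset X}
    (m₁ : c₁ ∈ A) (m₂ : c₂ ∈ A) (m₃ : t ∈ A) :
    ∃ d : ℝ → (X → Bool) → ℂ, HasProgram A 17 (fun σ => Matrix.diagonal (d σ)) ∧
      (∀ x, d 0 x = 1) ∧
      ∀ x, d 1 x = zPhase (Real.pi / 4) false * ((sgn ((x c₁ && x c₂) && x t) : ℝ) : ℂ) := by
  refine ⟨_, ((((((hasProgram_rot m₁ (Real.pi / 4)).diagonal_mul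
    (hasProgram_rot m₂ (Real.pi / 4))).diagonal_mul
    (hasProgram_rot m₃ (Real.pi / 4))).diagonal_mul
    ((hasProgram_rot m₂ (-(Real.pi / 4))).conj_cx h₁₂ m₁ m₂)).diagonal_mul
    ((hasProgram_rot m₃ (-(Real.pi / 4))).conj_cx h₁ m₁ m₃)).diagonal_mul
    ((hasProgram_rot m₃ (-(Real.pi / 4))).conj_cx h₂ m₂ m₃)).diagonal_mul
    (((hasProgram_rot m₃ (Real.pi / 4)).conj_cx h₁ m₁ m₃).conj_cx h₂ m₂ m₃),
    fun x => ?_, fun x => ?_⟩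
  · simp only [zero_mul, zPhase_zero, mul_one]
  · simp only [one_mul, Function.update_self, Function.update_of_ne h₁]
    simp only [zPhase_eq_exp _ (x _), zPhase_eq_exp _ (_ ^^ _),
      ← Complex.exp_add, ← mul_add, ← Complex.ofReal_add]
    apply sgn_eq_of_phase (m := 0)
    cases x c₁ <;> cases x c₂ <;> cases x t <;> simp <;> ring

theorem hadamard_conj_sgn (t : X) (p : (X → Bool) → Bool)
    (hp : ∀ x s, p (Function.update x t s) = p x) :
    onQubit t hadamardMatrix * (Matrix.diagonal fun x => ((sgn (p x && x t) : ℝ) : ℂ))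
      * onQubit t hadamardMatrix = mux t fun x => if p x then pauli .X else 1 := by
  rw [← hadamard_conj_mux t p hp, ← Matrix.mul_assoc, ← Matrix.mul_assoc, onQubit_hadamard_unit,
    Matrix.one_mul, Matrix.mul_assoc, onQubit_hadamard_unit, Matrix.mul_one]

/-- Conjugation of switchable signs by Hadamard gates. -/
theorem hasProgram_mux (t : X) {A : Finset X} {L : ℕ} (ht : t ∈ A) (p : (X → Bool) → Bool)
    (hp : ∀ x s, p (Function.update x t s) = p x) {u : ℂ}
    (h : ∃ d : ℝ → (X → Bool) → ℂ, HasProgram A L (fun σ => Matrix.diagonal (d σ)) ∧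
      (∀ x, d 0 x = 1) ∧ ∀ x, d 1 x = u * ((sgn (p x && x t) : ℝ) : ℂ)) :
    ∃ N : ℝ → Matrix (X → Bool) (X → Bool) ℂ, HasProgram A (L + 2) N ∧ N 0 = 1 ∧
      N 1 = u • mux t fun x => if p x then pauli .X else 1 := by
  obtain ⟨d, h1, h2, h3⟩ := h
  have hs : (Gate.hadamard t).support ⊆ A := by simpa [Gate.support] using ht
  refine ⟨_, h1.conj hs hs, ?_, ?_⟩
  · rw [funext h2, Matrix.diagonal_one, Matrix.mul_one]
    exact onQubit_hadamard_unit t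
  · rw [← hadamard_conj_sgn t p hp, funext h3]
    have : (Matrix.diagonal fun x : X → Bool => u * ((sgn (p x && x t) : ℝ) : ℂ))
        = u • Matrix.diagonal fun x => ((sgn (p x && x t) : ℝ) : ℂ) := by
      rw [← Matrix.diagonal_smul]; rfl
    rw [this, Matrix.mul_smul, Matrix.smul_mul]
    rfl

theorem hasSwitch_toffoli (c₁ c₂ t : X) (h₁₂ : c₁ ≠ c₂) (h₁ : c₁ ≠ t) (h₂ : c₂ ≠ t) :
    (Gate.toffoli c₁ c₂ t h₁₂ h₁ h₂).HasSwitch 19 := by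
  obtain ⟨N, h3, h4, h5⟩ := hasProgram_mux t (A := (Gate.toffoli c₁ c₂ t h₁₂ h₁ h₂).support)
    (by simp [Gate.support]) (fun x => x c₁ && x c₂)
    (fun x s => by simp only [Function.update_of_ne h₁, Function.update_of_ne h₂])
    (hasSwitch_ccz c₁ c₂ t h₁₂ h₁ h₂ (by simp [Gate.support]) (by simp [Gate.support])
      (by simp [Gate.support]))
  exact ⟨N, _, h3, zPhase_norm _ _, h4, by rw [h5, tof_eq_mux]⟩

/-- Only one `CX`, from `c` to some `t ∈ T`, has to be switched. Fan-outs from `t` to the rest of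
`T` before and after it spread the change, and cancel when it is off. The length is thus independent
of `T`. -/
theorem hasSwitch_fanout (c : X) (T : Finset X) (hc : c ∉ T) :
    (Gate.fanout c T hc).HasSwitch 9 := by
  rcases T.eq_empty_or_nonempty with rfl | ⟨t, ht⟩
  · refine ⟨_, 1, hasProgram_one.mono (by omega), norm_one, rfl, ?_⟩
    rw [one_smul, matrix_fanout, ← ofBasisMap_id]
    rfl
  have hct : c ≠ t := by rintro rfl; exact hc ht
  have hg : c ∉ ({t} : Finset X) := by simpa using hct
  have hF : t ∉ T.erase t := T.notMem_erase t
  have hs : (Gate.fanout t (T.erase t) hF).support ⊆ (Gate.fanout c T hc).support := by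
    intro w hw
    simp only [Gate.support, Finset.mem_insert, Finset.mem_erase] at hw ⊢
    rcases hw with rfl | hw
    · exact Or.inr ht
    · exact Or.inr hw.2
  obtain ⟨N, h3, h4, h5⟩ := hasProgram_mux t (A := (Gate.fanout c T hc).support)
    (by simp [Gate.support, ht]) (fun x => x c)
    (fun x s => by simp only [Function.update_of_ne hct])
    (hasSwitch_cz c t hct (by simp [Gate.support]) (by simp [Gate.support, ht]))
  refine ⟨_, zPhase (Real.pi / 2) false, h3.conj hs hs, zPhase_norm _ _, ?_, ?_⟩
  · rw [h4, Matrix.mul_one]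
    exact ofBasisMap_mul_self _ (fanMap_fanMap _ _ hF)
  · rw [h5, ← cx_eq_mux c t hg, Matrix.mul_smul, Matrix.smul_mul]
    congr 1
    rw [matrix_fanout, matrix_fanout, matrix_fanout, ofBasisMap_mul, ofBasisMap_mul]
    congr 1
    funext x w
    by_cases hw : w = t
    · subst hw
      simp [fanMap, ht, hc, hct]
    · by_cases hwT : w ∈ T
      · simp only [Function.comp_apply, fanMap, Finset.mem_erase, Finset.mem_singleton, hw, hwT,
          hct, hc, and_false, if_true, if_false, ne_eq, not_false_eq_true, and_self, not_true_eq_false,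
          false_and]
        cases x w <;> cases x t <;> cases x c <;> rfl
      · simp [fanMap, hw, hwT]

theorem Gate.hasSwitch (g : Gate X) : g.HasSwitch 19 := by
  have key : ∀ {L : ℕ}, g.HasSwitch L → L ≤ 19 → g.HasSwitch 19 := by
    rintro L ⟨N, u, h, h'⟩ hL
    exact ⟨N, u, h.mono hL, h'⟩
  cases g with
  | hadamard q => exact key (hasSwitch_hadamard q) (by omega)
  | phase q => exact key (hasSwitch_phase q) (by omega)
  | fanout c T hc => exact key (hasSwitch_fanout c T hc) (by omega)
  | rotation p θ q => exact key (hasSwitch_rotation p θ q) (by omega)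
  | toffoli c₁ c₂ t h₁₂ h₁ h₂ => exact hasSwitch_toffoli c₁ c₂ t h₁₂ h₁ h₂

end Program

end

section

open Matrix

/-! ### Controlled circuits -/

section Controlled

variable {X B : Type} [Fintype X] [DecidableEq X] [Fintype B] [DecidableEq B]

theorem Step.commute_op {s t : Step X} (h : Disjoint s.support t.support) (σ : ℝ) :
    Commute (s.op σ) (t.op σ) := by
  have key : ∀ s : Step X, s = .idle ∨ ∃ g : Gate X, g.support = s.support ∧
      s.op σ = g.matrix := by
    intro s
    cases s with
    | gate g => exact Or.inr ⟨g, rfl, rfl⟩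
    | rot q θ => exact Or.inr ⟨.rotation .Z (σ * θ) q, rfl, (onQubit_rotMatrix_Z q _).symm⟩
    | idle => exact Or.inl rfl
  rcases key s with rfl | ⟨g, hg, hs⟩
  · exact Commute.one_left _
  rcases key t with rfl | ⟨g', hg', ht⟩
  · exact Commute.one_right _
  rw [hs, ht]
  exact Gate.matrix_commute (by rwa [hg, hg'])

theorem commute_stepsOp {s : Step X} {l : List (Step X)}
    (h : ∀ t ∈ l, Disjoint s.support t.support) (σ : ℝ) : Commute (s.op σ) (stepsOp σ l) := by
  induction l with
  | nil => exact Commute.one_right _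
  | cons t l ih =>
    exact (ih fun t' ht' => h t' (by simp [ht'])).mul_right (Step.commute_op (h t (by simp)) σ)

/-- The gate of a step. -/
def Step.gate? : Step X → Option (Gate X)
  | .gate g => some g
  | _ => none

/-- The angles of the switchable rotation of a step. -/
def Step.angle : Step X → X → ℝ
  | .rot q θ => Pi.single q θ
  | _ => 0

theorem Step.angle_of_notMem {s : Step X} {w : X} (h : w ∉ s.support) : s.angle w = 0 := by
  cases s with
  | rot q θ => exact Pi.single_eq_of_ne (by simpa [Step.support] using h) _
  | _ => rfl

theorem sum_angle_of_notMem {l : List (Step X)} {w : X} (h : ∀ s ∈ l, w ∉ s.support) :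
    (l.map Step.angle).sum w = 0 := by
  induction l with
  | nil => rfl
  | cons s l ih =>
    rw [List.map_cons, List.sum_cons, Pi.add_apply, Step.angle_of_notMem (h s (by simp)),
      ih fun t ht => h t (by simp [ht]), add_zero]

/-- In a row of disjoint steps the switchable rotations move past the gates and merge into one
diagonal, which `ctrlRot` controls as a whole. -/
theorem prod_map_op {l : List (Step X)}
    (hl : l.Pairwise fun s t => Disjoint s.support t.support) (σ : ℝ) :
    (l.map (Step.op σ)).prod
      = Matrix.diagonal (zDiag fun w => σ * (l.map Step.angle).sum w)
        * ((l.filterMap Step.gate?).map Gate.matrix).prod := by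
  induction l with
  | nil =>
    simp only [List.map_nil, List.prod_nil, List.filterMap_nil, List.sum_nil, Pi.zero_apply,
      mul_zero, Matrix.mul_one]
    rw [funext zDiag_zero, Matrix.diagonal_one]
  | cons s l ih =>
    obtain ⟨hs, hl⟩ := List.pairwise_cons.1 hl
    rw [List.map_cons, List.prod_cons, ih hl]
    cases s with
    | gate g =>
      have hz : ∀ w ∈ g.support, σ * (l.map Step.angle).sum w = 0 := by
        intro w hw
        rw [sum_angle_of_notMem fun t ht => Finset.disjoint_left.1 (hs t ht) hw, mul_zero]
      have hc := Gate.commute_zDiag hz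
      have h1 : List.filterMap Step.gate? (Step.gate g :: l)
          = g :: List.filterMap Step.gate? l := rfl
      rw [h1, List.map_cons, List.sum_cons, List.map_cons, List.prod_cons]
      simp only [Step.op, Step.angle, zero_add]
      rw [← Matrix.mul_assoc, ← Matrix.mul_assoc, hc.eq]
    | rot q θ =>
      have h1 : List.filterMap Step.gate? (Step.rot q θ :: l) = List.filterMap Step.gate? l := rfl
      rw [h1, List.map_cons, List.sum_cons, ← Matrix.mul_assoc]
      simp only [Step.op, Step.angle, Matrix.diagonal_mul_diagonal, Pi.add_apply, mul_add]
      congr 2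
      funext x
      rw [zDiag_add, ← zDiag_single q (σ * θ)]
      congr 2
      funext w
      by_cases hw : w = q
      · subst hw
        simp
      · simp [hw]
    | idle =>
      have h1 : List.filterMap Step.gate? (Step.idle :: l) = List.filterMap Step.gate? l := rfl
      rw [h1, List.map_cons, List.sum_cons]
      simp only [Step.op, Step.angle, zero_add, Matrix.one_mul]

/-- The gates of simultaneous steps. -/
def rowLayer (l : List (Step X)) (hl : l.Pairwise fun s t => Disjoint s.support t.support) :
    Layer X where
  gates := l.filterMap Step.gate?
  disjoint := by
    refine hl.filterMap _ ?_
    intro s t hst g hg g' hg'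
    cases s with
    | gate _ =>
      cases t with
      | gate _ =>
        cases hg
        cases hg'
        exact hst
      | _ => cases hg'
    | _ => cases hg

theorem exists_row_circuit (h : B) (l : List (Step X))
    (hl : l.Pairwise fun s t => Disjoint s.support t.support) :
    ∃ c : Circuit (X ⊕ B), c.depth = 5 ∧
      c.matrix = fib fun b => (l.map (Step.op (if b h then 1 else 0))).prod := by
  -- One layer for the plain gates, four for the controlled rotations.
  refine ⟨[(rowLayer l hl).mapWires ⟨Sum.inl, Sum.inl_injective⟩] ++
    ctrlRot h (l.map Step.angle).sum, rfl, ?_⟩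
  rw [Circuit.matrix_append, Circuit.matrix_singleton, Layer.matrix_mapWires, lift_inl,
    matrix_ctrlRot, fib_mul]
  congr 1
  funext b
  rw [prod_map_op hl]
  rfl

theorem stepsOp_eq_tail_mul (σ : ℝ) (l : List (Step X)) :
    stepsOp σ l = stepsOp σ l.tail * (l.headD .idle).op σ := by
  cases l with
  | nil => exact (Matrix.mul_one _).symm
  | cons s l => rfl

theorem prod_map_mul_of_commute {ι M : Type} [Monoid M] (f g : ι → M) (l : List ι)
    (h : l.Pairwise fun i j => Commute (g i) (f j)) :
    (l.map fun i => f i * g i).prod = (l.map f).prod * (l.map g).prod := by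
  induction l with
  | nil => simp
  | cons i l ih =>
    obtain ⟨hi, hl⟩ := List.pairwise_cons.1 h
    have hc : Commute (g i) (l.map f).prod := by
      apply Commute.list_prod_right
      intro m hm
      obtain ⟨j, hj, rfl⟩ := List.mem_map.1 hm
      exact hi j hj
    rw [List.map_cons, List.prod_cons, ih hl, List.map_cons, List.prod_cons, List.map_cons,
      List.prod_cons, mul_assoc, mul_assoc, ← mul_assoc (g i), hc.eq, mul_assoc]

theorem disjoint_support_headD {l : List (Step X)} {t : Step X}
    (h : ∀ s ∈ l, Disjoint s.support t.support) : Disjoint (l.headD .idle).support t.support := by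
  cases l with
  | nil => exact Finset.disjoint_empty_left _
  | cons s l => exact h s (by simp)

/-- Programs on disjoint wires run in parallel: their first steps, padded by `idle`, form a row and
commute with the tails of the other programs. -/
theorem exists_programs_circuit (h : B) (R : ℕ) (ts : List (List (Step X)))
    (hR : ∀ t ∈ ts, t.length ≤ R)
    (hd : ts.Pairwise fun t t' => ∀ s ∈ t, ∀ s' ∈ t', Disjoint s.support s'.support) :
    ∃ c : Circuit (X ⊕ B), c.depth = 5 * R ∧
      c.matrix = fib fun b => (ts.map (stepsOp (if b h then 1 else 0))).prod := by
  induction R generalizing ts with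
  | zero =>
    refine ⟨[], rfl, ?_⟩
    rw [Circuit.matrix_nil, ← fib_one]
    congr 1
    funext b
    symm
    apply List.prod_eq_one
    intro m hm
    obtain ⟨t, ht, rfl⟩ := List.mem_map.1 hm
    rw [List.length_eq_zero_iff.1 (Nat.le_zero.1 (hR t ht))]
    rfl
  | succ R ih =>
    obtain ⟨c, hc1, hc2⟩ := ih (ts.map List.tail) (by
      intro t ht
      obtain ⟨t', ht', rfl⟩ := List.mem_map.1 ht
      have := hR t' ht'
      rw [List.length_tail]
      omega) (by
      rw [List.pairwise_map]
      exact hd.imp fun h s hs s' hs' => h s (List.mem_of_mem_tail hs) s' (List.mem_of_mem_tail hs'))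
    have hrow : (ts.map fun t => t.headD .idle).Pairwise
        fun s t => Disjoint s.support t.support := by
      rw [List.pairwise_map]
      refine hd.imp fun {t t'} h => disjoint_support_headD fun s hs => ?_
      exact (disjoint_support_headD fun s' hs' => (h s hs s' hs').symm).symm
    obtain ⟨c', hc1', hc2'⟩ := exists_row_circuit h _ hrow
    refine ⟨c' ++ c, by rw [Circuit.depth_append, hc1, hc1']; omega, ?_⟩
    rw [Circuit.matrix_append, hc2, hc2', fib_mul]
    congr 1
    funext b
    rw [List.map_map, List.map_map]
    simp only [Function.comp_def]
    rw [← prod_map_mul_of_commute (fun t : List (Step X) => stepsOp (if b h then 1 else 0) t.tail)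
      (fun t => (t.headD .idle).op (if b h then 1 else 0))]
    · congr 1
      apply List.map_congr_left
      intro t _
      exact (stepsOp_eq_tail_mul _ t).symm
    · refine hd.imp fun {t t'} h => commute_stepsOp (fun s' hs' => ?_) _
      exact disjoint_support_headD fun s hs => h s hs s' (List.mem_of_mem_tail hs')

theorem exists_ctrl_layer (h : B) (L : Layer X) :
    ∃ (c : Circuit (X ⊕ B)) (u : ℂ), c.depth = 95 ∧ ‖u‖ = 1 ∧
      c.matrix = fib fun b => if b h then u • L.matrix else 1 := by
  choose N u hN hu h0 h1 using Gate.hasSwitch (X := X)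
  choose l hl hs hop using hN
  -- At most `19` rows of depth `5` each, whence `95`.
  obtain ⟨c, hc1, hc2⟩ := exists_programs_circuit h 19 (L.gates.map l) (by
    intro t ht
    obtain ⟨g, _, rfl⟩ := List.mem_map.1 ht
    exact hl g) (by
    rw [List.pairwise_map]
    exact L.disjoint.imp fun hg s hs1 s' hs1' =>
      Finset.disjoint_of_subset_left (hs _ s hs1) (Finset.disjoint_of_subset_right
        (hs _ s' hs1') hg))
  refine ⟨c, (L.gates.map u).prod, hc1, ?_, ?_⟩
  · have : ∀ gs : List (Gate X), ‖(gs.map u).prod‖ = 1 := by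
      intro gs
      induction gs with
      | nil => simp
      | cons g gs ih => rw [List.map_cons, List.prod_cons, norm_mul, hu, ih, one_mul]
    exact this _
  · rw [hc2]
    congr 1
    funext b
    rw [List.map_map, Layer.matrix]
    cases b h
    · simp only [Function.comp_def, Bool.false_eq_true, if_false]
      apply List.prod_eq_one
      intro m hm
      obtain ⟨g, _, rfl⟩ := List.mem_map.1 hm
      rw [hop, h0]
    · simp only [Function.comp_def, if_true, hop, h1]
      generalize L.gates = gs
      induction gs with
      | nil => simp
      | cons g gs ih =>
        simp only [List.map_cons, List.prod_cons, ih, Matrix.smul_mul, Matrix.mul_smul, smul_smul,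
          mul_comm (u g)]

/-- Every circuit can be controlled, up to a phase, at the cost of a constant factor of depth. -/
theorem exists_ctrl_circuit (h : B) (C : Circuit X) :
    ∃ (c : Circuit (X ⊕ B)) (u : ℂ), c.depth = 95 * C.depth ∧ ‖u‖ = 1 ∧
      c.matrix = fib fun b => if b h then u • C.matrix else 1 := by
  induction C with
  | nil =>
    refine ⟨[], 1, rfl, norm_one, ?_⟩
    rw [Circuit.matrix_nil, Circuit.matrix_nil, ← fib_one]
    simp
  | cons L C ih =>
    obtain ⟨c, u, h1, h2, h3⟩ := ih
    obtain ⟨c', u', h1', h2', h3'⟩ := exists_ctrl_layer h L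
    refine ⟨c' ++ c, u * u', ?_, by rw [norm_mul, h2, h2', one_mul], ?_⟩
    · rw [Circuit.depth_append, h1, h1', Circuit.depth, Circuit.depth, List.length_cons]
      ring
    · rw [Circuit.matrix_append, h3, h3', fib_mul, Circuit.matrix_cons]
      congr 1
      funext b
      cases b h
      · simp
      · simp [smul_smul, mul_comm]

end Controlled

end

section

open Matrix

/-! ### Linear combinations of block-encodings -/

/-- If digit `k` is set with probability `w k / ∑ j ≥ k, w j`, independently, then it is the first
one set with probability proportional to `w k`. So one layer of rotations prepares any weights. The
value of `F` where no digit is set is free: that event has probability `0`, or the total weight is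
`0`. -/
theorem exists_firstHit_weights {S : ℕ} (w : Fin S → ℝ) (hw : ∀ k, 0 ≤ w k) :
    ∃ t : Fin S → ℝ, (∀ i, t i ∈ Set.Icc (0 : ℝ) 1) ∧
      ∀ (v : Fin S → ℂ) (F : (Fin S → Bool) → ℂ),
        (∀ d k, d k = true → (∀ j, j < k → d j = false) → F d = v k) →
        ((∑ k, w k : ℝ) : ℂ) * ∑ d, (prodWeight t d : ℂ) * F d = ∑ k, (w k : ℂ) * v k := by
  induction S with
  | zero => exact ⟨fun _ => 0, by simp, fun v F _ => by simp⟩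
  | succ S ih =>
    obtain ⟨t, ht, h⟩ := ih (fun k => w k.succ) fun k => hw _
    have hW' : 0 ≤ ∑ k, w (Fin.succ k) := Finset.sum_nonneg fun k _ => hw _
    have hsum : ∑ k, w k = w 0 + ∑ k, w (Fin.succ k) := Fin.sum_univ_succ w
    have hW : 0 ≤ ∑ k, w k := by rw [hsum]; exact add_nonneg (hw 0) hW'
    -- If the total weight is `0`, so is `w 0`, and the quotient is `0` by convention.
    have hmul : (∑ k, w k) * (w 0 / ∑ k, w k) = w 0 := by
      by_cases h0 : ∑ k, w k = 0
      · have := hw 0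
        rw [h0, zero_mul]
        linarith
      · field_simp
    refine ⟨Fin.cons (w 0 / ∑ k, w k) t, cons_mem_Icc ⟨div_nonneg (hw 0) hW,
      div_le_one_of_le₀ (by rw [hsum]; linarith) hW⟩ ht, fun v F hF => ?_⟩
    have h1 := h (fun k => v k.succ) (fun d => F (Fin.cons false d)) fun d k hk hj => by
      refine hF _ k.succ (by simpa using hk) fun j hjk => ?_
      refine Fin.cases (fun _ => rfl) (fun j hjk => ?_) j hjk
      exact hj j (Fin.succ_lt_succ_iff.1 hjk)
    have h2 : ∀ d : Fin S → Bool, F (Fin.cons true d) = v 0 := fun d =>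
      hF _ 0 rfl fun j hj => absurd hj (Fin.not_lt_zero j)
    have h3 : ((∑ d, prodWeight t d : ℝ) : ℂ) = 1 := by rw [sum_prodWeight]; simp
    have h4 : ((∑ k, w k : ℝ) : ℂ) * ((w 0 / ∑ k, w k : ℝ) : ℂ) = (w 0 : ℂ) := by
      rw [← Complex.ofReal_mul, hmul]
    have h5 : ((∑ k, w k : ℝ) : ℂ) * ((1 - w 0 / ∑ k, w k : ℝ) : ℂ)
        = ((∑ k, w (Fin.succ k) : ℝ) : ℂ) := by
      rw [← Complex.ofReal_mul, mul_sub, hmul, mul_one, hsum]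
      congr 1; ring
    have h6 : ∑ d, (prodWeight (Fin.cons (w 0 / ∑ k, w k) t : Fin (S + 1) → ℝ) d : ℂ) * F d
        = ((w 0 / ∑ k, w k : ℝ) : ℂ) * v 0 + ((1 - w 0 / ∑ k, w k : ℝ) : ℂ)
          * ∑ d, (prodWeight t d : ℂ) * F (Fin.cons false d) := by
      rw [sum_cons_bool, Fintype.sum_bool, Finset.mul_sum]
      congr 1
      · rw [← mul_one (((w 0 / ∑ k, w k : ℝ) : ℂ)), ← h3, Complex.ofReal_sum, Finset.mul_sum,
          Finset.sum_mul]
        apply Finset.sum_congr rfl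
        intro d _
        rw [h2]
        simp only [prodWeight, Fin.prod_univ_succ, Fin.cons_zero, Fin.cons_succ, if_true,
          Complex.ofReal_mul]
      · apply Finset.sum_congr rfl
        intro d _
        simp only [prodWeight, Fin.prod_univ_succ, Fin.cons_zero, Fin.cons_succ,
          Bool.false_eq_true, if_false, Complex.ofReal_mul, mul_assoc]
    rw [h6, mul_add, ← mul_assoc, ← mul_assoc, h4, h5, h1, Fin.sum_univ_succ]

theorem hitVal_true {ι : Type} [DecidableEq ι] (v : ι → Bool) (l : List ι) (j : ι) :
    hitVal v l true j = false := by
  induction l with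
  | nil => rfl
  | cons a l ih =>
    rw [hitVal, Bool.true_or, ih]
    simp

theorem hitVal_of_first {ι : Type} [LinearOrder ι] (v : ι → Bool) {l : List ι}
    (hl : l.Pairwise (· < ·)) {k : ι} (hk : k ∈ l) (hv : v k = true)
    (hlt : ∀ j, j < k → v j = false) {j : ι} (hj : j ∈ l) :
    hitVal v l false j = decide (j = k) := by
  induction l with
  | nil => simp at hj
  | cons a l ih =>
    obtain ⟨ha, hl⟩ := List.pairwise_cons.1 hl
    rw [hitVal]
    by_cases hak : a = k
    · subst hak
      by_cases hja : j = a
      · simp [hja, hv]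
      · simp [hja, hv, hitVal_true]
    · have hk' : k ∈ l := by simpa [Ne.symm hak] using hk
      have hva := hlt a (ha k hk')
      by_cases hja : j = a
      · simp [hja, hva, hak]
      · rw [if_neg hja, hva]
        exact ih hl hk' (by simpa [hja] using hj)

section Combination

variable {X B : Type} [Fintype X] [DecidableEq X] [Fintype B] [DecidableEq B]

theorem matrix_conjBy_of_fib {l : List (Gate B)} (hl : ∀ g ∈ l, g.IsClassical)
    {c : Circuit (X ⊕ B)} {N : (B → Bool) → Matrix (X → Bool) (X → Bool) ℂ}
    (hc : c.matrix = fib N) :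
    (conjBy (l.map (Gate.mapWires ⟨Sum.inr, Sum.inr_injective⟩)) c).matrix
      = fib fun b => N (runMap l b) := by
  induction l with
  | nil => exact hc
  | cons g l ih =>
    rw [List.map_cons, conjBy, Circuit.matrix_append, Circuit.matrix_append, matrix_seq_cons,
      matrix_seq_nil, Matrix.one_mul, ih fun g' hg' => hl g' (by simp [hg']),
      Gate.matrix_mapWires, Gate.matrix_of_isClassical (hl g (by simp))]
    ext x y
    rw [lift_mul_fib_mul_lift_apply, Finset.sum_eq_single (g.basisMap (y ∘ Sum.inr))]
    · simp only [ofBasisMap_apply, if_true, mul_one, g.basisMap_basisMap, fib, Matrix.of_apply,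
        runMap]
      rw [ite_mul, one_mul, zero_mul]
    · intro b _ hb
      rw [ofBasisMap_apply g.basisMap b, if_neg hb, mul_zero]
    · simp

/-- Circuits of which the one that is marked by the register is applied, up to a phase. -/
theorem exists_select_circuit {ι : Type} [DecidableEq ι] (h : ι → B) (C : ι → Circuit X) {D : ℕ}
    (hD : ∀ k, (C k).depth ≤ D) :
    ∃ u : ι → ℂ, (∀ k, ‖u k‖ = 1) ∧ ∀ l : List ι, l.Nodup →
      ∃ (c : Circuit (X ⊕ B)) (N : (B → Bool) → Matrix (X → Bool) (X → Bool) ℂ),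
        c.depth ≤ 95 * D * l.length ∧ c.matrix = fib N ∧
        ∀ b k, (∀ j ∈ l, b (h j) = decide (j = k)) →
          N b = if k ∈ l then u k • (C k).matrix else 1 := by
  choose c u h1 h2 h3 using fun k => exists_ctrl_circuit (X := X) (h k) (C k)
  refine ⟨u, h2, fun l hl => ?_⟩
  induction l with
  | nil => exact ⟨[], fun _ => 1, le_rfl, by rw [Circuit.matrix_nil, fib_one], by simp⟩
  | cons i l ih =>
    obtain ⟨hi, hl⟩ := List.nodup_cons.1 hl
    obtain ⟨c', N, h1', h2', h3'⟩ := ih hl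
    refine ⟨c i ++ c', _, ?_, by rw [Circuit.matrix_append, h2', h3, fib_mul], ?_⟩
    · rw [Circuit.depth_append, h1, List.length_cons]
      have := hD i
      nlinarith
    · intro b k hb
      rw [h3' b k fun j hj => hb j (by simp [hj]), hb i (by simp)]
      by_cases hik : i = k
      · subst hik
        simp [hi]
      · simp [hik, Ne.symm hik]

end Combination

/-- The ancillas of a linear combination. -/
abbrev LcuWire (S : ℕ) : Type := Fin S ⊕ (Fin S ⊕ Bool)

section Lcu

variable {S : ℕ}

/-- The angles of the first rotations. -/
def lcuAngle (θ : Fin S → ℝ) (ρ : ℝ) : LcuWire S → ℝ :=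
  Sum.elim θ (Sum.elim (fun _ => 0) fun b => if b then 0 else ρ)

theorem rotMatrix_Y_mul_apply (θ : ℝ) (b : Bool) :
    rotMatrix .Y (-θ) false b * rotMatrix .Y θ b false
      = ((if b then Real.sin (θ / 2) ^ 2 else 1 - Real.sin (θ / 2) ^ 2 : ℝ) : ℂ) := by
  rw [rotMatrix_Y_apply, rotMatrix_Y_apply]
  cases b
  · simp only [Matrix.of_apply, if_true, neg_div, Real.cos_neg, Bool.false_eq_true, if_false]
    rw [← Complex.ofReal_mul, ← Real.cos_sq', sq]
  · simp only [Matrix.of_apply, if_true, neg_div, Real.sin_neg, Bool.false_eq_true,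
      Bool.true_eq_false, if_false]
    rw [← Complex.ofReal_neg, ← Complex.ofReal_mul, neg_neg, sq]

/-- Preparing and unpreparing multiply to a probability. The wire turned by `ρ` is not turned back
and contributes `cos (ρ / 2)`, an adjustable subnormalisation. -/
theorem tens_lcuAngle_mul (θ : Fin S → ℝ) (ρ : ℝ) (e : LcuWire S → Bool) :
    tens (fun w => rotMatrix .Y (lcuAngle (fun i => -θ i) 0 w)) (fun _ => false) e
      * tens (fun w => rotMatrix .Y (lcuAngle θ ρ w)) e (fun _ => false)
      = (prodWeight (fun i => Real.sin (θ i / 2) ^ 2) (e ∘ Sum.inl) : ℂ)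
        * if e ∘ Sum.inr = (fun _ => false) then (Real.cos (ρ / 2) : ℂ) else 0 := by
  rw [tens_apply, tens_apply, ← Finset.prod_mul_distrib, Fintype.prod_sum_type]
  congr 1
  · rw [prodWeight, Complex.ofReal_prod]
    apply Finset.prod_congr rfl
    intro i _
    exact rotMatrix_Y_mul_apply (θ i) (e (Sum.inl i))
  · have h1 : ∀ v : Fin S ⊕ Bool,
        rotMatrix .Y (lcuAngle (fun i => -θ i) 0 (Sum.inr v)) false (e (Sum.inr v))
          * rotMatrix .Y (lcuAngle θ ρ (Sum.inr v)) (e (Sum.inr v)) false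
        = if e (Sum.inr v) = false then (if v = Sum.inr false then (Real.cos (ρ / 2) : ℂ) else 1)
          else 0 := by
      intro v
      have h2 : lcuAngle (fun i => -θ i) 0 (Sum.inr v) = 0 := by
        rcases v with v | v | v <;> simp [lcuAngle]
      have h3 : lcuAngle θ ρ (Sum.inr v) = if v = Sum.inr false then ρ else 0 := by
        rcases v with v | v | v <;> simp [lcuAngle]
      rw [h2, h3, rotMatrix_zero]
      cases e (Sum.inr v)
      · by_cases hv : v = Sum.inr false
        · simp [hv, rotMatrix_Y_apply]
        · simp [hv, rotMatrix_zero]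
      · simp
    rw [Finset.prod_congr rfl fun v _ => h1 v]
    by_cases h : e ∘ Sum.inr = fun _ => false
    · have h4 : ∀ v, e (Sum.inr v) = false := congrFun h
      simp only [h4, if_true]
      rw [if_pos h, Finset.prod_ite_eq' Finset.univ (Sum.inr false) fun _ => (Real.cos (ρ / 2) : ℂ),
        if_pos (Finset.mem_univ _)]
    · rw [if_neg h]
      obtain ⟨v, hv⟩ := Function.ne_iff.1 h
      exact Finset.prod_eq_zero (Finset.mem_univ v) (if_neg hv)

/-- The angles of the phases. -/
def lcuPhase (η : Fin S → ℝ) : LcuWire S → ℝ :=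
  Sum.elim (fun _ => 0) (Sum.elim η fun b => if b then 0 else -∑ j, η j)

/-- The marks contribute `exp (± i η j / 2)`. The rotation by `-∑ η j` of a wire that holds `0`
removes the common part and leaves the phase of the marked index. -/
theorem zDiag_lcuPhase (η : Fin S → ℝ) (b : LcuWire S → Bool) (k : Fin S)
    (hb : ∀ j, b (.inr (.inl j)) = decide (j = k)) (hs : b (.inr (.inr false)) = false) :
    zDiag (lcuPhase η) b = Complex.exp (Complex.I * (η k : ℂ)) := by
  have h1 : ∀ j, zPhase (η j) (b (.inr (.inl j)))
      = Complex.exp (Complex.I * ((-(η j / 2) + if j = k then η k else 0 : ℝ) : ℂ)) := by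
    intro j
    rw [hb, zPhase]
    congr 1
    by_cases hjk : j = k
    · subst hjk
      simp only [decide_true, sgn_true, if_true]
      push_cast; ring
    · simp only [hjk, decide_false, sgn_false, if_false]
      push_cast; ring
  rw [zDiag, Fintype.prod_sum_type, Fintype.prod_sum_type, Fintype.prod_bool]
  simp only [lcuPhase, Sum.elim_inl, Sum.elim_inr, zPhase_zero, Finset.prod_const_one, one_mul,
    if_true, Bool.false_eq_true, if_false, hs, h1]
  rw [← Complex.exp_sum, zPhase, ← Complex.exp_add, ← Finset.mul_sum, ← Complex.ofReal_sum,
    Finset.sum_add_distrib, Finset.sum_ite_eq' Finset.univ k fun _ => η k,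
    if_pos (Finset.mem_univ k), Finset.sum_neg_distrib, ← Finset.sum_div]
  congr 1
  push_cast [sgn_false]
  ring

end Lcu

end

/-! ### The circuit of a linear combination of block-encodings -/

section

open Matrix

section Lcu

variable {S : ℕ}

/-- The gates that mark the first of the digits that are set. -/
def lcuMark (S : ℕ) : List (Gate (LcuWire S)) :=
  firstHit (fun i => .inl i) (fun i => .inr (.inl i)) (.inr (.inr true)) (by simp) (by simp)
    (by simp) (List.finRange S)

theorem lcuMark_isClassical (S : ℕ) : ∀ g ∈ lcuMark S, g.IsClassical :=
  isClassical_firstHit _ _ _ _ _ _ _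

theorem runMap_lcuMark {e : LcuWire S → Bool} (he : e ∘ Sum.inr = fun _ => false) {k : Fin S}
    (hk : e (.inl k) = true) (hlt : ∀ j, j < k → e (.inl j) = false) :
    (∀ j, runMap (lcuMark S) e (.inr (.inl j)) = decide (j = k)) ∧
      runMap (lcuMark S) e (.inr (.inr false)) = false := by
  have he' : ∀ v, e (Sum.inr v) = false := congrFun he
  obtain ⟨-, h2, h3⟩ := runMap_firstHit (W := LcuWire S) (fun i => .inl i)
    (fun i => .inr (.inl i)) (.inr (.inr true)) (by simp) (by simp) (by simp)
    (fun i j h => by simpa using h) (List.finRange S) (List.nodup_finRange S) e fun j _ => he' _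
  refine ⟨fun j => ?_, ?_⟩
  · rw [lcuMark, h2 j (List.mem_finRange j), he']
    exact hitVal_of_first (fun i => e (.inl i)) (List.pairwise_lt_finRange S)
      (List.mem_finRange k) hk hlt (List.mem_finRange j)
  · rw [lcuMark, h3 _ (by simp) (by simp), he']

variable {X : Type} [Fintype X] [DecidableEq X]

/-- The circuit of a linear combination. -/
def lcuCircuit (θ : Fin S → ℝ) (ρ : ℝ) (η : Fin S → ℝ) (c : Circuit (X ⊕ LcuWire S)) :
    Circuit (X ⊕ LcuWire S) :=
  [(rotLayer (fun _ => .Y) (lcuAngle θ ρ)).mapWires ⟨Sum.inr, Sum.inr_injective⟩] ++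
    (conjBy ((lcuMark S).map (Gate.mapWires ⟨Sum.inr, Sum.inr_injective⟩))
      (c ++ [(rotLayer (fun _ => .Z) (lcuPhase η)).mapWires ⟨Sum.inr, Sum.inr_injective⟩]) ++
    [(rotLayer (fun _ => .Y) (lcuAngle (fun i => -θ i) 0)).mapWires
      ⟨Sum.inr, Sum.inr_injective⟩])

theorem depth_lcuCircuit (θ : Fin S → ℝ) (ρ : ℝ) (η : Fin S → ℝ) (c : Circuit (X ⊕ LcuWire S)) :
    (lcuCircuit θ ρ η c).depth = 3 + 6 * S + c.depth := by
  rw [lcuCircuit, Circuit.depth_append, Circuit.depth_append, depth_conjBy, Circuit.depth_append,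
    List.length_map, lcuMark, length_firstHit, List.length_finRange]
  simp only [Circuit.depth, List.length_singleton]
  omega

/-- The conjugation uncomputes the marks, so the middle part preserves the register, and only
register states with all wires beyond the digits at `0` connect the two outer layers. -/
theorem lcuCircuit_apply (θ : Fin S → ℝ) (ρ : ℝ) (η : Fin S → ℝ) {c : Circuit (X ⊕ LcuWire S)}
    {N : (LcuWire S → Bool) → Matrix (X → Bool) (X → Bool) ℂ} (hc : c.matrix = fib N)
    (x y : X → Bool) :
    (lcuCircuit θ ρ η c).matrix (Sum.elim x fun _ => false) (Sum.elim y fun _ => false)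
      = Real.cos (ρ / 2) * ∑ d, (prodWeight (fun i => Real.sin (θ i / 2) ^ 2) d : ℂ) *
          (zDiag (lcuPhase η) (runMap (lcuMark S) (Sum.elim d fun _ => false)) *
            N (runMap (lcuMark S) (Sum.elim d fun _ => false)) x y) := by
  have h1 : (c ++ [(rotLayer (fun _ => .Z) (lcuPhase η)).mapWires
      (⟨Sum.inr, Sum.inr_injective⟩ : LcuWire S ↪ X ⊕ LcuWire S)] : Circuit _).matrix
      = fib fun b => zDiag (lcuPhase η) b • N b := by
    rw [Circuit.matrix_append, Circuit.matrix_singleton, Layer.matrix_mapWires, matrix_rotLayer,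
      tens_rotMatrix_Z, lift_inr_diagonal, hc, fib_mul]
    congr 1
    funext b
    rw [Matrix.smul_mul, Matrix.one_mul]
  rw [lcuCircuit, Circuit.matrix_append, Circuit.matrix_append, Circuit.matrix_singleton,
    Circuit.matrix_singleton, Layer.matrix_mapWires, Layer.matrix_mapWires, matrix_rotLayer,
    matrix_rotLayer, matrix_conjBy_of_fib (lcuMark_isClassical S) h1,
    lift_mul_fib_mul_lift_apply, sum_sum_bool, Finset.sum_eq_single fun _ => false,
    Finset.mul_sum]
  · apply Finset.sum_congr rfl
    intro d _
    have h2 := tens_lcuAngle_mul θ ρ (Sum.elim d fun _ => false)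
    rw [Sum.elim_comp_inr, if_pos rfl, Sum.elim_comp_inl] at h2
    simp only [Sum.elim_comp_inr, Sum.elim_comp_inl, Matrix.smul_apply, smul_eq_mul]
    rw [mul_right_comm, h2]
    ring
  · intro b _ hb
    apply Finset.sum_eq_zero
    intro d _
    have h2 := tens_lcuAngle_mul θ ρ (Sum.elim d b)
    rw [Sum.elim_comp_inr, if_neg hb, mul_zero] at h2
    simp only [Sum.elim_comp_inr]
    rw [mul_right_comm, h2, zero_mul]
  · simp

end Lcu

theorem exists_general_blockEncoding : ∃ K : ℕ, ∀ (n a S C : ℕ), 1 ≤ S → 1 ≤ C →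
    ∀ (φ : Fin S → (Fin n → Bool) → ℂ) (β : Fin S → ℝ),
      (∀ k, ∃ c : Circuit (Fin n ⊕ Fin a),
        IsBlockEncoding (β k) c.matrix (Matrix.diagonal (φ k)) ∧ c.depth ≤ C) →
      ∀ (y : Fin S → ℂ) (α : ℝ), 0 < α → ∑ k, ‖y k‖ * β k ≤ α →
        ∃ (b : ℕ) (c : Circuit (Fin n ⊕ Fin (a + b))),
          IsBlockEncoding α c.matrix (Matrix.diagonal (∑ k, y k • φ k)) ∧
            b ≤ K * S ∧ c.depth ≤ K * (S * C) := by
  -- `104 = 95 + 6 + 3`: the controlled circuits, three marking gates per index computed and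
  -- uncomputed, and three layers of rotations. The register has `2 S + 2` wires.
  refine ⟨104, fun n a S C hS hC φ β hφ y α hα hy => ?_⟩
  choose G hG hGC using hφ
  have hβ : ∀ k, 0 < β k := fun k => (hG k).1
  have hw : ∀ k, 0 ≤ ‖y k‖ * β k := fun k => mul_nonneg (norm_nonneg _) (hβ k).le
  obtain ⟨t, ht, hsum⟩ := exists_firstHit_weights (fun k => ‖y k‖ * β k) hw
  obtain ⟨u, hu, hsel⟩ := exists_select_circuit
    (fun k : Fin S => (Sum.inr (Sum.inl k) : LcuWire S)) G hGC
  obtain ⟨c, N, hcd, hc, hN⟩ := hsel (List.finRange S) (List.nodup_finRange S)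
  rw [List.length_finRange] at hcd
  have hθ : ∀ i, Real.sin (2 * Real.arcsin (Real.sqrt (t i)) / 2) ^ 2 = t i := by
    intro i
    rw [mul_div_cancel_left₀ _ two_ne_zero, Real.sin_arcsin
      ((neg_nonpos.2 zero_le_one).trans (Real.sqrt_nonneg _)) (Real.sqrt_le_one.2 (ht i).2),
      Real.sq_sqrt (ht i).1]
  have hW : 0 ≤ ∑ k, ‖y k‖ * β k := Finset.sum_nonneg fun k _ => hw k
  -- The natural normalisation `∑ |y k| β k` is weakened to `α` by the wire turned by `ρ`.
  have hρ : Real.cos (2 * Real.arccos ((∑ k, ‖y k‖ * β k) / α) / 2)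
      = (∑ k, ‖y k‖ * β k) / α := by
    rw [mul_div_cancel_left₀ _ two_ne_zero, Real.cos_arccos (by
      have := div_nonneg hW hα.le; linarith) ((div_le_one hα).2 hy)]
  set e : (Fin n ⊕ Fin a) ⊕ LcuWire S ≃ Fin n ⊕ (Fin a ⊕ LcuWire S) := Equiv.sumAssoc _ _ _ with he
  set c₁ := (lcuCircuit (fun i => 2 * Real.arcsin (Real.sqrt (t i)))
    (2 * Real.arccos ((∑ k, ‖y k‖ * β k) / α)) (fun k => (y k / u k).arg) c) with hc₁
  obtain ⟨c', hc', hd, -⟩ := exists_blockEncoding (c₁.mapWires e.toEmbedding) hα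
    (A := Matrix.diagonal (∑ k, y k • φ k)) fun i j => by
      have hel : ∀ i : Fin n → Bool, (Sum.elim i fun _ => false :
          Fin n ⊕ (Fin a ⊕ LcuWire S) → Bool) ∘ e
          = Sum.elim (Sum.elim i fun _ => false) fun _ => false := by
        intro i
        funext w
        rcases w with (w | w) | w <;> rfl
      rw [Circuit.matrix_mapWires, lift_equiv, hel, hel, hc₁, lcuCircuit_apply _ _ _ hc, hρ]
      simp only [hθ]
      have hF := hsum (fun k => Complex.exp (Complex.I * ((y k / u k).arg : ℂ)) *
        (u k * (Matrix.diagonal (φ k) i j / (β k : ℂ)))) _ fun d k hk hlt => by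
          obtain ⟨h1, h2⟩ := runMap_lcuMark (e := Sum.elim d fun _ => false)
            (Sum.elim_comp_inr _ _) hk hlt
          show zDiag (lcuPhase fun k => (y k / u k).arg) (runMap (lcuMark S)
            (Sum.elim d fun _ => false)) * N (runMap (lcuMark S) (Sum.elim d fun _ => false))
              (Sum.elim i fun _ => false) (Sum.elim j fun _ => false) = _
          rw [zDiag_lcuPhase _ _ k h1 h2, hN _ k fun j _ => h1 j, if_pos (List.mem_finRange k),
            Matrix.smul_apply, (hG k).2.2, smul_eq_mul]
      rw [Complex.ofReal_div, div_mul_eq_mul_div, hF]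
      congr 1
      -- The applied phase `arg (y k / u k)` restores that of `y k` and cancels the phase `u k` left
      -- by controlling the circuit.
      have hterm : ∀ k, ((‖y k‖ * β k : ℝ) : ℂ) *
          (Complex.exp (Complex.I * ((y k / u k).arg : ℂ)) *
            (u k * (Matrix.diagonal (φ k) i j / (β k : ℂ)))) = y k * Matrix.diagonal (φ k) i j := by
        intro k
        have hu0 : u k ≠ 0 := by
          intro h
          have := hu k
          rw [h, norm_zero] at this
          exact zero_ne_one this
        have hβ0 : (β k : ℂ) ≠ 0 := Complex.ofReal_ne_zero.2 (hβ k).ne'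
        have h1 := Complex.norm_mul_exp_arg_mul_I (y k / u k)
        rw [norm_div, hu, div_one, mul_comm _ Complex.I] at h1
        have h2 : (‖y k‖ : ℂ) * Complex.exp (Complex.I * ((y k / u k).arg : ℂ)) * u k = y k := by
          rw [h1, div_mul_cancel₀ _ hu0]
        conv_rhs => rw [← h2]
        push_cast
        field_simp
      rw [Finset.sum_congr rfl fun k _ => hterm k]
      by_cases hij : i = j
      · subst hij
        simp [Finset.sum_apply]
      · simp [hij]
  have hcard : Fintype.card (Fin a ⊕ LcuWire S) = a + (2 * S + 2) := by
    simp only [Fintype.card_sum, Fintype.card_fin, Fintype.card_bool]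
    omega
  have hdepth : c'.depth ≤ 104 * (S * C) := by
    rw [hd, Circuit.depth_mapWires, hc₁, depth_lcuCircuit]
    have h1 : S ≤ S * C := Nat.le_mul_of_pos_right S hC
    have h2 : 1 ≤ S * C := Nat.mul_pos hS hC
    have h3 : 95 * C * S = 95 * (S * C) := by ring
    omega
  revert c'
  rw [hcard]
  intro c' hc' _ hdepth
  exact ⟨2 * S + 2, c', hc', by omega, hdepth⟩

end

/-! ### Common constant and the main theorem -/

section

open Matrix Polynomial ComplexConjugate

theorem le_mul_add_lg {K' K S n : ℕ} {a : ℝ} (hn : 3 ≤ n) (hK : K ≤ K') (h : a ≤ K * lg n) :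
    a ≤ K' * (S + lg n) := by
  have h1 : 1 ≤ lg n := one_le_lg (by exact_mod_cast (by omega : 2 ≤ n))
  have h2 : (K : ℝ) ≤ K' := by exact_mod_cast hK
  have h3 : (0 : ℝ) ≤ K' * S := by positivity
  have h4 : (K : ℝ) * lg n ≤ K' * lg n := mul_le_mul_of_nonneg_right h2 (by linarith)
  rw [mul_add]
  linarith

end

end Spectral

end

theorem mainTheorem3 :
    ∃ K : ℕ,
      -- any basis
      (∀ (n a S C : ℕ), 1 ≤ S → 1 ≤ C →
        ∀ (φ : Fin S → (Fin n → Bool) → ℂ), LinearIndependent ℂ φ →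
        ∀ (β : Fin S → ℝ),
        (∀ k, ∃ c : Spectral.Circuit (Fin n ⊕ Fin a),
          Spectral.IsBlockEncoding (β k) c.matrix (Matrix.diagonal (φ k)) ∧ c.depth ≤ C) →
        ∀ (y : Fin S → ℂ) (α : ℝ), 0 < α → ∑ k, ‖y k‖ * β k ≤ α →
        ∃ (b : ℕ) (c : Spectral.Circuit (Fin n ⊕ Fin (a + b))),
          Spectral.IsBlockEncoding α c.matrix (Matrix.diagonal (∑ k, y k • φ k)) ∧
          b ≤ K * S ∧ c.depth ≤ K * (S * C)) ∧
      -- Fourier basis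
      (∀ (n S : ℕ), 1 ≤ n → 2 ≤ S →
        ∀ (k₀ : ℤ) (y : Fin S → ℂ) (α : ℝ), 0 < α → ∑ k, ‖y k‖ ≤ α →
        ∃ (a : ℕ) (c : Spectral.Circuit (Fin n ⊕ Fin a)),
          Spectral.IsBlockEncoding α c.matrix (Matrix.diagonal (Spectral.fourierSum k₀ y)) ∧
          a ≤ K * S ∧ (c.rotDepth : ℝ) ≤ Spectral.fourierRot S ∧ c.tofDepth = 0) ∧
      -- monomial basis
      (∀ (n S : ℕ), 3 ≤ n → 2 ≤ S →
        ∀ (y : Fin S → ℂ) (α : ℝ), 0 < α → ∑ k, ‖y k‖ ≤ α →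
        ∃ (a : ℕ) (c : Spectral.Circuit (Fin n ⊕ Fin a)),
          Spectral.IsBlockEncoding α c.matrix (Matrix.diagonal (Spectral.monomialSum y)) ∧
          (a : ℝ) ≤ K * (S + Spectral.lg n) ∧
          (c.rotDepth : ℝ) ≤ Spectral.monomialRot S n ∧
          (c.tofDepth : ℝ) ≤ Spectral.monomialTof S n) ∧
      -- composition of a polynomial with the Fourier case
      (∀ (n S : ℕ), 1 ≤ n → 3 ≤ S →
        ∀ (k₀ : ℤ) (y : Fin S → ℂ) (α : ℝ), 0 < α → ∑ k, ‖y k‖ ≤ α →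
        ∀ g : (Fin n → Bool) → ℝ, (∀ b, Spectral.fourierSum k₀ y b = (g b : ℂ)) →
        ∀ (d : ℕ) (P : Polynomial ℝ), 1 ≤ d → P.natDegree = d →
        (∀ x ∈ Set.Icc (-1 : ℝ) 1, |P.eval x| ≤ 1) →
        ((∀ x : ℝ, P.eval (-x) = (-1) ^ d * P.eval x) →
          ∃ (a : ℕ) (c : Spectral.Circuit (Fin n ⊕ Fin a)),
            Spectral.IsBlockEncoding 1 c.matrix (Spectral.composedDiag P g α) ∧
            a ≤ K * S ∧
            (c.rotDepth : ℝ) ≤ Spectral.composedFourierRot S * d ∧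
            (c.tofDepth : ℝ) ≤ Spectral.composedFourierTof S * d) ∧
        ∃ (a : ℕ) (c : Spectral.Circuit (Fin n ⊕ Fin a)),
          Spectral.IsBlockEncoding 2 c.matrix (Spectral.composedDiag P g α) ∧
          a ≤ K * S ∧
          (c.rotDepth : ℝ) ≤ 2 * (Spectral.composedFourierRot S * d) ∧
          (c.tofDepth : ℝ) ≤ 2 * (Spectral.composedFourierTof S * d)) ∧
      -- composition of a polynomial with the monomial case
      (∀ (n S : ℕ), 3 ≤ n → 2 ≤ S →
        ∀ (y : Fin S → ℂ) (α : ℝ), 0 < α → ∑ k, ‖y k‖ ≤ α →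
        ∀ g : (Fin n → Bool) → ℝ, (∀ b, Spectral.monomialSum y b = (g b : ℂ)) →
        ∀ (d : ℕ) (P : Polynomial ℝ), 1 ≤ d → P.natDegree = d →
        (∀ x ∈ Set.Icc (-1 : ℝ) 1, |P.eval x| ≤ 1) →
        ((∀ x : ℝ, P.eval (-x) = (-1) ^ d * P.eval x) →
          ∃ (a : ℕ) (c : Spectral.Circuit (Fin n ⊕ Fin a)),
            Spectral.IsBlockEncoding 1 c.matrix (Spectral.composedDiag P g α) ∧
            (a : ℝ) ≤ K * (S + Spectral.lg n) ∧
            (c.rotDepth : ℝ) ≤ Spectral.composedMonomialRot S n * d ∧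
            (c.tofDepth : ℝ) ≤ Spectral.composedMonomialTof S n * d) ∧
        ∃ (a : ℕ) (c : Spectral.Circuit (Fin n ⊕ Fin a)),
          Spectral.IsBlockEncoding 2 c.matrix (Spectral.composedDiag P g α) ∧
          (a : ℝ) ≤ K * (S + Spectral.lg n) ∧
          (c.rotDepth : ℝ) ≤ 2 * (Spectral.composedMonomialRot S n * d) ∧
          (c.tofDepth : ℝ) ≤ 2 * (Spectral.composedMonomialTof S n * d)) := by
  obtain ⟨K₁, h1⟩ := Spectral.exists_general_blockEncoding
  obtain ⟨K₂, h2⟩ := Spectral.exists_polynomial_blockEncoding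
  -- The summand `2` pays for the two ancillas of the Fourier circuits.
  refine ⟨K₁ + K₂ + 2, ?_, ?_, ?_, ?_, ?_⟩
  · intro n a S C hS hC φ _ β hφ y α hα hy
    obtain ⟨b, c, hc, hb, hd⟩ := h1 n a S C hS hC φ β hφ y α hα hy
    exact ⟨b, c, hc, hb.trans (Nat.mul_le_mul_right _ (by omega)),
      hd.trans (Nat.mul_le_mul_right _ (by omega))⟩
  · intro n S hn hS k₀ y α hα hy
    obtain ⟨c, hc, hr, ht⟩ := Spectral.isBlockEncoding_fourierSum hn hS k₀ y hα hy
    exact ⟨2, c, hc, by nlinarith, hr, ht⟩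
  · intro n S hn hS y α hα hy
    obtain ⟨a, c, hc, ha, hr, ht⟩ := Spectral.exists_monomial_blockEncoding hn hS y hα hy
      (h2 n (S - 1) (by omega))
    exact ⟨a, c, hc, Spectral.le_mul_add_lg hn (by omega) ha, hr, ht⟩
  · intro n S hn hS k₀ y α hα hy g hg d P hd1 hd hP
    refine ⟨fun hpar => ?_, ?_⟩
    · obtain ⟨c, hc, hr, ht⟩ := Spectral.isBlockEncoding_parity_fourierSum hn hS k₀ y hα hy g hg P
        hd1 hd hP hpar
      exact ⟨2, c, hc, by nlinarith, hr, ht⟩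
    · obtain ⟨c, hc, hr, ht⟩ := Spectral.isBlockEncoding_composed_fourierSum hn hS k₀ y hα hy g hg
        P hd1 hd hP
      exact ⟨2, c, hc, by nlinarith, hr, ht⟩
  · intro n S hn hS y α hα hy g hg d P hd1 hd hP
    refine ⟨fun _ => ?_, ?_⟩
    · obtain ⟨a, c, hc, ha, hr, ht⟩ := Spectral.exists_composed_monomial_blockEncoding hn hS y hα
        hy g hg P hd1 hd hP le_rfl (h2 n (d * (S - 1)) (by omega))
      exact ⟨a, c, hc, Spectral.le_mul_add_lg hn (by omega) ha, hr, ht⟩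
    · obtain ⟨a, c, hc, ha, hr, ht⟩ := Spectral.exists_composed_monomial_blockEncoding hn hS y hα
        hy g hg P hd1 hd hP one_le_two (h2 n (d * (S - 1)) (by omega))
      refine ⟨a, c, hc, Spectral.le_mul_add_lg hn (by omega) ha, ?_, ?_⟩
      · have : (0 : ℝ) ≤ c.rotDepth := Nat.cast_nonneg _
        linarith
      · have : (0 : ℝ) ≤ c.tofDepth := Nat.cast_nonneg _
        linarith
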